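/- **Theorem 3.2.** Let $\mathcal A$ be a small DG category over a field $\mathbb k$ and let $n\ge 1$ be invertible in $\mathbb k$. Let $C_\bullet(\mathcal A)$ be the Hochschild complex, with $C_{m-1}(\mathcal A)$ spanned by chains $\underline\alpha=(\alpha_1,\dots,\alpha_m)$ of cyclically composable morphisms. Let $C_\bullet(\mathcal A^{\otimes n};t_n)$ be the Hochschild complex of $\mathcal A^{\otimes n}$ twisted by the functor $t_n\colon a_1\otimes\dots\otimes a_n\mapsto a_n\otimes a_1\otimes\dots\otimes a_{n-1}$, and $C_\bullet(\mathcal A^{\otimes n};t_n)_{t_n}$ its quotient by the subspace spanned by all $\xi-t_n\xi$. We write a chain $(\alpha_{11}\otimes\dots\otimes\alpha_{1n})\otimes\dots\otimes(\alpha_{m1}\otimes\dots\otimes\alpha_{mn})$ of $C_{m-1}(\mathcal A^{\otimes n};t_n)$ as an $m\times n$ matrix; its entries are cyclically composable down each column and then from the top of the next column. The differential of each complex is the total one (the Hochschild differential plus the one induced by the differential of $\mathcal A$), and rearrangements of morphisms carry Koszul signs, which are not displayed. For $c\in\{1,\dots,l\}^r$ let $\sigma_c\in S_r$ send $i$ to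 the number of $k$ with $c_k<c_i$, or with $c_k=c_i$ and $k\le i$, and let $N_{r,l}=\sum_{c\in\{1,\dots,l\}^r}(-1)^{\sigma_c}$ (so $N_{0,l}=1$, and $N_{r,0}=0$ for $r\ge1$). Let $Y_{p,q}=\binom{\lfloor (p+q)/2\rfloor}{\lfloor p/2\rfloor}$ if $p$ or $q$ is even and $Y_{p,q}=0$ otherwise. For $m,p\ge1$, $q\ge0$, $p+q\le m$ set $$T^{p,q}_{m,n}=\tfrac1n(-1)^{(p-1)(m-p-q)}\,Y_{p-1,q}\sum_{s=1}^nN_{p-1,s-1}N_{q,n-s}.$$ Define $$f_n\colon C_\bullet(\mathcal A^{\otimes n};t_n)_{t_n}\to C_\bullet(\mathcal A),\qquad (\alpha_{ij})\mapsto\frac1n\sum_{s=1}^n(\alpha_{1(s+1)}\cdots\alpha_{m(s-1)}\alpha_{1s},\ \alpha_{2s},\dots,\alpha_{ms}),$$ where the first entry is the composite, in the cyclic order, of all the entries outside the column $s$ followed by $\alpha_{1s}$ (column indices mod $n$), and $$g_n\colon C_\bullet(\mathcal A)\to C_\bullet(\mathcal A^{\otimes n};t_n)_{t_n},\qquad (\alpha_1,\dots,\alpha_m)\mapsto\sum_{c\in\{1,\dots,n\}^m,\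 c_1=1}(-1)^{\sigma_c}(\beta_{ij}),$$ where $\beta_{ic_i}=\alpha_{\sigma_c(i)}$ and $\beta_{ij}=\mathrm{id}$ for $j\ne c_i$. Define the degree $-1$ map $\Psi_n\colon C_\bullet(\mathcal A)\to C_\bullet(\mathcal A)$ by $$\Psi_n(\alpha_1,\dots,\alpha_m)=(-1)^m\sum_{\substack{1\le p\le m,\ 0\le q\le m-p\\ p+q\text{ even}}}T^{p,q}_{m,n}\ \mathrm{shfl}\big((\alpha_{m-q+1}\cdots\alpha_m\alpha_1\cdots\alpha_p,\ \alpha_{p+1},\dots,\alpha_{m-q}),\ 1^{\otimes(p+q+1)}\big),$$ where $\mathrm{shfl}(\underline\gamma,1^{\otimes(r+1)})$, for a chain $\underline\gamma=\gamma_0\otimes\dots\otimes\gamma_l$, is the sum over all $(l,r)$-shuffles $\sigma$ of $(-1)^\sigma$ times the chain obtained from $\underline\gamma$ by keeping $\gamma_0$ in front, placing $\gamma_i$ in the position $\sigma(i)$, and filling the other $r$ positions with identities. Then $f_n$ and $g_n$ are well-defined morphisms of complexes, and $$d\Psi_n+\Psi_nd=f_ng_n-\mathrm{id}.$$ Moreover,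 there is a degree $-1$ map $\Phi_n$ on $C_\bullet(\mathcal A^{\otimes n};t_n)_{t_n}$ with $d\Phi_n+\Phi_nd=g_nf_n-\mathrm{id}$. Hence $f_n$ and $g_n$ are mutually inverse homotopy equivalences. -/

import Mathlib

open CategoryTheory
open scoped BigOperators

universe w v u

attribute [local instance 2000] CategoryTheory.CategoryStruct.toQuiver

/-- A (small) DG category over a field `k`: a `k`-linear category whose morphism spaces are
`ℤ`-graded and carry a differential of degree `+1` satisfying the graded Leibniz rule.
In the notation `αβ` for the composite of `β` followed by `α` (in Lean: `β ≫ α`), the Leibniz rule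
is `d(αβ) = (dα)β + (-1)^{|α|} α(dβ)`. -/
class DGCategory (k : Type w) [Field k] (A : Type u) [Category.{v} A] [Preadditive A]
    [Linear k A] where
  /-- the morphisms of degree `i` -/
  grade : ∀ X Y : A, ℤ → Submodule k (X ⟶ Y)
  /-- every morphism space is the direct sum of its homogeneous parts -/
  isInternal : ∀ X Y : A, DirectSum.IsInternal (grade X Y)
  id_mem : ∀ X : A, 𝟙 X ∈ grade X X 0
  comp_mem : ∀ {X Y Z : A} {i j : ℤ} {β : X ⟶ Y} {α : Y ⟶ Z},
    β ∈ grade X Y i → α ∈ grade Y Z j → β ≫ α ∈ grade X Z (i + j)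
  /-- the differential -/
  diff : ∀ X Y : A, (X ⟶ Y) →ₗ[k] (X ⟶ Y)
  diff_mem : ∀ {X Y : A} {i : ℤ} {α : X ⟶ Y}, α ∈ grade X Y i → diff X Y α ∈ grade X Y (i + 1)
  diff_diff : ∀ {X Y : A} (α : X ⟶ Y), diff X Y (diff X Y α) = 0
  leibniz : ∀ {X Y Z : A} {i : ℤ} (β : X ⟶ Y) (α : Y ⟶ Z), α ∈ grade Y Z i →
    diff X Z (β ≫ α) = β ≫ diff Y Z α + ((Int.negOnePow i : ℤˣ) : ℤ) • (diff X Y β ≫ α)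

namespace DGHochschild

/-! ### Positions in a matrix and their composable order -/

/-- Positions in a matrix with `m + 1` rows and `n` columns (both numbered from `0`). -/
abbrev Idx (m n : ℕ) : Type := Fin (m + 1) × Fin n

/-- The successor of a position in the cyclic composable order: down each column, then to the top
of the next column, and from the bottom of the last column to the top of the first one. -/
def next {m n : ℕ} [NeZero n] (x : Idx m n) : Idx m n :=
  if x.1 = Fin.last m then (0, x.2 + 1) else (x.1 + 1, x.2)

/-- The reading order of a matrix, row after row and each row from left to right: the order of
the tensor factors in `(α₁₁ ⊗ ⋯ ⊗ α₁ₙ) ⊗ (α₂₁ ⊗ ⋯ ⊗ α₂ₙ) ⊗ ⋯`. -/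
def ReadLT {m n : ℕ} (x y : Idx m n) : Prop := x.1 < y.1 ∨ (x.1 = y.1 ∧ x.2 < y.2)

/-- The (linear) order of the positions down each column, the columns from left to right. -/
def ColLT {m n : ℕ} (x y : Idx m n) : Prop := x.2 < y.2 ∨ (x.2 = y.2 ∧ x.1 < y.1)

section nextLemmas

variable {m n : ℕ} [NeZero n]

theorem fin_last_add_one (m : ℕ) : (Fin.last m + 1 : Fin (m + 1)) = 0 := by
  simp

theorem next_last (j : Fin n) : next ((Fin.last m, j) : Idx m n) = (0, j + 1) := by
  simp [next]

theorem next_of_ne {i : Fin (m + 1)} (h : i ≠ Fin.last m) (j : Fin n) :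
    next ((i, j) : Idx m n) = (i + 1, j) := by
  simp [next, h]

theorem next_fst (x : Idx m n) : (next x).1 = x.1 + 1 := by
  unfold next; split_ifs with h
  · simp [h]
  · rfl

theorem next_iter_down (i : ℕ) (hi : i < m + 1) (j : Fin n) :
    next^[i] ((0, j) : Idx m n) = (⟨i, hi⟩, j) := by
  induction i with
  | zero => rfl
  | succ i ih =>
    rw [Function.iterate_succ_apply', ih (by omega), next_of_ne]
    · congr 1; apply Fin.ext
      rw [Fin.val_add_one_of_lt' (by simpa using hi)]
    · intro h; have := congrArg Fin.val h; simp at this; omega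

theorem next_iter_col (j : Fin n) :
    next^[m + 1] ((0, j) : Idx m n) = (0, j + 1) := by
  rw [Function.iterate_succ_apply', next_iter_down m (by omega)]
  exact next_last j

theorem next_iter_cols (c : ℕ) (j : Fin n) :
    next^[c * (m + 1)] ((0, j) : Idx m n) = (0, j + Fin.ofNat n c) := by
  induction c with
  | zero => simp
  | succ c ih =>
    rw [Nat.succ_mul, Nat.add_comm, Function.iterate_add_apply, ih, next_iter_col]
    congr 1; apply Fin.ext; simp [Fin.val_add, Fin.ofNat, add_assoc]

theorem exists_iter_zero (x : Idx m n) :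
    ∃ d, next^[d] ((0, 0) : Idx m n) = x := by
  refine ⟨x.1.val + x.2.val * (m + 1), ?_⟩
  rw [Function.iterate_add_apply, next_iter_cols, next_iter_down _ x.1.isLt]
  ext <;> simp [Fin.ofNat, Nat.mod_eq_of_lt]

theorem next_iter_all : next^[n * (m + 1)] = (id : Idx m n → Idx m n) := by
  have h0 : next^[n * (m + 1)] ((0, 0) : Idx m n) = (0, 0) := by
    rw [next_iter_cols]; congr 1; apply Fin.ext; simp [Fin.ofNat]
  funext x
  obtain ⟨d, rfl⟩ := exists_iter_zero x
  rw [← Function.iterate_add_apply, Nat.add_comm, Function.iterate_add_apply, h0]; rfl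

theorem exists_iter (x y : Idx m n) : ∃ d < n * (m + 1), next^[d] x = y := by
  have hN : 0 < n * (m + 1) := Nat.mul_pos (Nat.pos_of_ne_zero (NeZero.ne n)) (by omega)
  obtain ⟨a, rfl⟩ := exists_iter_zero x
  obtain ⟨b, rfl⟩ := exists_iter_zero y
  have hp : ∀ c, (next^[n * (m + 1) * c] : Idx m n → Idx m n) = id := by
    intro c; rw [Function.iterate_mul, next_iter_all]; exact Function.iterate_id c
  have hmod : ∀ d (z : Idx m n), next^[d % (n * (m + 1))] z = next^[d] z := by
    intro d z
    conv_rhs => rw [← Nat.mod_add_div d (n * (m + 1))]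
    rw [Function.iterate_add_apply, hp]; rfl
  refine ⟨(b + (n * (m + 1) * a - a)) % (n * (m + 1)), Nat.mod_lt _ hN, ?_⟩
  rw [hmod, ← Function.iterate_add_apply]
  have : b + (n * (m + 1) * a - a) + a = b + n * (m + 1) * a := by
    have : a ≤ n * (m + 1) * a := Nat.le_mul_of_pos_left a hN
    omega
  rw [this, Function.iterate_add_apply, hp]; rfl

end nextLemmas

theorem next_single {m : ℕ} (r : Fin (m + 1)) (j : Fin 1) :
    next ((r, j) : Idx m 1) = (r + 1, j) := by
  refine Prod.ext (next_fst _) (Subsingleton.elim _ _)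

theorem next_iter_single {m : ℕ} (l : ℕ) (r : Fin (m + 1)) (j : Fin 1) :
    next^[l] ((r, j) : Idx m 1) = (r + Fin.ofNat (m + 1) l, j) := by
  induction l with
  | zero => simp
  | succ l ih =>
    rw [Function.iterate_succ_apply', ih, next_single]
    congr 1; apply Fin.ext; simp [Fin.val_add, Fin.ofNat, add_assoc]

/-! ### Regrouping the entries of a matrix -/

/-- A recipe for making a matrix with `m' + 1` rows and `n'` columns out of one with `m + 1` rows
and `n` columns: the entry at the position `y` of the new matrix is the composite
`α_x α_{next x} α_{next (next x)} ⋯` of `len y` consecutive entries of the old matrix, beginning at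
the position `x = start y`; it is an identity morphism if `len y = 0`. The entries of the new matrix
have to be composable in their own cyclic order (`chain`), and every entry of the old matrix is used
exactly once (`total`, see `slot_bijective`). -/
structure Regrouping (n m n' m' : ℕ) [NeZero n] [NeZero n'] where
  start : Idx m' n' → Idx m n
  len : Idx m' n' → ℕ
  chain : ∀ y, next^[len y] (start y) = start (next y)
  total : ∑ y, len y = n * (m + 1)

namespace Regrouping

variable {n m n' m' : ℕ} [NeZero n] [NeZero n'] (R : Regrouping n m n' m')

/-- The old position used as the `o`-th factor of the entry at the new position `y`. -/
def slot (p : Σ y : Idx m' n', Fin (R.len y)) : Idx m n := next^[(p.2 : ℕ)] (R.start p.1)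

theorem slot_surjective : Function.Surjective R.slot := by
  intro x
  set y : ℕ → Idx m' n' := fun j => next^[j] (0, 0) with hy
  set S : ℕ → ℕ := fun j => ∑ i ∈ Finset.range j, R.len (y i) with hS
  have hstart : ∀ j, R.start (y j) = next^[S j] (R.start (y 0)) := by
    intro j
    induction j with
    | zero => simp [hS]
    | succ j ih =>
      have h1 : y (j + 1) = next (y j) := Function.iterate_succ_apply' _ _ _
      have h2 : S (j + 1) = R.len (y j) + S j := by
        simp only [hS]; rw [Finset.sum_range_succ, Nat.add_comm]
      rw [h1, h2, Function.iterate_add_apply, ← ih, R.chain]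
  have htot : S (n' * (m' + 1)) = n * (m + 1) := by
    rw [← R.total]
    have hs : Function.Surjective (fun j : Fin (n' * (m' + 1)) => y j) := by
      intro z
      obtain ⟨d, hd, h⟩ := exists_iter ((0, 0) : Idx m' n') z
      exact ⟨⟨d, hd⟩, h⟩
    have hb : Function.Bijective (fun j : Fin (n' * (m' + 1)) => y j) := by
      rw [Fintype.bijective_iff_surjective_and_card]
      exact ⟨hs, by simp [Nat.mul_comm]⟩
    rw [← (Equiv.ofBijective _ hb).sum_comp, hS]
    simp only [Equiv.ofBijective_apply]
    exact Finset.sum_range (fun i => R.len (y i))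
  obtain ⟨d, hd, hx⟩ := exists_iter (R.start (y 0)) x
  have hex : ∃ j, d < S j := ⟨_, htot ▸ hd⟩
  classical
  obtain ⟨j, hj⟩ : ∃ j, Nat.find hex = j + 1 := by
    refine Nat.exists_eq_succ_of_ne_zero ?_
    intro h0
    have := Nat.find_spec hex
    rw [h0] at this; simp [hS] at this
  have h1 : d < S (j + 1) := hj ▸ Nat.find_spec hex
  have h2 : S j ≤ d := not_lt.1 (Nat.find_min hex (by omega))
  have h3 : S (j + 1) = S j + R.len (y j) := Finset.sum_range_succ _ _
  refine ⟨⟨y j, ⟨d - S j, by omega⟩⟩, ?_⟩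
  simp only [slot]
  rw [hstart, ← Function.iterate_add_apply, Nat.sub_add_cancel h2, hx]

theorem slot_bijective : Function.Bijective R.slot := by
  rw [Fintype.bijective_iff_surjective_and_card]
  refine ⟨R.slot_surjective, ?_⟩
  simp [R.total, Nat.mul_comm]

/-- Where an entry of the old matrix goes: the new position and the index of the factor in it. -/
noncomputable def place (x : Idx m n) : Σ y : Idx m' n', Fin (R.len y) :=
  (Equiv.ofBijective R.slot R.slot_bijective).symm x

/-- The order in which the old entries are met when the new matrix is read row after row (and the
factors of each composite from left to right). -/
def NewReadLT (x x' : Idx m n) : Prop :=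
  ReadLT (R.place x).1 (R.place x').1 ∨
    ((R.place x).1 = (R.place x').1 ∧ ((R.place x).2 : ℕ) < ((R.place x').2 : ℕ))

open Classical in
/-- The Koszul sign of the rearrangement, for entries whose degrees have the parities `p`:
a factor `-1` for every pair of odd entries whose order is reversed. -/
noncomputable def koszul (p : Idx m n → ZMod 2) : ℤ :=
  ∏ x, ∏ x', if ReadLT x x' ∧ R.NewReadLT x' x ∧ p x = 1 ∧ p x' = 1 then -1 else 1

end Regrouping

/-! ### Chains -/

section chains

variable (k : Type w) [Field k] (A : Type u) [Category.{v} A] [Preadditive A] [Linear k A]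

/-- The space `⨁ ⨂_{ij} Hom(a_{next(i,j)}, a_{ij})` of `(m + 1) × n` matrices of cyclically
composable morphisms `α_{ij} : a_{next(i,j)} ⟶ a_{ij}`, the sum being over all families `a` of
objects. Written out, it is the `m`-th term
`⨁_{a₀,…,aₘ} (ₜA^{⊗n})(a₀,a₁) ⊗ A^{⊗n}(a₁,a₂) ⊗ ⋯ ⊗ A^{⊗n}(aₘ,a₀)` of the Hochschild complex
of `A^{⊗n}` with coefficients in the diagonal bimodule twisted by the cyclic permutation functor
`t : (a₁,…,aₙ) ↦ (aₙ,a₁,…,aₙ₋₁)`, whose rows are the tensor factors `α_{i1} ⊗ ⋯ ⊗ α_{in}`.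
For `n = 1` it is the `m`-th term `⨁ A(a₀,a₁) ⊗ ⋯ ⊗ A(aₘ,a₀)` of the Hochschild complex of `A`. -/
def Chain (n m : ℕ) [NeZero n] : Type _ :=
  DirectSum (Idx m n → A) fun a => PiTensorProduct k fun x : Idx m n => (a (next x) ⟶ a x)

noncomputable instance (n m : ℕ) [NeZero n] : AddCommGroup (Chain k A n m) :=
  inferInstanceAs (AddCommGroup (DirectSum (Idx m n → A) fun a =>
    PiTensorProduct k fun x : Idx m n => (a (next x) ⟶ a x)))

noncomputable instance (n m : ℕ) [NeZero n] : Module k (Chain k A n m) :=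
  inferInstanceAs (Module k (DirectSum (Idx m n → A) fun a =>
    PiTensorProduct k fun x : Idx m n => (a (next x) ⟶ a x)))

variable {A}

open Classical in
/-- The inclusion of the summand of a family of objects. -/
noncomputable def Chain.single {n m : ℕ} [NeZero n] (a : Idx m n → A) :
    (PiTensorProduct k fun x : Idx m n => (a (next x) ⟶ a x)) →ₗ[k] Chain k A n m :=
  DirectSum.lof k (Idx m n → A)
    (fun a => PiTensorProduct k fun x : Idx m n => (a (next x) ⟶ a x)) a

open Classical in
/-- The linear map on chains with given restrictions to the summands. -/
noncomputable def Chain.desc {n m : ℕ} [NeZero n] {M : Type*} [AddCommGroup M] [Module k M]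
    (φ : ∀ a : Idx m n → A, (PiTensorProduct k fun x : Idx m n => (a (next x) ⟶ a x)) →ₗ[k] M) :
    Chain k A n m →ₗ[k] M :=
  DirectSum.toModule k (Idx m n → A) M φ

theorem Chain.desc_single {n m : ℕ} [NeZero n] {M : Type*} [AddCommGroup M] [Module k M]
    (φ : ∀ a : Idx m n → A, (PiTensorProduct k fun x : Idx m n => (a (next x) ⟶ a x)) →ₗ[k] M)
    (a : Idx m n → A) (ξ : PiTensorProduct k fun x : Idx m n => (a (next x) ⟶ a x)) :
    Chain.desc k φ (Chain.single k a ξ) = φ a ξ := by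
  classical exact DFinsupp.sumAddHom_single (fun a => (φ a).toAddMonoidHom) a ξ

/-- The basic chain given by a matrix of composable morphisms. -/
noncomputable def basic {n m : ℕ} [NeZero n] (a : Idx m n → A)
    (α : ∀ x : Idx m n, (a (next x) ⟶ a x)) : Chain k A n m :=
  Chain.single k a (PiTensorProduct.tprod k α)

end chains

section run

variable {A : Type u} [Category.{v} A] {n m : ℕ} [NeZero n]

/-- The composite `α_x α_{next x} ⋯` of `l` consecutive entries beginning at the position `x`. -/
def run {a : Idx m n → A} (α : ∀ x : Idx m n, (a (next x) ⟶ a x)) :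
    ∀ (l : ℕ) (x : Idx m n), (a (next^[l] x) ⟶ a x)
  | 0, x => 𝟙 (a x)
  | l + 1, x => @CategoryStruct.comp A _ (a (next^[l] (next x))) _ _ (run α l (next x)) (α x)

theorem run_update_of_notMem [DecidableEq (Idx m n)] {a : Idx m n → A}
    (α : ∀ x : Idx m n, (a (next x) ⟶ a x)) (x : Idx m n) (u : a (next x) ⟶ a x)
    (l : ℕ) (z : Idx m n) (h : ∀ o < l, next^[o] z ≠ x) :
    run (Function.update α x u) l z = run α l z := by
  induction l generalizing z with
  | zero => rfl
  | succ l ih =>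
    have h0 : z ≠ x := h 0 (by omega)
    simp only [run]
    rw [Function.update_of_ne h0, ih (next z) (fun o ho => h (o + 1) (by omega))]

theorem run_update_linear [Preadditive A] {k : Type w} [Field k] [Linear k A]
    [DecidableEq (Idx m n)] {a : Idx m n → A}
    (α : ∀ x : Idx m n, (a (next x) ⟶ a x)) (x : Idx m n)
    (l : ℕ) (z : Idx m n) (o : ℕ) (ho : o < l) (hx : next^[o] z = x)
    (huniq : ∀ o' < l, next^[o'] z = x → o' = o) :
    (∀ u v : a (next x) ⟶ a x, run (Function.update α x (u + v)) l z =
      run (Function.update α x u) l z + run (Function.update α x v) l z) ∧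
    (∀ (c : k) (u : a (next x) ⟶ a x), run (Function.update α x (c • u)) l z =
      c • run (Function.update α x u) l z) := by
  induction l generalizing z o with
  | zero => omega
  | succ l ih =>
    rcases o with _ | o
    · obtain rfl : z = x := hx
      have hn : ∀ o < l, next^[o] (next z) ≠ z := by
        intro o ho h
        exact absurd (huniq (o + 1) (by omega) h) (by omega)
      simp only [run, Function.update_self, run_update_of_notMem α z _ l (next z) hn]
      exact ⟨fun u v => Preadditive.comp_add _ _ _ _ _ _, fun c u => Linear.comp_smul _ _ _ _ _ _⟩
    · have hz : z ≠ x := fun h => absurd (huniq 0 (by omega) h) (by omega)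
      obtain ⟨h1, h2⟩ := ih (next z) o (by omega) hx
        (fun o' ho' h => by have := huniq (o' + 1) (by omega) h; omega)
      simp only [run, Function.update_of_ne hz]
      exact ⟨fun u v => by rw [h1]; exact Preadditive.add_comp _ _ _ _ _ _,
        fun c u => by rw [h2]; exact Linear.smul_comp _ _ _ _ _ _⟩

end run

namespace Regrouping

variable {n m n' m' : ℕ} [NeZero n] [NeZero n'] (R : Regrouping n m n' m')
variable (k : Type w) [Field k] {A : Type u} [Category.{v} A] [Preadditive A] [Linear k A]

/-- The entries of the new matrix. -/
def entry {a : Idx m n → A} (α : ∀ x : Idx m n, (a (next x) ⟶ a x)) (y : Idx m' n') :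
    a (R.start (next y)) ⟶ a (R.start y) :=
  eqToHom (congrArg a (R.chain y).symm) ≫ run α (R.len y) (R.start y)

theorem entry_update [DecidableEq (Idx m n)] [DecidableEq (Idx m' n')] {a : Idx m n → A}
    (α : ∀ x : Idx m n, (a (next x) ⟶ a x)) (x : Idx m n) :
    ∃ y₀ : Idx m' n',
      (∀ u, R.entry (Function.update α x u) =
        Function.update (R.entry α) y₀ (R.entry (Function.update α x u) y₀)) ∧
      (∀ u v : a (next x) ⟶ a x, R.entry (Function.update α x (u + v)) y₀ =
        R.entry (Function.update α x u) y₀ + R.entry (Function.update α x v) y₀) ∧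
      (∀ (c : k) (u : a (next x) ⟶ a x), R.entry (Function.update α x (c • u)) y₀ =
        c • R.entry (Function.update α x u) y₀) := by
  obtain ⟨⟨y₀, o⟩, hp⟩ := R.slot_surjective x
  have huniq : ∀ (y : Idx m' n') (o' : ℕ) (ho' : o' < R.len y), next^[o'] (R.start y) = x →
      y = y₀ ∧ o' = o := by
    intro y o' ho' h
    have := R.slot_bijective.1 (a₁ := ⟨y, ⟨o', ho'⟩⟩) (a₂ := ⟨y₀, o⟩) (by rw [hp]; exact h)
    cases this; exact ⟨rfl, rfl⟩
  refine ⟨y₀, ?_, ?_⟩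
  · intro u
    funext y
    by_cases hy : y = y₀
    · subst hy; simp
    · rw [Function.update_of_ne hy]
      simp only [entry]
      rw [run_update_of_notMem]
      intro o' ho' h
      exact hy (huniq y o' ho' h).1
  · obtain ⟨h1, h2⟩ := run_update_linear (k := k) α x (R.len y₀) (R.start y₀) o o.isLt hp
      (fun o' ho' h => (huniq y₀ o' ho' h).2)
    simp only [entry]
    exact ⟨fun u v => by rw [h1, Preadditive.comp_add], fun c u => by rw [h2, Linear.comp_smul]⟩

/-- The regrouping, without its Koszul sign, as a multilinear map of the entries. -/
noncomputable def multi (a : Idx m n → A) :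
    MultilinearMap k (fun x : Idx m n => (a (next x) ⟶ a x))
      (PiTensorProduct k fun y : Idx m' n' => (a (R.start (next y)) ⟶ a (R.start y))) where
  toFun α := PiTensorProduct.tprod k (R.entry α)
  map_update_add' := by
    classical
    intro inst α x u v
    obtain rfl : inst = instDecidableEqProd := Subsingleton.elim _ _
    obtain ⟨y₀, h0, h1, -⟩ := R.entry_update k α x
    rw [h0 (u + v), h0 u, h0 v, h1]
    exact (PiTensorProduct.tprod k).map_update_add _ _ _ _
  map_update_smul' := by
    classical
    intro inst α x c u
    obtain rfl : inst = instDecidableEqProd := Subsingleton.elim _ _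
    obtain ⟨y₀, h0, -, h2⟩ := R.entry_update k α x
    rw [h0 (c • u), h0 u, h2]
    exact (PiTensorProduct.tprod k).map_update_smul _ _ _ _

end Regrouping

/-! ### Koszul signs and the operators on chains -/

section operators

variable (k : Type w) [Field k] {A : Type u} [Category.{v} A] [Preadditive A] [Linear k A]
  [DGCategory k A]

theorem bijective_coe (X Y : A) :
    Function.Bijective (DirectSum.coeLinearMap (DGCategory.grade (k := k) X Y)) :=
  DGCategory.isInternal X Y

/-- The projection of a morphism space onto its part of even (`p = 0`) or odd (`p = 1`) degree. -/
noncomputable def parityProj (X Y : A) (p : ZMod 2) : (X ⟶ Y) →ₗ[k] (X ⟶ Y) :=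
  (DirectSum.toModule k ℤ (X ⟶ Y) fun i =>
      if (i : ZMod 2) = p then (DGCategory.grade (k := k) X Y i).subtype else 0) ∘ₗ
    (LinearEquiv.ofBijective (DirectSum.coeLinearMap (DGCategory.grade (k := k) X Y))
      (bijective_coe k X Y)).symm.toLinearMap

variable {k} in
/-- The linear map that a regrouping induces on chains. On a matrix of homogeneous morphisms it is
the Koszul sign times the regrouped matrix (the sum over `p` splits each entry into its even and
its odd part; for homogeneous entries one summand survives). -/
noncomputable def Regrouping.map {n m n' m' : ℕ} [NeZero n] [NeZero n']
    (R : Regrouping n m n' m') : Chain k A n m →ₗ[k] Chain k A n' m' :=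
  Chain.desc k fun a =>
    Chain.single k (fun y => a (R.start y)) ∘ₗ
      PiTensorProduct.lift (∑ p : Idx m n → ZMod 2, (R.koszul p : k) •
        (R.multi k a).compLinearMap fun x => parityProj k (a (next x)) (a x) (p x))

theorem parityProj_of_mem {X Y : A} {i : ℤ} {α : X ⟶ Y}
    (h : α ∈ DGCategory.grade (k := k) X Y i) (p : ZMod 2) :
    parityProj k X Y p α = if (i : ZMod 2) = p then α else 0 := by
  have e : (LinearEquiv.ofBijective (DirectSum.coeLinearMap (DGCategory.grade (k := k) X Y))
      (bijective_coe k X Y)).symm α =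
      DirectSum.lof k ℤ (fun i => DGCategory.grade (k := k) X Y i) i ⟨α, h⟩ := by
    rw [LinearEquiv.symm_apply_eq, LinearEquiv.ofBijective_apply]
    exact (DirectSum.coeLinearMap_lof _ i ⟨α, h⟩).symm
  simp only [parityProj, LinearMap.comp_apply, LinearEquiv.coe_coe, e, DirectSum.toModule_lof]
  split_ifs <;> simp

variable {k} in
/-- On a matrix of homogeneous morphisms a regrouping acts by the Koszul sign times the regrouped
matrix. -/
theorem Regrouping.map_basic {n m n' m' : ℕ} [NeZero n] [NeZero n'] (R : Regrouping n m n' m')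
    (a : Idx m n → A) (α : ∀ x : Idx m n, (a (next x) ⟶ a x)) (δ : Idx m n → ℤ)
    (hδ : ∀ x, α x ∈ DGCategory.grade (k := k) (a (next x)) (a x) (δ x)) :
    R.map (basic k a α) =
      (R.koszul (fun x => (δ x : ZMod 2)) : k) • basic k (fun y => a (R.start y)) (R.entry α) := by
  rw [basic, Regrouping.map, Chain.desc_single, LinearMap.comp_apply, PiTensorProduct.lift.tprod,
    sum_apply, Finset.sum_eq_single (fun x => (δ x : ZMod 2))]
  · rw [smul_apply, MultilinearMap.compLinearMap_apply, map_smul]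
    congr 2
    have : (fun x => parityProj k (a (next x)) (a x) (δ x : ZMod 2) (α x)) = α := by
      funext x; rw [parityProj_of_mem k (hδ x), if_pos rfl]
    rw [this]; rfl
  · intro p _ hp
    obtain ⟨x, hx⟩ : ∃ x, (δ x : ZMod 2) ≠ p x := by
      by_contra! h; exact hp (funext fun x => (h x).symm)
    rw [smul_apply, MultilinearMap.compLinearMap_apply,
      MultilinearMap.map_coord_zero _ x (by rw [parityProj_of_mem k (hδ x), if_neg hx]), smul_zero]
  · simp

open Classical in
/-- The differential of the tensor product of complexes `⨂ Hom(a_{next x}, a_x)`: the sum over all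
positions `x` of the chains where `α_x` is replaced by `d α_x`, with the sign `(-1)^{|α_y|}` for
every position `y` read before `x`. -/
noncomputable def internalDiff (n m : ℕ) [NeZero n] : Chain k A n m →ₗ[k] Chain k A n m :=
  Chain.desc k fun a =>
    Chain.single k a ∘ₗ
      ∑ x : Idx m n, PiTensorProduct.map fun y =>
        if ReadLT y x then parityProj k (a (next y)) (a y) 0 - parityProj k (a (next y)) (a y) 1
        else if y = x then DGCategory.diff (a (next y)) (a y)
        else LinearMap.id

end operators

/-! ### The regroupings that occur in the construction -/

theorem sum_idx {n m : ℕ} (F : Fin (m + 1) → ℕ) :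
    ∑ y : Idx m n, F y.1 = n * ∑ r, F r := by
  rw [Fintype.sum_prod_type]
  simp [Finset.mul_sum]

theorem sum_ite_zero (m c : ℕ) (i : Fin (m + 1)) :
    ∑ r : Fin (m + 1), (if r = i then c + 1 else 1) = m + c + 1 := by
  have : ∀ r : Fin (m + 1), (if r = i then c + 1 else 1) = (if r = i then c else 0) + 1 := by
    intro r; split_ifs <;> rfl
  simp only [this, Finset.sum_add_distrib]
  simp; omega

/-- Composing the rows `i` and `i + 1` (numbered from `0`) in `A^{⊗n}`, that is, entry by entry:
`(α₁ ⊗ ⋯ ⊗ αₙ)(β₁ ⊗ ⋯ ⊗ βₙ) = ± α₁β₁ ⊗ ⋯ ⊗ αₙβₙ`. The sign is the Koszul sign of the regrouping. -/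
def faceRegrouping (n m : ℕ) [NeZero n] (i : Fin (m + 1)) : Regrouping n (m + 1) n m where
  start y := (i.succ.succAbove y.1, y.2)
  len y := if y.1 = i then 2 else 1
  chain := by
    have hn : ∀ (M : ℕ) (r : Fin (M + 1)) (j : Fin n), next ((r, j) : Idx M n) =
        if h : (r : ℕ) < M then (⟨r + 1, by omega⟩, j) else (0, j + 1) := by
      intro M r j
      split_ifs with h
      · rw [next_of_ne (by intro h'; rw [h'] at h; simp at h)]
        congr 1; apply Fin.ext
        rw [Fin.val_add_one_of_lt' (by omega)]
      · have : r = Fin.last M := by apply Fin.ext; simp; omega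
        rw [this, next_last]
    rintro ⟨r, j⟩
    have hs : ∀ r : Fin (m + 1), i.succ.succAbove r =
        if (r : ℕ) ≤ i then ⟨r, by omega⟩ else ⟨r + 1, by omega⟩ := by
      intro r
      split_ifs with h
      · rw [Fin.succAbove_of_castSucc_lt _ _ (by simp [Fin.lt_def]; omega)]; rfl
      · rw [Fin.succAbove_of_le_castSucc _ _ (by simp [Fin.le_def]; omega)]; rfl
    have h0 : i.succ.succAbove 0 = (0 : Fin (m + 2)) := by
      rw [hs]; simp
    have key0 : next ((⟨r, by omega⟩, j) : Idx (m + 1) n) = (⟨r + 1, by omega⟩, j) := by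
      rw [hn, dif_pos r.isLt]
    have key : ∀ h : (r : ℕ) < m + 1,
        next ((⟨r + 1, by omega⟩, j) : Idx (m + 1) n) =
          (if h : (r : ℕ) < m then (⟨r + 2, by omega⟩, j) else (0, j + 1)) := by
      intro _
      rw [hn]
      simp only [Nat.add_lt_add_iff_right]
    simp only
    by_cases hm : (r : ℕ) < m
    · have e : next ((r, j) : Idx m n) = (⟨r + 1, by omega⟩, j) := by rw [hn, dif_pos hm]
      rw [e]
      simp only [hs]
      rcases lt_trichotomy (r : ℕ) (i : ℕ) with h | h | h
      · rw [if_neg (fun h' => by rw [h'] at h; exact lt_irrefl _ h), if_pos h.le,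
          if_pos (by simpa using h), Function.iterate_one, key0]
      · rw [if_pos (Fin.ext h), if_pos h.le, if_neg (by simp; omega)]
        simp only [Function.iterate_succ_apply', Function.iterate_zero, id]
        rw [key0, key r.isLt, dif_pos hm]
      · rw [if_neg (fun h' => by rw [h'] at h; exact lt_irrefl _ h), if_neg (by omega),
          if_neg (by simp; omega), Function.iterate_one, key r.isLt, dif_pos hm]
    · have e : next ((r, j) : Idx m n) = (0, j + 1) := by rw [hn, dif_neg hm]
      rw [e, h0]
      simp only [hs]
      by_cases h : r = i
      · rw [if_pos h, if_pos (by rw [h])]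
        simp only [Function.iterate_succ_apply', Function.iterate_zero, id]
        rw [key0, key r.isLt, dif_neg hm]
      · have hne : (r : ℕ) ≠ i := fun h' => h (Fin.ext h')
        rw [if_neg h, if_neg (by omega), Function.iterate_one, key r.isLt, dif_neg hm]
  total := by
    rw [sum_idx (fun r => if r = i then 2 else 1), sum_ite_zero m 1 i]

/-- Composing `t(last row)` with the top row: the entry in the column `j` of the new top row is
`α_{m+1,j-1} α_{0,j}`, and the last row is removed. The Koszul sign of the
regrouping is the product of those of moving the last row to the front, of permuting its factors
by `t`, and of the composition in `A^{⊗n}`. -/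
def lastFaceRegrouping (n m : ℕ) [NeZero n] : Regrouping n (m + 1) n m where
  start y := if y.1 = 0 then (Fin.last (m + 1), y.2 - 1) else (y.1.castSucc, y.2)
  len y := if y.1 = 0 then 2 else 1
  chain := by
    rintro ⟨r, j⟩
    have key : next ((r.castSucc, j) : Idx (m + 1) n) =
        if (next ((r, j) : Idx m n)).1 = 0 then
          (Fin.last (m + 1), (next ((r, j) : Idx m n)).2 - 1)
        else ((next ((r, j) : Idx m n)).1.castSucc, (next ((r, j) : Idx m n)).2) := by
      rw [next_of_ne (Fin.castSucc_lt_last r).ne]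
      by_cases h : r = Fin.last m
      · subst h
        rw [next_last]
        simp
      · have hlt : (r : ℕ) < m := by
          have := Fin.val_lt_last h; simpa using this
        have hv : ((r + 1 : Fin (m + 1)) : ℕ) = r + 1 := Fin.val_add_one_of_lt' (by omega)
        have h0 : (r + 1 : Fin (m + 1)) ≠ 0 := by
          intro h'; rw [h'] at hv; simp at hv
        rw [next_of_ne h]
        simp only [h0, if_false]
        congr 1; apply Fin.ext
        rw [Fin.val_add_one_of_lt' (by simp; omega)]
        simp [hv]
    by_cases h : r = 0
    · subst h
      simp only [if_true, Function.iterate_succ_apply', Function.iterate_zero, id]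
      rw [next_last, sub_add_cancel]
      exact key
    · simp only [h, if_false, Function.iterate_one]
      exact key
  total := by
    rw [sum_idx (fun r => if r = 0 then 2 else 1), sum_ite_zero m 1 0]

/-- The action of `t` on matrices: `(α_{i1}, …, α_{in}) ↦ (α_{in}, α_{i1}, …, α_{i,n-1})` in
every row. -/
def rotateRegrouping (n m : ℕ) [NeZero n] : Regrouping n m n m where
  start y := (y.1, y.2 - 1)
  len _ := 1
  chain := by
    rintro ⟨r, j⟩
    simp only [Function.iterate_one]
    by_cases h : r = Fin.last m
    · subst h; rw [next_last, next_last]; simp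
    · rw [next_of_ne h, next_of_ne h]
  total := by simp [Nat.mul_comm]

/-- The column `s`, with all the other columns composed, in the cyclic order, onto its top entry
from the left. -/
def columnRegrouping (n m : ℕ) [NeZero n] (s : Fin n) : Regrouping n m 1 m where
  start y := if y.1 = 0 then (0, s + 1) else (y.1, s)
  len y := if y.1 = 0 then (n - 1) * (m + 1) + 1 else 1
  chain := by
    rintro ⟨r, j⟩
    have hs : s + 1 + Fin.ofNat n (n - 1) = s := by
      have hn : 0 < n := Nat.pos_of_ne_zero (NeZero.ne n)
      have : (1 : Fin n) + Fin.ofNat n (n - 1) = 0 := by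
        apply Fin.ext
        rw [Fin.val_add]
        simp only [Fin.val_one', Fin.ofNat, Nat.add_mod_mod, Nat.mod_add_mod]
        rw [Nat.add_sub_cancel' hn]; simp
      rw [add_assoc, this, add_zero]
    have key : next ((r, s) : Idx m n) = if r + 1 = 0 then (0, s + 1) else (r + 1, s) := by
      by_cases h : r = Fin.last m
      · subst h; rw [next_last]; simp
      · have hlt : (r : ℕ) < m := by
          have := Fin.val_lt_last h; simpa using this
        have hv : ((r + 1 : Fin (m + 1)) : ℕ) = r + 1 := Fin.val_add_one_of_lt' (by omega)
        have h0 : (r + 1 : Fin (m + 1)) ≠ 0 := by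
          intro h'; rw [h'] at hv; simp at hv
        rw [next_of_ne h, if_neg h0]
    simp only [next_single]
    by_cases h : r = 0
    · subst h
      simp only [if_true, Function.iterate_succ_apply', next_iter_cols, hs]
      exact key
    · simp only [h, if_false, Function.iterate_one]
      exact key
  total := by
    rw [sum_idx (fun r => if r = 0 then (n - 1) * (m + 1) + 1 else 1), sum_ite_zero]
    obtain ⟨N, rfl⟩ := Nat.exists_eq_succ_of_ne_zero (NeZero.ne n)
    simp; ring

open Classical in
/-- Distributing the `m + 1` entries of a column, in order, over a set `S` of `m + 1` positions of
an `(m' + 1) × n'` matrix taken in the order down each column and from left to right; the other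
positions are filled with identities. -/
noncomputable def insertRegrouping (m n' m' : ℕ) [NeZero n'] (S : Finset (Idx m' n'))
    (hS : S.card = m + 1) : Regrouping 1 m n' m' where
  start y := (Fin.ofNat (m + 1) (S.filter fun x => ColLT x y).card, 0)
  len y := if y ∈ S then 1 else 0
  chain := by
    intro y
    rw [next_iter_single]
    congr 1
    have hadd : ∀ a b : ℕ, Fin.ofNat (m + 1) a + Fin.ofNat (m + 1) b =
        Fin.ofNat (m + 1) (a + b) := by
      intro a b; apply Fin.ext; simp [Fin.val_add, Fin.ofNat]
    rw [hadd]
    have hone : (if y ∈ S then 1 else 0) = (S.filter fun x => x = y).card := by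
      rw [Finset.filter_eq']; split_ifs <;> simp
    have hle : ∀ x : Idx m' n', (ColLT x y ∨ x = y) ↔ x.2 < y.2 ∨ (x.2 = y.2 ∧ x.1 ≤ y.1) := by
      intro x
      unfold ColLT
      rw [le_iff_lt_or_eq, Prod.ext_iff]
      tauto
    have hcard : (S.filter fun x => ColLT x y).card + (if y ∈ S then 1 else 0) =
        (S.filter fun x => ColLT x y ∨ x = y).card := by
      rw [hone, Finset.filter_or, Finset.card_union_of_disjoint]
      rw [Finset.disjoint_filter]
      rintro x - hx rfl
      rcases hx with hx | hx
      · exact lt_irrefl _ hx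
      · exact lt_irrefl _ hx.2
    rw [hcard]
    obtain ⟨r, j⟩ := y
    by_cases hr : r = Fin.last m'
    · subst hr
      rw [next_last]
      by_cases hj : (j : ℕ) + 1 < n'
      · congr 2
        apply Finset.filter_congr
        rintro ⟨x, z⟩ -
        rw [hle]
        have hv : ((j + 1 : Fin n') : ℕ) = j + 1 := Fin.val_add_one_of_lt' hj
        simp only [ColLT, Fin.lt_def, Fin.ext_iff, hv, Fin.le_def, Fin.val_last, Fin.val_zero]
        have := x.isLt
        omega
      · have hj1 : j + 1 = 0 := by
          apply Fin.ext
          rw [Fin.val_add, Fin.val_one', Nat.add_mod_mod, Fin.val_zero,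
            show (j : ℕ) + 1 = n' by omega, Nat.mod_self]
        rw [hj1]
        have h1 : (S.filter fun x => ColLT x (Fin.last m', j) ∨ x = (Fin.last m', j)) = S := by
          apply Finset.filter_true_of_mem
          rintro ⟨x, z⟩ -
          rw [hle]
          simp only [Fin.lt_def, Fin.ext_iff, Fin.le_def, Fin.val_last]
          have := x.isLt; have := z.isLt
          omega
        have h2 : (S.filter fun x => ColLT x ((0, 0) : Idx m' n')) = ∅ := by
          apply Finset.filter_false_of_mem
          rintro ⟨x, z⟩ -
          simp [ColLT]
        rw [h1, h2, hS]
        apply Fin.ext; simp [Fin.ofNat]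
    · have hlt : (r : ℕ) < m' := by
        have := Fin.val_lt_last hr; simpa using this
      have hv : ((r + 1 : Fin (m' + 1)) : ℕ) = r + 1 := Fin.val_add_one_of_lt' (by omega)
      rw [next_of_ne hr]
      congr 2
      apply Finset.filter_congr
      rintro ⟨x, z⟩ -
      rw [hle]
      simp only [ColLT, Fin.lt_def, Fin.ext_iff, hv, Fin.le_def]
      omega
  total := by
    simp [hS]

/-- For a column `(α₁, …, α_{m+1})`, the column
`(α_{m+1-q+1} ⋯ α_{m+1} α₁ ⋯ α_p, α_{p+1}, …, α_{m+1-q})`. -/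
def wrapRegrouping (m p q : ℕ) (hp : 1 ≤ p) (hpq : p + q ≤ m + 1) :
    Regrouping 1 m 1 (m + 1 - (p + q)) where
  start y := if y.1 = 0 then (Fin.ofNat (m + 1) (m + 1 - q), 0)
    else (Fin.ofNat (m + 1) (p + y.1 - 1), 0)
  len y := if y.1 = 0 then p + q else 1
  chain := by
    rintro ⟨r, j⟩
    have hadd : ∀ a b : ℕ, Fin.ofNat (m + 1) a + Fin.ofNat (m + 1) b =
        Fin.ofNat (m + 1) (a + b) := by
      intro a b; apply Fin.ext; simp [Fin.val_add, Fin.ofNat]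
    have key : ((Fin.ofNat (m + 1) (p + (r : ℕ)), 0) : Idx m 1) =
        if r + 1 = 0 then (Fin.ofNat (m + 1) (m + 1 - q), 0)
        else (Fin.ofNat (m + 1) (p + ((r + 1 : Fin (m + 1 - (p + q) + 1)) : ℕ) - 1), 0) := by
      by_cases h : r = Fin.last _
      · subst h
        rw [if_pos (fin_last_add_one _), Fin.val_last]
        congr 2; omega
      · have hlt : (r : ℕ) < m + 1 - (p + q) := by
          have := Fin.val_lt_last h; simpa using this
        have hv : ((r + 1 : Fin (m + 1 - (p + q) + 1)) : ℕ) = r + 1 :=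
          Fin.val_add_one_of_lt' (by omega)
        have h0 : (r + 1 : Fin (m + 1 - (p + q) + 1)) ≠ 0 := by
          intro h'; rw [h'] at hv; simp at hv
        rw [if_neg h0, hv]; rfl
    simp only [next_single]
    rw [← key]
    by_cases h : r = 0
    · subst h
      simp only [if_true]
      rw [next_iter_single, hadd]
      congr 1; apply Fin.ext
      simp only [Fin.ofNat, Fin.val_zero]
      rw [show m + 1 - q + (p + q) = p + 0 + (m + 1) by omega, Nat.add_mod_right]
    · have hr : 0 < (r : ℕ) := by
        rcases Nat.eq_zero_or_pos (r : ℕ) with h' | h'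
        · exact absurd (Fin.ext h') h
        · exact h'
      simp only [h, if_false]
      rw [next_iter_single, hadd, show p + (r : ℕ) - 1 + 1 = p + r by omega]
  total := by
    rw [sum_idx (fun r => if r = 0 then p + q else 1)]
    have := sum_ite_zero (m + 1 - (p + q)) (p + q - 1) 0
    rw [show p + q - 1 + 1 = p + q by omega] at this
    rw [this]; omega

/-! ### Shuffles and the integers `N`, `Y` and the coefficients `T` -/

/-- `(p, q)`-shuffles: the permutations of `p + q` elements that preserve the relative order of the
first `p` and of the last `q` elements. -/
def IsShuffle {p q : ℕ} (σ : Equiv.Perm (Fin (p + q))) : Prop :=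
  (∀ i j : Fin p, i < j → σ (Fin.castAdd q i) < σ (Fin.castAdd q j)) ∧
    ∀ i j : Fin q, i < j → σ (Fin.natAdd p i) < σ (Fin.natAdd p j)

/-- The number of `c_j` with `c_j < c_i`, or with `c_j = c_i` and `j < i`. -/
def rank {r l : ℕ} (c : Fin r → Fin l) (i : Fin r) : ℕ :=
  (Finset.univ.filter fun j => c j < c i ∨ (c j = c i ∧ j < i)).card

theorem rank_lt {r l : ℕ} (c : Fin r → Fin l) (i : Fin r) : rank c i < r := by
  have : rank c i < (Finset.univ : Finset (Fin r)).card := by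
    apply Finset.card_lt_card
    rw [Finset.ssubset_univ_iff]
    intro h
    have := Finset.mem_univ i
    rw [← h] at this
    simp at this
  simpa using this

theorem rank_lt_rank {r l : ℕ} (c : Fin r → Fin l) {i j : Fin r}
    (h : c i < c j ∨ (c i = c j ∧ i < j)) : rank c i < rank c j := by
  apply Finset.card_lt_card
  rw [Finset.ssubset_iff_of_subset]
  · exact ⟨i, by simpa using h, by simp⟩
  · intro x
    simp only [Finset.mem_filter, Finset.mem_univ, true_and]
    intro hx
    rcases hx with hx | hx <;> rcases h with h | h
    · exact Or.inl (hx.trans h)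
    · exact Or.inl (h.1 ▸ hx)
    · exact Or.inl (hx.1 ▸ h)
    · exact Or.inr ⟨hx.1.trans h.1, hx.2.trans h.2⟩

/-- The permutation `σ_c`, which sends `i` to the rank of the position `(i, c_i)` among all the
chosen positions `(j, c_j)`, taken down each column and from left to right. -/
noncomputable def rankPerm {r l : ℕ} (c : Fin r → Fin l) : Equiv.Perm (Fin r) :=
  Equiv.ofBijective (fun i => ⟨rank c i, rank_lt c i⟩) <| by
    rw [Fintype.bijective_iff_injective_and_card]
    refine ⟨fun i j h => ?_, rfl⟩
    have h' : rank c i = rank c j := congrArg Fin.val h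
    by_contra hne
    rcases lt_trichotomy (c i) (c j) with hc | hc | hc
    · exact absurd h' (rank_lt_rank c (Or.inl hc)).ne
    · rcases lt_or_gt_of_ne hne with hl | hl
      · exact absurd h' (rank_lt_rank c (Or.inr ⟨hc, hl⟩)).ne
      · exact absurd h' (rank_lt_rank c (Or.inr ⟨hc.symm, hl⟩)).ne'
    · exact absurd h' (rank_lt_rank c (Or.inl hc)).ne'

/-- The number of the maps `c : {1,…,r} → {1,…,l}`, counted with the signs of the `σ_c`. -/
noncomputable def signedN (r l : ℕ) : ℤ := ∑ c : Fin r → Fin l, (Equiv.Perm.sign (rankPerm c) : ℤ)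

/-- The number `Y_{p,q}`, which counts the `(p, q)`-shuffles with their signs. -/
def signedY (p q : ℕ) : ℤ :=
  if Even p ∨ Even q then (Nat.choose ((p + q) / 2) (p / 2) : ℤ) else 0

/-- The coefficient
`T^{p,q}_{m,n} = (1/n) (-1)^{(p-1)(m-p-q)} Y_{p-1,q} ∑_{s=1}^n N_{p-1,s-1} N_{q,n-s}`,
for `n, m, p ≥ 1` and `p + q ≤ m`. -/
noncomputable def coeffT (k : Type w) [Field k] (p q m n : ℕ) : k :=
  (n : k)⁻¹ * (((-1) ^ ((p - 1) * (m - p - q)) * signedY (p - 1) q *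
    ∑ s ∈ Finset.Icc 1 n, signedN (p - 1) (s - 1) * signedN q (n - s) : ℤ) : k)

/-! ### The maps `f`, `g`, `Ψ` in each degree -/

section maps

variable (k : Type w) [Field k] (A : Type u) [Category.{v} A] [Preadditive A] [Linear k A]
  [DGCategory k A]

/-- The Hochschild differential
`m₀ ⊗ ⋯ ⊗ α_m ↦ ∑_{i < m} (-1)^i (⋯ ⊗ α_i α_{i+1} ⊗ ⋯) + (-1)^m (± t(α_m) m₀ ⊗ α₁ ⊗ ⋯)`. -/
noncomputable def hochschildDiff (n : ℕ) [NeZero n] :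
    ∀ m : ℕ, Chain k A n (m + 1) →ₗ[k] Chain k A n m := fun m =>
  (∑ i : Fin (m + 1), ((-1) ^ (i : ℕ) : k) • (faceRegrouping n m i).map) +
    ((-1) ^ (m + 1) : k) • (lastFaceRegrouping n m).map

/-- The map `f` in degree `m`, on all matrices:
`(1/n) ∑_s (α_{1,s+1} ⋯ α_{m,s-1} α_{1s}, α_{2s}, …, α_{ms})`. -/
noncomputable def mapF (n : ℕ) [NeZero n] (m : ℕ) : Chain k A n m →ₗ[k] Chain k A 1 m :=
  (n : k)⁻¹ • ∑ s : Fin n, (columnRegrouping n m s).map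

/-- The positions `(i, c_i)`, one in each row. -/
def chosen {n m : ℕ} (c : Fin (m + 1) → Fin n) : Finset (Idx m n) :=
  Finset.univ.image fun i => (i, c i)

theorem card_chosen {n m : ℕ} (c : Fin (m + 1) → Fin n) : (chosen c).card = m + 1 := by
  rw [chosen, Finset.card_image_of_injective _ (fun i j h => (Prod.ext_iff.1 h).1)]
  simp

/-- The map `g` in degree `m`, before passing to coinvariants: the sum over all choices `c` of one
position in each row, with the first position chosen in the first row, of `(-1)^{σ_c}` times
the matrix with the given morphisms, in the cyclic order, in the chosen positions and with
identities in all the others. -/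
noncomputable def mapG (n : ℕ) [NeZero n] (m : ℕ) : Chain k A 1 m →ₗ[k] Chain k A n m :=
  ∑ c : Fin (m + 1) → Fin n with c 0 = 0, ((Equiv.Perm.sign (rankPerm c) : ℤ) : k) •
    (insertRegrouping m n m (chosen c) (card_chosen c)).map

/-- The positions, for a shuffle `σ`, of `α₀` and of the `α_i` among the inserted identities:
`α₀` stays first, and `α_i` goes to the position `σ(i)`. -/
def shufflePositions {l r : ℕ} (σ : Equiv.Perm (Fin (l + r))) : Finset (Idx (l + r) 1) :=
  insert (0, 0) (Finset.univ.image fun i : Fin l => ((σ (Fin.castAdd r i)).succ, 0))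

theorem card_shufflePositions {l r : ℕ} (σ : Equiv.Perm (Fin (l + r))) :
    (shufflePositions σ).card = l + 1 := by
  rw [shufflePositions, Finset.card_insert_of_notMem, Finset.card_image_of_injective]
  · simp
  · intro i j h
    have h1 := (Prod.ext_iff.1 h).1
    exact Fin.castAdd_injective l r (σ.injective (Fin.succ_injective _ h1))
  · simp only [Finset.mem_image, not_exists, not_and]
    intro i _ h
    exact Fin.succ_ne_zero _ (Prod.ext_iff.1 h).1

open Classical in
/-- The shuffle product `shfl(α, 1^{⊗(r+1)})` of a chain `α` of degree `l` with the constant chain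
`1 ⊗ ⋯ ⊗ 1` of degree `r`: the sum over all `(l, r)`-shuffles `σ` of `(-1)^σ` times the chain
obtained from `α` by using `σ` to shuffle `r` identities into it. -/
noncomputable def shuffleOnes (l r : ℕ) : Chain k A 1 l →ₗ[k] Chain k A 1 (l + r) :=
  ∑ σ : Equiv.Perm (Fin (l + r)) with IsShuffle σ, ((Equiv.Perm.sign σ : ℤ) : k) •
    (insertRegrouping l 1 (l + r) (shufflePositions σ) (card_shufflePositions σ)).map

/-! ### The total complexes -/

/-- The total space of the Hochschild complex of `A^{⊗n}` twisted by `t`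
(of the Hochschild complex of `A` if `n = 1`). -/
abbrev Tot (n : ℕ) [NeZero n] : Type _ := DirectSum ℕ fun m => Chain k A n m

/-- The part of cohomological degree `e` of the total space: it is spanned by the basic chains
with `m + 1` rows and homogeneous entries whose degrees add up to `e + m`. -/
noncomputable def degreePart (n : ℕ) [NeZero n] (e : ℤ) : Submodule k (Tot k A n) :=
  Submodule.span k {ξ | ∃ (m : ℕ) (a : Idx m n → A) (α : ∀ x : Idx m n, (a (next x) ⟶ a x))
    (δ : Idx m n → ℤ), (∀ x, α x ∈ DGCategory.grade (k := k) (a (next x)) (a x) (δ x)) ∧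
      (∑ x, δ x) - m = e ∧ ξ = DirectSum.lof k ℕ (fun m => Chain k A n m) m (basic k a α)}

/-- The differential of the total complex: the Hochschild differential plus, on chains with `m + 1`
rows, `(-1)^m` times the differential induced by the one of `A`. -/
noncomputable def totalDiff (n : ℕ) [NeZero n] : Tot k A n →ₗ[k] Tot k A n :=
  (DirectSum.toModule k ℕ _ fun m => match m with
    | 0 => 0
    | m + 1 => DirectSum.lof k ℕ (fun m => Chain k A n m) m ∘ₗ hochschildDiff k A n m) +
  DirectSum.toModule k ℕ _ fun m =>
    DirectSum.lof k ℕ (fun m => Chain k A n m) m ∘ₗ (((-1) ^ m : k) • internalDiff k n m)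

/-- The action of `t` on the Hochschild complex of `A^{⊗n}` twisted by `t`. -/
noncomputable def rotation (n : ℕ) [NeZero n] : Tot k A n →ₗ[k] Tot k A n :=
  DirectSum.toModule k ℕ _ fun m =>
    DirectSum.lof k ℕ (fun m => Chain k A n m) m ∘ₗ (rotateRegrouping n m).map

/-- The coinvariants of `t`: the quotient by the subspace of all `t ξ - ξ`. -/
abbrev Coinv (n : ℕ) [NeZero n] : Type _ :=
  Tot k A n ⧸ LinearMap.range (rotation k A n - LinearMap.id)

/-- The projection onto the coinvariants. -/
noncomputable def coinvProj (n : ℕ) [NeZero n] : Tot k A n →ₗ[k] Coinv k A n :=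
  (LinearMap.range (rotation k A n - LinearMap.id)).mkQ

/-- The map `f` on all chains, before it is factored through the coinvariants. -/
noncomputable def totalF (n : ℕ) [NeZero n] : Tot k A n →ₗ[k] Tot k A 1 :=
  DirectSum.toModule k ℕ _ fun m =>
    DirectSum.lof k ℕ (fun m => Chain k A 1 m) m ∘ₗ mapF k A n m

/-- The map `g`, with values in the coinvariants. -/
noncomputable def totalG (n : ℕ) [NeZero n] : Tot k A 1 →ₗ[k] Coinv k A n :=
  coinvProj k A n ∘ₗ DirectSum.toModule k ℕ _ fun m =>
    DirectSum.lof k ℕ (fun m => Chain k A n m) m ∘ₗ mapG k A n m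

/-- The map `Ψ_n`. On a chain `(α₁, …, α_m)` of length `m = M + 1` it is `(-1)^m` times the sum,
over all `1 ≤ p ≤ m` and `0 ≤ q ≤ m - p` with `p + q` even, of `T^{p,q}_{m,n}` times the shuffle
product of `(α_{m-q+1} ⋯ α_m α₁ ⋯ α_p, α_{p+1}, …, α_{m-q})` with the chain of `p + q + 1`
ones. -/
noncomputable def totalPsi (n : ℕ) : Tot k A 1 →ₗ[k] Tot k A 1 :=
  DirectSum.toModule k ℕ _ fun M =>
    ((-1) ^ (M + 1) : k) • ∑ p ∈ Finset.range (M + 2), ∑ q ∈ Finset.range (M + 2),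
      if h : 1 ≤ p ∧ p + q ≤ M + 1 ∧ Even (p + q) then
        coeffT k p q (M + 1) n •
          (DirectSum.lof k ℕ (fun m => Chain k A 1 m) (M + 1 - (p + q) + (p + q)) ∘ₗ
            shuffleOnes k A (M + 1 - (p + q)) (p + q) ∘ₗ
            (wrapRegrouping M p q h.1 h.2.1).map)
      else 0

end maps

end DGHochschild

/-! The theorem reduces to statements about arbitrary simplicial objects. Number the positions of a
matrix down each column and from left to right. A regrouping is then given by a monotone map `ψ : ℤ
→ ℤ`, periodic up to translation, which sends a new entry to the last old entry that it uses
(`Regrouping.eq_ofLift`), and regroupings compose as these maps do (`Regrouping.ofLift_comp`).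

The Koszul signs are treated once and for all. The sign of a rearrangement is the parity of the
number of reversed pairs of odd entries. This parity is additive along three total orders
(`crossing_add`), and a change of one degree alters it in a controlled way (`crossing_update`).
Hence regroupings act functorially on chains (`Regrouping.map_comp`) and commute with the internal
differential (`Regrouping.map_internalDiff`). From then on no degrees appear: the chains of `A` form
a simplicial object `chainOps` in a preadditive category, and the twisted complex of `A^{⊗n}` is its
`n`-fold edgewise subdivision (`conjugate_blockBoundary`).

For a simplicial object `X` the map `g` is a signed sum over words from `X` to the subdivision, and
`n f` is the sum of the projections to the `n` columns. In a signed sum over words, whatever does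
not see the order of two adjacent letters cancels unless the letters are equal (`sum_words_swap`).
This principle gives the compatibility of `g` with the boundaries (`subdivide_boundary`) and
evaluates the numbers `N` and `Y`. The column `s` of the piece of a word sees only the places of the
letter `s` and the number of smaller letters, so `n f g` is a combination of shuffles of paths with
constant steps (`sum_subdivide_column`), whose coefficients involve the numbers `p` and `q` of
smaller and larger letters. The homotopy consists of such shuffles with `p + q` odd, and Pascal's
rule for the coefficients (`shuffleCoeff_even`) makes its boundary the required one
(`psi_boundary`).

For `g f` the same result is applied to the subdivision of `X`. Both `g` after a column and a column
after the subdivision map of the subdivision pass through the twofold subdivision, and they differ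
only in which `n` of its `n²` blocks are read. Prisms move one choice of blocks to another
(`prism_boundary`, `moveColumns_boundary`), so `g f` is homotopic to the identity on all matrices
(`subdivisionHomotopy_boundary`). Averaging over the cyclic group, which is possible since `n` is
invertible, lets this homotopy descend to the coinvariants. -/

namespace DGHochschild

/-! ### Signs of rearrangements as quadratic forms over `ZMod 2` -/

/-- The sign `(-1)^z` of a parity. -/
def paritySign (z : ZMod 2) : ℤ := if z = 1 then -1 else 1

theorem paritySign_zero : paritySign 0 = 1 := rfl

theorem paritySign_add (y z : ZMod 2) : paritySign (y + z) = paritySign y * paritySign z := by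
  revert y z; decide

theorem paritySign_sum {ι : Type*} (s : Finset ι) (f : ι → ZMod 2) :
    paritySign (∑ i ∈ s, f i) = ∏ i ∈ s, paritySign (f i) := by
  classical
  induction s using Finset.induction_on with
  | empty => rfl
  | insert a s ha ih => rw [Finset.sum_insert ha, Finset.prod_insert ha, paritySign_add, ih]

theorem negOnePow_eq_paritySign (i : ℤ) :
    ((Int.negOnePow i : ℤˣ) : ℤ) = paritySign (i : ZMod 2) := by
  rcases Int.even_or_odd i with h | h
  · rw [Int.negOnePow_even i h, (ZMod.intCast_eq_zero_iff_even).2 h]; rfl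
  · rw [Int.negOnePow_odd i h, (ZMod.intCast_eq_one_iff_odd).2 h]; rfl

/-- A strict total order. -/
structure TotalLT {ι : Type*} (r : ι → ι → Prop) : Prop where
  irrefl : ∀ x, ¬ r x x
  swap : ∀ x y, x ≠ y → (r y x ↔ ¬ r x y)

open Classical in
/-- The parity of the number of pairs of odd elements whose order is reversed between two
total orders. -/
noncomputable def crossing {ι : Type*} [Fintype ι] (r s : ι → ι → Prop) (p : ι → ZMod 2) : ZMod 2 :=
  ∑ x, ∑ y, if r x y ∧ s y x then p x * p y else 0

/-- Over `ZMod 2` the terms at `(x, y)` and `(y, x)` cancel, so only the diagonal could contribute.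
-/
theorem sum_symmetric_eq_zero {ι : Type*} [Fintype ι] (f : ι → ι → ZMod 2)
    (h0 : ∀ x, f x x = 0) (hs : ∀ x y, f x y = f y x) : ∑ x, ∑ y, f x y = 0 := by
  rw [← Fintype.sum_prod_type']
  refine Finset.sum_involution (fun q _ => q.swap) ?_ ?_ ?_ ?_
  · rintro ⟨x, y⟩ -
    simp only [Prod.swap_prod_mk]
    rw [hs y x]; exact CharTwo.add_self_eq_zero _
  · rintro ⟨x, y⟩ - hxy h
    simp only [Prod.swap_prod_mk, Prod.mk.injEq] at h
    rw [h.1] at hxy; exact hxy (h0 _)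
  · simp
  · simp

/-- A pair is reversed between `r` and `t` exactly when it is reversed in one and only one of the
two stages. For sums over ordered pairs this takes the form that the three summands together are
symmetric in `x` and `y`, so their sum vanishes. It is the cocycle identity behind the functoriality
of the Koszul signs. -/
theorem crossing_add {ι : Type*} [Fintype ι] {r s t : ι → ι → Prop} (hr : TotalLT r)
    (hs : TotalLT s) (ht : TotalLT t) (p : ι → ZMod 2) :
    crossing r s p + crossing s t p = crossing r t p := by
  classical
  have key : crossing r s p + crossing s t p + crossing r t p = 0 := by
    simp only [crossing, ← Finset.sum_add_distrib]
    apply sum_symmetric_eq_zero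
    · intro x; simp [hr.irrefl, hs.irrefl]
    · intro x y
      by_cases h : x = y
      · rw [h]
      · rw [hr.swap x y h, hs.swap x y h, ht.swap x y h, mul_comm (p y)]
        by_cases h1 : r x y <;> by_cases h2 : s x y <;> by_cases h3 : t x y <;>
          simp [h1, h2, h3, CharTwo.add_self_eq_zero]
  rw [← sub_eq_zero, CharTwo.sub_eq_add, key]

open Classical in
/-- The parity of the number of odd elements before `x`. -/
noncomputable def frontParity {ι : Type*} [Fintype ι] (r : ι → ι → Prop) (p : ι → ZMod 2) (x : ι) :
    ZMod 2 :=
  ∑ y, if r y x then p y else 0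

theorem frontParity_update {ι : Type*} [Fintype ι] [DecidableEq ι] (r : ι → ι → Prop)
    (p : ι → ZMod 2) (x y : ι) : frontParity r (Function.update p x (p x + 1)) y =
      frontParity r p y + open Classical in (if r x y then 1 else 0) := by
  classical
  simp only [frontParity]
  rw [← Finset.sum_erase_add _ _ (Finset.mem_univ x),
    ← Finset.sum_erase_add _ (fun z => if r z y then p z else 0) (Finset.mem_univ x),
    Finset.sum_congr (g := fun z => if r z y then p z else 0) rfl fun z hz => by
      rw [Function.update_of_ne (Finset.ne_of_mem_erase hz)]]
  rw [Function.update_self, add_assoc]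
  split_ifs <;> simp

/-- The elements whose order relative to `x` is reversed form the symmetric difference of the
initial segments of `x` in `r` and in `s`. So raising the degree of `x` by one alters the sign of a
rearrangement by the quotient of the signs with which a differential reaches `x` before and after
it. -/
theorem crossing_update {ι : Type*} [Fintype ι] [DecidableEq ι] {r s : ι → ι → Prop}
    (hr : TotalLT r) (hs : TotalLT s) (p : ι → ZMod 2) (x : ι) :
    crossing r s (Function.update p x (p x + 1)) + frontParity r p x =
      crossing r s p + frontParity s p x := by
  classical
  have hu : ∀ y, Function.update p x (p x + 1) y = p y + if y = x then 1 else 0 := by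
    intro y
    by_cases h : y = x
    · subst h; simp
    · simp [h]
  have h1 : ∀ y z, (if r y z ∧ s z y then (p y + if y = x then 1 else 0) *
        (p z + if z = x then 1 else 0) else 0 : ZMod 2) =
      (if r y z ∧ s z y then p y * p z else 0) +
        (if y = x then (if r x z ∧ s z x then p z else 0) else 0) +
        (if z = x then (if r y x ∧ s x y then p y else 0) else 0) := by
    intro y z
    by_cases hy : y = x <;> by_cases hz : z = x
    · subst hy; subst hz; simp [hr.irrefl]
    · subst hy; simp only [if_true, if_neg hz, add_zero]; split_ifs <;> ring
    · subst hz; simp only [if_true, if_neg hy, add_zero]; split_ifs <;> ring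
    · simp only [if_neg hy, if_neg hz, add_zero]
  simp only [crossing, hu, h1, Finset.sum_add_distrib, frontParity]
  rw [add_assoc, add_assoc]
  congr 1
  simp only [Finset.sum_ite_irrel, Finset.sum_const_zero, Finset.sum_ite_eq', Finset.mem_univ,
    if_true]
  rw [← Finset.sum_add_distrib, ← Finset.sum_add_distrib]
  refine Finset.sum_congr rfl fun y _ => ?_
  by_cases h : x = y
  · subst h; simp [hr.irrefl, hs.irrefl]
  · rw [hr.swap x y h, hs.swap x y h]
    by_cases h1 : r x y <;> by_cases h2 : s x y <;> simp [h1, h2, CharTwo.add_self_eq_zero]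

theorem ReadLT.total {m n : ℕ} : TotalLT (ReadLT : Idx m n → Idx m n → Prop) where
  irrefl x := by simp [ReadLT]
  swap x y h := by
    simp only [ReadLT]
    rw [Ne, Prod.ext_iff] at h
    rcases lt_trichotomy x.1 y.1 with h1 | h1 | h1
    · simp [h1, h1.not_gt, h1.ne']
    · have h2 : x.2 ≠ y.2 := fun h2 => h ⟨h1, h2⟩
      simp only [h1, lt_irrefl, false_or, true_and, not_lt]
      exact ⟨le_of_lt, fun h => lt_of_le_of_ne h h2.symm⟩
    · simp [h1, h1.not_gt, h1.ne']

/-! ### Koszul signs of regroupings. -/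

namespace Regrouping

variable {n m n' m' n'' m'' : ℕ} [NeZero n] [NeZero n'] [NeZero n'']

theorem ext_of {R S : Regrouping n m n' m'} (h1 : ∀ y, R.start y = S.start y)
    (h2 : ∀ y, R.len y = S.len y) : R = S := by
  cases R; cases S
  obtain rfl := funext h1
  obtain rfl := funext h2
  rfl

variable (R : Regrouping n m n' m')

theorem slot_place (x : Idx m n) : R.slot (R.place x) = x :=
  (Equiv.ofBijective R.slot R.slot_bijective).apply_symm_apply x

theorem place_slot (p : Σ y : Idx m' n', Fin (R.len y)) : R.place (R.slot p) = p :=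
  (Equiv.ofBijective R.slot R.slot_bijective).symm_apply_apply p

theorem place_injective : Function.Injective R.place :=
  (Equiv.ofBijective R.slot R.slot_bijective).symm.injective

theorem sum_slot {M : Type*} [AddCommMonoid M] (f : Idx m n → M) :
    ∑ x, f x = ∑ y, ∑ o : Fin (R.len y), f (R.slot ⟨y, o⟩) := by
  rw [← Fintype.sum_sigma' (fun y o => f (R.slot ⟨y, o⟩))]
  exact ((Equiv.ofBijective R.slot R.slot_bijective).sum_comp f).symm

theorem newReadLT_total : TotalLT R.NewReadLT where
  irrefl x := by simp [NewReadLT, ReadLT.total.irrefl]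
  swap x y h := by
    simp only [NewReadLT]
    by_cases h1 : (R.place x).1 = (R.place y).1
    · have h2 : ((R.place x).2 : ℕ) ≠ ((R.place y).2 : ℕ) := by
        intro h2
        apply h; apply R.place_injective
        generalize R.place x = a at h1 h2
        generalize R.place y = b at h1 h2
        obtain ⟨a1, a2⟩ := a
        obtain ⟨b1, b2⟩ := b
        obtain rfl : a1 = b1 := h1
        obtain rfl : a2 = b2 := Fin.ext h2
        rfl
      simp only [h1, ReadLT.total.irrefl, false_or, true_and]
      omega
    · simp only [h1, Ne.symm h1, false_and, or_false]
      exact ReadLT.total.swap _ _ h1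

theorem koszul_eq (p : Idx m n → ZMod 2) :
    R.koszul p = paritySign (crossing ReadLT R.NewReadLT p) := by
  classical
  simp only [koszul, crossing, paritySign_sum]
  refine Finset.prod_congr rfl fun x _ => Finset.prod_congr rfl fun y _ => ?_
  have : ∀ a b : ZMod 2, paritySign (a * b) = if a = 1 ∧ b = 1 then -1 else 1 := by decide
  by_cases h : ReadLT x y ∧ R.NewReadLT y x
  · rw [if_pos h, this]; simp [h]
  · rw [if_neg h, if_neg (by tauto)]; rfl

/-- The odd factors met before a factor of the entry at `y` lie either in entries read before `y`,
which gives the sign in the differential of the new matrix, or earlier in the same composite, which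
gives the sign in the Leibniz rule. -/
theorem frontParity_slot (p : Idx m n → ZMod 2) (y : Idx m' n') (o : Fin (R.len y)) :
    frontParity R.NewReadLT p (R.slot ⟨y, o⟩) =
      frontParity ReadLT (fun y => ∑ o : Fin (R.len y), p (R.slot ⟨y, o⟩)) y +
        ∑ i ∈ Finset.range o, p (next^[i] (R.start y)) := by
  classical
  simp only [frontParity]
  rw [R.sum_slot]
  have h1 : ∑ i ∈ Finset.range o, p (next^[i] (R.start y)) =
      ∑ y' : Idx m' n', ∑ o' : Fin (R.len y'), if y' = y ∧ (o' : ℕ) < o then p (R.slot ⟨y', o'⟩)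
        else 0 := by
    rw [Finset.sum_eq_single y]
    · simp only [true_and]
      rw [Finset.sum_fin_eq_sum_range, ← Finset.sum_subset (Finset.range_mono o.isLt.le)]
      · refine Finset.sum_congr rfl fun i hi => ?_
        rw [Finset.mem_range] at hi
        rw [dif_pos (hi.trans o.isLt), if_pos hi]; rfl
      · intro i _ hi
        rw [Finset.mem_range] at hi
        split_ifs <;> rfl
    · intro y' _ h; simp [h]
    · simp
  rw [h1, ← Finset.sum_add_distrib]
  refine Finset.sum_congr rfl fun y' _ => ?_
  have h2 : ∀ o' : Fin (R.len y'), R.NewReadLT (R.slot ⟨y', o'⟩) (R.slot ⟨y, o⟩) ↔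
      ReadLT y' y ∨ (y' = y ∧ (o' : ℕ) < o) := by
    intro o'; rw [NewReadLT, place_slot, place_slot]
  simp only [h2]
  by_cases h : y' = y
  · subst h; simp [ReadLT.total.irrefl]
  · simp only [h, false_and, or_false, if_false, Finset.sum_const_zero, add_zero]
    split_ifs <;> simp

/-! ### Composition of regroupings -/

theorem start_iterate (o : ℕ) (y : Idx m' n') :
    R.start (next^[o] y) =
      next^[∑ i ∈ Finset.range o, R.len (next^[i] y)] (R.start y) := by
  induction o with
  | zero => rfl
  | succ o ih =>
    rw [Function.iterate_succ_apply', ← R.chain, ih, ← Function.iterate_add_apply,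
      Finset.sum_range_succ, Nat.add_comm]

/-- Regrouping twice. -/
noncomputable def comp (R' : Regrouping n' m' n'' m'') (R : Regrouping n m n' m') :
    Regrouping n m n'' m'' where
  start z := R.start (R'.start z)
  len z := ∑ o ∈ Finset.range (R'.len z), R.len (next^[o] (R'.start z))
  chain z := by rw [← R.start_iterate, R'.chain]
  total := by
    rw [← R.total, R'.sum_slot]
    refine Finset.sum_congr rfl fun z _ => ?_
    rw [Finset.sum_range]; rfl

variable (R' : Regrouping n' m' n'' m'')

/-- The index, in an entry obtained by regrouping twice, of the `o`-th factor of the `i`-th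
intermediate factor. -/
def compOffset (z : Idx m'' n'') (i o : ℕ) : ℕ :=
  ∑ j ∈ Finset.range i, R.len (next^[j] (R'.start z)) + o

theorem compOffset_lt {z : Idx m'' n''} {i o i' o' : ℕ}
    (ho : o < R.len (next^[i] (R'.start z))) (h : i < i') :
    R.compOffset R' z i o < R.compOffset R' z i' o' := by
  have h1 : ∑ j ∈ Finset.range (i + 1), R.len (next^[j] (R'.start z)) ≤
      ∑ j ∈ Finset.range i', R.len (next^[j] (R'.start z)) :=
    Finset.sum_le_sum_of_subset (Finset.range_mono h)
  rw [Finset.sum_range_succ] at h1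
  simp only [compOffset]; omega

theorem place_comp (x : Idx m n) :
    ((R'.comp R).place x).1 = (R'.place (R.place x).1).1 ∧
      (((R'.comp R).place x).2 : ℕ) = R.compOffset R' (R'.place (R.place x).1).1
        (R'.place (R.place x).1).2 (R.place x).2 := by
  set p := R.place x with hp
  set q := R'.place p.1 with hq
  have h1 : next^[(q.2 : ℕ)] (R'.start q.1) = p.1 := R'.slot_place p.1
  have h2 : next^[(p.2 : ℕ)] (R.start p.1) = x := R.slot_place x
  have hlt : R.compOffset R' q.1 q.2 p.2 < (R'.comp R).len q.1 := by
    have := R.compOffset_lt R' (z := q.1) (i := q.2) (o := p.2) (i' := R'.len q.1) (o' := 0)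
      (by rw [h1]; exact p.2.isLt) q.2.isLt
    exact this
  have h3 : (R'.comp R).slot ⟨q.1, ⟨_, hlt⟩⟩ = x := by
    change next^[R.compOffset R' q.1 q.2 p.2] (R.start (R'.start q.1)) = x
    rw [compOffset, Nat.add_comm, Function.iterate_add_apply, ← R.start_iterate, h1, h2]
  have h4 := (R'.comp R).place_slot ⟨q.1, ⟨_, hlt⟩⟩
  rw [h3] at h4
  rw [h4]; exact ⟨rfl, rfl⟩

/-- The order after two regroupings is lexicographic: `R'` moves the intermediate entries as wholes,
and the factors inside one of them keep their order. -/
theorem newReadLT_comp (x y : Idx m n) : (R'.comp R).NewReadLT x y ↔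
    R'.NewReadLT (R.place x).1 (R.place y).1 ∨
      ((R.place x).1 = (R.place y).1 ∧ ((R.place x).2 : ℕ) < ((R.place y).2 : ℕ)) := by
  obtain ⟨hx1, hx2⟩ := R.place_comp R' x
  obtain ⟨hy1, hy2⟩ := R.place_comp R' y
  simp only [NewReadLT, hx1, hy1, hx2, hy2]
  have hxl' := (R.place x).2.isLt
  have hyl' := (R.place y).2.isLt
  generalize ((R.place x).2 : ℕ) = i at *
  generalize ((R.place y).2 : ℕ) = j at *
  generalize (R.place x).1 = a at *
  generalize (R.place y).1 = b at *
  have ha : next^[((R'.place a).2 : ℕ)] (R'.start (R'.place a).1) = a := R'.slot_place a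
  have hb : next^[((R'.place b).2 : ℕ)] (R'.start (R'.place b).1) = b := R'.slot_place b
  by_cases h1 : (R'.place a).1 = (R'.place b).1
  · simp only [h1, ReadLT.total.irrefl, false_or, true_and]
    rcases lt_trichotomy ((R'.place a).2 : ℕ) ((R'.place b).2 : ℕ) with h | h | h
    · simp only [h, true_or, iff_true]
      exact R.compOffset_lt R' (by rw [← h1, ha]; exact hxl') h
    · have hab : a = b := ha.symm.trans (by rw [h, h1, hb])
      simp only [h, hab, lt_irrefl, false_or, true_and, compOffset]
      omega
    · have := R.compOffset_lt R' (z := (R'.place b).1) (i' := (R'.place a).2)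
        (o' := i) (by rw [hb]; exact hyl') h
      have hab : a ≠ b := by rintro rfl; exact lt_irrefl _ h
      simp only [hab, h.not_gt, false_and, or_self, iff_false]
      omega
  · have hab : a ≠ b := by rintro rfl; exact h1 rfl
    simp [h1, hab]

/-- All factors of one intermediate entry cross all factors of another one together, so expanding
the product of the two total parities yields the crossings of the single factors. Factors of the
same intermediate entry are never exchanged. -/
theorem crossing_place (p : Idx m n → ZMod 2) :
    crossing ReadLT R'.NewReadLT (fun y => ∑ o : Fin (R.len y), p (R.slot ⟨y, o⟩)) =
      crossing R.NewReadLT (R'.comp R).NewReadLT p := by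
  classical
  simp only [crossing]
  rw [R.sum_slot (fun x => ∑ y, if R.NewReadLT x y ∧ (R'.comp R).NewReadLT y x then p x * p y
    else 0)]
  refine Finset.sum_congr rfl fun y _ => ?_
  rw [Finset.sum_comm' (t' := Finset.univ) (s' := fun _ => Finset.univ) (by simp)]
  rw [R.sum_slot]
  refine Finset.sum_congr rfl fun y' _ => ?_
  have : ∀ (o : Fin (R.len y)) (o' : Fin (R.len y')),
      (R.NewReadLT (R.slot ⟨y, o⟩) (R.slot ⟨y', o'⟩) ∧
        (R'.comp R).NewReadLT (R.slot ⟨y', o'⟩) (R.slot ⟨y, o⟩)) ↔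
      (ReadLT y y' ∧ R'.NewReadLT y' y) := by
    intro o o'
    rw [newReadLT_comp, NewReadLT, place_slot, place_slot]
    simp only
    by_cases h : y = y'
    · subst h
      simp only [ReadLT.total.irrefl, R'.newReadLT_total.irrefl, false_or, true_and, false_and,
        iff_false]
      omega
    · simp [h, Ne.symm h]
  simp only [this]
  by_cases h : ReadLT y y' ∧ R'.NewReadLT y' y
  · simp only [if_pos h]
    rw [Finset.sum_mul_sum, Finset.sum_comm]
  · simp [if_neg h]

/-- This is `crossing_add` for the original order, the order after `R` and the order after both. -/
theorem koszul_comp (p : Idx m n → ZMod 2) :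
    (R'.comp R).koszul p =
      R.koszul p * R'.koszul (fun y => ∑ o : Fin (R.len y), p (R.slot ⟨y, o⟩)) := by
  rw [koszul_eq, koszul_eq, koszul_eq, crossing_place, ← paritySign_add,
    crossing_add ReadLT.total R.newReadLT_total (R'.comp R).newReadLT_total]

end Regrouping

/-! ### Composites of consecutive entries. -/

section runs

variable {A : Type u} [Category.{v} A]

theorem run_congr {n m : ℕ} [NeZero n] {a : Idx m n → A}
    (α : ∀ x : Idx m n, (a (next x) ⟶ a x)) {l l' : ℕ} {z z' : Idx m n} (hl : l = l')
    (hz : z = z') : run α l z = eqToHom (by rw [hl, hz]) ≫ run α l' z' ≫ eqToHom (by rw [hz]) := by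
  subst hl hz; simp

theorem run_add {n m : ℕ} [NeZero n] {a : Idx m n → A}
    (α : ∀ x : Idx m n, (a (next x) ⟶ a x)) (l l' : ℕ) (z : Idx m n) :
    run α (l + l') z = eqToHom (by rw [Function.iterate_add_apply]) ≫
      run α l (next^[l'] z) ≫ run α l' z := by
  induction l' generalizing z with
  | zero => exact ((Category.id_comp _).trans (Category.comp_id _)).symm
  | succ l' ih =>
    change run α (l + l') (next z) ≫ α z = _
    rw [ih]
    simp only [run, Category.assoc]
    rfl

end runs

section chainMaps

variable (k : Type w) [Field k] {A : Type u} [Category.{v} A] [Preadditive A] [Linear k A]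
  [DGCategory k A]

/-! ### Homogeneous chains -/

theorem span_homogeneous (X Y : A) : Submodule.span k (Set.range
    fun p : (Σ i : ℤ, DGCategory.grade (k := k) X Y i) => (p.2 : X ⟶ Y)) = ⊤ := by
  rw [eq_top_iff, ← (DGCategory.isInternal (k := k) X Y).submodule_iSup_eq_top, iSup_le_iff]
  intro i α hα
  exact Submodule.subset_span ⟨⟨i, α, hα⟩, rfl⟩

variable {k}

/-- Homogeneous morphisms span, so maps of chains need only be compared on homogeneous matrices,
where a regrouping is a single sign times a matrix. -/
theorem Chain.hom_ext {n m : ℕ} [NeZero n] {M : Type*} [AddCommGroup M] [Module k M]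
    {φ ψ : Chain k A n m →ₗ[k] M}
    (h : ∀ (a : Idx m n → A) (α : ∀ x : Idx m n, (a (next x) ⟶ a x)) (δ : Idx m n → ℤ),
      (∀ x, α x ∈ DGCategory.grade (k := k) (a (next x)) (a x) (δ x)) →
        φ (basic k a α) = ψ (basic k a α)) : φ = ψ := by
  classical
  have : ∀ a : Idx m n → A, φ ∘ₗ Chain.single k a = ψ ∘ₗ Chain.single k a := by
    intro a
    refine PiTensorProduct.ext_of_span_eq_top (R := k)
      (γ := fun x => Σ i : ℤ, DGCategory.grade (k := k) (a (next x)) (a x) i)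
      (g := fun x p => (p.2 : a (next x) ⟶ a x)) (fun x => span_homogeneous k _ _) ?_
    intro j
    exact h a (fun x => (j x).2) (fun x => (j x).1) (fun x => (j x).2.2)
  refine DirectSum.linearMap_ext k fun a => ?_
  convert! this a

theorem eqToHom_comp_mem {X X' Y : A} (e : X = X') {i : ℤ} {α : X' ⟶ Y}
    (h : α ∈ DGCategory.grade (k := k) X' Y i) :
    eqToHom e ≫ α ∈ DGCategory.grade (k := k) X Y i := by
  subst e; simpa using h

theorem diff_eqToHom_comp {X X' Y : A} (e : X = X') (α : X' ⟶ Y) :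
    DGCategory.diff (k := k) X Y (eqToHom e ≫ α) = eqToHom e ≫ DGCategory.diff (k := k) X' Y α := by
  subst e; simp

theorem run_mem {n m : ℕ} [NeZero n] {a : Idx m n → A} {α : ∀ x : Idx m n, (a (next x) ⟶ a x)}
    {δ : Idx m n → ℤ} (hδ : ∀ x, α x ∈ DGCategory.grade (k := k) (a (next x)) (a x) (δ x))
    (l : ℕ) (z : Idx m n) :
    run α l z ∈ DGCategory.grade (k := k) _ _ (∑ o ∈ Finset.range l, δ (next^[o] z)) := by
  induction l generalizing z with
  | zero => exact DGCategory.id_mem _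
  | succ l ih =>
    rw [Finset.sum_range_succ']
    exact DGCategory.comp_mem (ih (next z)) (hδ z)

/-! ### The internal differential and homogeneous chains -/

theorem internalDiff_basic {n m : ℕ} [NeZero n] (a : Idx m n → A)
    (α : ∀ x : Idx m n, (a (next x) ⟶ a x)) (δ : Idx m n → ℤ)
    (hδ : ∀ x, α x ∈ DGCategory.grade (k := k) (a (next x)) (a x) (δ x)) :
    internalDiff k n m (basic k a α) =
      ∑ x, (paritySign (frontParity ReadLT (fun y => (δ y : ZMod 2)) x) : k) •
        basic k a (Function.update α x (DGCategory.diff (k := k) _ _ (α x))) := by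
  classical
  rw [basic, internalDiff, Chain.desc_single, LinearMap.comp_apply, LinearMap.sum_apply, map_sum]
  refine Finset.sum_congr rfl fun x _ => ?_
  rw [PiTensorProduct.map_tprod, basic, ← map_smul]
  congr 1
  -- On a homogeneous morphism the difference of the even and the odd projection is multiplication
  -- by `(-1)^{|α_y|}`; these scalars are then pulled out of the tensor product together.
  have : ∀ y, (if ReadLT y x then
        parityProj k (a (next y)) (a y) 0 - parityProj k (a (next y)) (a y) 1
      else if y = x then DGCategory.diff (k := k) (a (next y)) (a y) else LinearMap.id) (α y) =
      (if ReadLT y x then (paritySign (δ y : ZMod 2) : k) else 1) •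
        Function.update α x (DGCategory.diff (k := k) _ _ (α x)) y := by
    intro y
    by_cases h : y = x
    · subst h; simp [ReadLT.total.irrefl]
    · rw [Function.update_of_ne h]
      by_cases h' : ReadLT y x
      · simp only [if_pos h', LinearMap.sub_apply, parityProj_of_mem k (hδ y)]
        rcases (by decide : ∀ z : ZMod 2, z = 0 ∨ z = 1) (δ y : ZMod 2) with h2 | h2 <;>
          simp [h2, paritySign]
      · simp [h, h']
  simp only [this]
  rw [MultilinearMap.map_smul_univ]
  congr 1
  rw [frontParity, paritySign_sum, Int.cast_prod]
  refine Finset.prod_congr rfl fun y _ => ?_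
  split_ifs <;> simp [paritySign]

theorem update_diff_mem {n m : ℕ} [NeZero n] [DecidableEq (Idx m n)] {a : Idx m n → A}
    {α : ∀ x : Idx m n, (a (next x) ⟶ a x)} {δ : Idx m n → ℤ}
    (hδ : ∀ x, α x ∈ DGCategory.grade (k := k) (a (next x)) (a x) (δ x)) (x y : Idx m n) :
    Function.update α x (DGCategory.diff (k := k) _ _ (α x)) y ∈
      DGCategory.grade (k := k) (a (next y)) (a y) (Function.update δ x (δ x + 1) y) := by
  by_cases h : y = x
  · subst h; simpa using DGCategory.diff_mem (hδ y)
  · simpa [h] using hδ y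

/-- The Leibniz rule iterated along a composite. As the positions are distinct, replacing the
morphism at one of them changes a single factor. -/
theorem run_diff {n m : ℕ} [NeZero n] [DecidableEq (Idx m n)] {a : Idx m n → A}
    {α : ∀ x : Idx m n, (a (next x) ⟶ a x)} {δ : Idx m n → ℤ}
    (hδ : ∀ x, α x ∈ DGCategory.grade (k := k) (a (next x)) (a x) (δ x)) (l : ℕ) (z : Idx m n)
    (hz : ∀ o < l, ∀ o' < l, next^[o] z = next^[o'] z → o = o') :
    DGCategory.diff (k := k) _ _ (run α l z) =
      ∑ o ∈ Finset.range l,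
        (paritySign (∑ i ∈ Finset.range o, (δ (next^[i] z) : ZMod 2)) : k) •
          run (Function.update α (next^[o] z) (DGCategory.diff (k := k) _ _ (α (next^[o] z)))) l z := by
  induction l generalizing z with
  | zero =>
    simp only [run, Finset.range_zero, Finset.sum_empty]
    -- The Leibniz rule for `𝟙 ≫ 𝟙` reads `d 𝟙 = d 𝟙 + d 𝟙`, so identities are closed.
    have h := DGCategory.leibniz (k := k) (𝟙 (a z)) (𝟙 (a z)) (DGCategory.id_mem (a z))
    rw [Category.comp_id, Int.negOnePow_zero, Units.val_one, one_smul, Category.id_comp,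
      Category.comp_id, left_eq_add] at h
    exact h
  | succ l ih =>
    have h0 : ∀ o < l, next^[o] (next z) ≠ z := by
      intro o ho h
      exact absurd (hz (o + 1) (by omega) 0 (by omega) h) (by omega)
    change DGCategory.diff (k := k) (a (next^[l] (next z))) (a z) (run α l (next z) ≫ α z) =
      ∑ o ∈ Finset.range (l + 1),
        (paritySign (∑ i ∈ Finset.range o, (δ (next^[i] z) : ZMod 2)) : k) •
          (run (Function.update α (next^[o] z)
            (DGCategory.diff (k := k) _ _ (α (next^[o] z)))) l (next z) ≫
          Function.update α (next^[o] z) (DGCategory.diff (k := k) _ _ (α (next^[o] z))) z)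
    rw [DGCategory.leibniz _ _ (hδ z), ih (next z) (fun o ho o' ho' h => by
      have := hz (o + 1) (by omega) (o' + 1) (by omega) h; omega)]
    rw [Finset.sum_range_succ', add_comm]
    congr 1
    · rw [Preadditive.sum_comp, Finset.smul_sum]
      refine Finset.sum_congr rfl fun o ho => ?_
      rw [Finset.mem_range] at ho
      rw [Function.iterate_succ_apply, Function.update_of_ne (h0 o ho).symm,
        Finset.sum_range_succ', paritySign_add, negOnePow_eq_paritySign, Int.cast_mul,
        mul_comm, mul_smul, Linear.smul_comp]
      simp only [Int.cast_smul_eq_zsmul]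
      rfl
    · simp only [Function.iterate_zero, id, Finset.range_zero, Finset.sum_empty, paritySign_zero,
        Int.cast_one, one_smul, Function.update_self]
      rw [run_update_of_notMem α z _ l (next z) h0]
      rfl

end chainMaps

/-! ### Functoriality of regroupings on chains, and the Leibniz rule for their entries. -/

namespace Regrouping

section entries

variable {A : Type u} [Category.{v} A] {n m n' m' n'' m'' : ℕ} [NeZero n] [NeZero n'] [NeZero n'']
  (R : Regrouping n m n' m') (R' : Regrouping n' m' n'' m'')

theorem run_entry {a : Idx m n → A} (α : ∀ x : Idx m n, (a (next x) ⟶ a x)) (l : ℕ)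
    (z : Idx m' n') : run (a := fun y => a (R.start y)) (R.entry α) l z =
      eqToHom (by rw [R.start_iterate]) ≫
        run α (∑ o ∈ Finset.range l, R.len (next^[o] z)) (R.start z) := by
  induction l generalizing z with
  | zero => exact (Category.id_comp _).symm
  | succ l ih =>
    have h1 : ∑ o ∈ Finset.range (l + 1), R.len (next^[o] z) =
        ∑ o ∈ Finset.range l, R.len (next^[o] (next z)) + R.len z := by
      rw [Finset.sum_range_succ']; rfl
    rw [run_congr α h1 rfl, run_add α _ _ (R.start z), run_congr α rfl (R.chain z)]
    change run (a := fun y => a (R.start y)) (R.entry α) l (next z) ≫ R.entry α z = _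
    rw [ih (next z), entry]
    simp only [Category.assoc, eqToHom_refl, Category.comp_id, eqToHom_trans_assoc]
    rfl

theorem entry_comp {a : Idx m n → A} (α : ∀ x : Idx m n, (a (next x) ⟶ a x))
    (y : Idx m'' n'') : (R'.comp R).entry α y =
      R'.entry (a := fun y => a (R.start y)) (R.entry α) y := by
  rw [entry, entry, run_entry]
  simp only [← Category.assoc, eqToHom_trans]
  rfl

theorem slot_injective_of {y : Idx m' n'} {o o' : ℕ} (ho : o < R.len y) (ho' : o' < R.len y)
    (h : next^[o] (R.start y) = next^[o'] (R.start y)) : o = o' := by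
  have := R.slot_bijective.1 (a₁ := ⟨y, ⟨o, ho⟩⟩) (a₂ := ⟨y, ⟨o', ho'⟩⟩) h
  simpa using this

theorem entry_update_slot [DecidableEq (Idx m n)] [DecidableEq (Idx m' n')] {a : Idx m n → A}
    (α : ∀ x : Idx m n, (a (next x) ⟶ a x)) (y : Idx m' n') (o : Fin (R.len y))
    (u : a (next (R.slot ⟨y, o⟩)) ⟶ a (R.slot ⟨y, o⟩)) :
    R.entry (Function.update α (R.slot ⟨y, o⟩) u) = Function.update (R.entry α) y
      (R.entry (Function.update α (R.slot ⟨y, o⟩) u) y) := by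
  funext y'
  by_cases hy : y' = y
  · subst hy; simp
  · rw [Function.update_of_ne hy]
    simp only [entry]
    rw [run_update_of_notMem]
    intro o' ho' h
    have := R.slot_bijective.1 (a₁ := ⟨y', ⟨o', ho'⟩⟩) (a₂ := ⟨y, o⟩) h
    exact hy (congrArg Sigma.fst this)

end entries

section maps

variable {k : Type w} [Field k] {A : Type u} [Category.{v} A] [Preadditive A] [Linear k A]
  [DGCategory k A] {n m n' m' n'' m'' : ℕ} [NeZero n] [NeZero n'] [NeZero n'']
  (R : Regrouping n m n' m') (R' : Regrouping n' m' n'' m'')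

/-- The degrees of the entries of the new matrix. -/
def entryDegree (δ : Idx m n → ℤ) (y : Idx m' n') : ℤ :=
  ∑ o ∈ Finset.range (R.len y), δ (next^[o] (R.start y))

theorem sum_entryDegree (δ : Idx m n → ℤ) : ∑ y, R.entryDegree δ y = ∑ x, δ x := by
  rw [R.sum_slot]
  refine Finset.sum_congr rfl fun y _ => ?_
  rw [entryDegree, Finset.sum_range]; rfl

theorem entryDegree_cast (δ : Idx m n → ℤ) (y : Idx m' n') :
    (R.entryDegree δ y : ZMod 2) = ∑ o : Fin (R.len y), (δ (R.slot ⟨y, o⟩) : ZMod 2) := by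
  rw [entryDegree, Finset.sum_range, Int.cast_sum]; rfl

theorem entry_mem {a : Idx m n → A} {α : ∀ x : Idx m n, (a (next x) ⟶ a x)}
    {δ : Idx m n → ℤ} (hδ : ∀ x, α x ∈ DGCategory.grade (k := k) (a (next x)) (a x) (δ x))
    (y : Idx m' n') : R.entry α y ∈
      DGCategory.grade (k := k) (a (R.start (next y))) (a (R.start y)) (R.entryDegree δ y) :=
  eqToHom_comp_mem _ (run_mem hδ _ _)

/-- On a homogeneous matrix the entries agree by associativity of composition and the signs by
`koszul_comp`, applied with the degrees of the intermediate composites. -/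
theorem map_comp : (R'.comp R).map (k := k) (A := A) = R'.map ∘ₗ R.map := by
  refine Chain.hom_ext fun a α δ hδ => ?_
  rw [LinearMap.comp_apply, R.map_basic a α δ hδ, map_smul,
    R'.map_basic _ _ _ (R.entry_mem hδ), (R'.comp R).map_basic a α δ hδ, koszul_comp, Int.cast_mul,
    mul_smul]
  simp only [entryDegree_cast]
  congr 3
  funext y
  exact R.entry_comp R' α y

theorem diff_entry [DecidableEq (Idx m n)] {a : Idx m n → A}
    {α : ∀ x : Idx m n, (a (next x) ⟶ a x)} {δ : Idx m n → ℤ}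
    (hδ : ∀ x, α x ∈ DGCategory.grade (k := k) (a (next x)) (a x) (δ x)) (y : Idx m' n') :
    DGCategory.diff (k := k) _ _ (R.entry α y) = ∑ o : Fin (R.len y),
      (paritySign (∑ i ∈ Finset.range o, (δ (next^[i] (R.start y)) : ZMod 2)) : k) •
        R.entry (Function.update α (R.slot ⟨y, o⟩)
          (DGCategory.diff (k := k) _ _ (α (R.slot ⟨y, o⟩)))) y := by
  rw [entry, diff_eqToHom_comp, run_diff hδ _ _ (fun o ho o' ho' => R.slot_injective_of ho ho'),
    Finset.sum_range, Preadditive.comp_sum]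
  refine Finset.sum_congr rfl fun o _ => ?_
  rw [Linear.comp_smul]; rfl

end maps

end Regrouping

section basics

variable {k : Type w} [Field k] {A : Type u} [Category.{v} A] [Preadditive A] [Linear k A]
  {n m : ℕ} [NeZero n]

theorem basic_update_sum [DecidableEq (Idx m n)] (a : Idx m n → A)
    (α : ∀ x : Idx m n, (a (next x) ⟶ a x)) (x : Idx m n) {ι : Type*} (s : Finset ι) (c : ι → k)
    (u : ι → (a (next x) ⟶ a x)) :
    basic k a (Function.update α x (∑ i ∈ s, c i • u i)) =
      ∑ i ∈ s, c i • basic k a (Function.update α x (u i)) := by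
  simp only [basic, MultilinearMap.map_update_sum, MultilinearMap.map_update_smul, map_sum,
    map_smul]

theorem basic_eq_zero (a : Idx m n → A)
    (α : ∀ x : Idx m n, (a (next x) ⟶ a x)) (x : Idx m n) (h : α x = 0) :
    basic k a α = 0 := by
  rw [basic, MultilinearMap.map_coord_zero _ x h, map_zero]

end basics

theorem update_cast_parity {n m : ℕ} [DecidableEq (Idx m n)] (δ : Idx m n → ℤ) (x : Idx m n) :
    (fun y => ((Function.update δ x (δ x + 1) y : ℤ) : ZMod 2)) =
      Function.update (fun y => (δ y : ZMod 2)) x ((δ x : ZMod 2) + 1) := by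
  funext y
  by_cases h : y = x
  · subst h; simp
  · simp [h]

section internal

variable {k : Type w} [Field k] {A : Type u} [Category.{v} A] [Preadditive A] [Linear k A]
  [DGCategory k A] {n m n' m' : ℕ} [NeZero n] [NeZero n']

/-- The terms of both sides correspond factor by factor, after the differential of each composite
has been expanded by the Leibniz rule. Their signs agree by `crossing_update`, once
`frontParity_slot` has split the parity in front of the factor. -/
theorem Regrouping.map_internalDiff (R : Regrouping n m n' m') :
    R.map (A := A) ∘ₗ internalDiff k n m = internalDiff k n' m' ∘ₗ R.map := by
  classical
  refine Chain.hom_ext fun a α δ hδ => ?_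
  rw [LinearMap.comp_apply, LinearMap.comp_apply, internalDiff_basic a α δ hδ,
    R.map_basic a α δ hδ, map_smul, internalDiff_basic _ _ _ (R.entry_mem hδ), map_sum, R.sum_slot,
    Finset.smul_sum]
  refine Finset.sum_congr rfl fun y _ => ?_
  rw [R.diff_entry hδ, basic_update_sum, Finset.smul_sum, Finset.smul_sum]
  refine Finset.sum_congr rfl fun o _ => ?_
  rw [map_smul, R.map_basic _ _ _ (update_diff_mem hδ _), R.entry_update_slot α y o]
  simp only [Regrouping.koszul_eq, update_cast_parity, smul_smul, ← Int.cast_mul,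
    ← paritySign_add, R.entryDegree_cast]
  congr 3
  · rw [add_comm, crossing_update ReadLT.total R.newReadLT_total, R.frontParity_slot]
  · simp

/-- Differentiating at `x` and then at `y` cancels against the opposite order: in exactly one of the
two cases the second differential has to pass an entry whose degree has just been raised. The
diagonal terms vanish since the differential of morphisms squares to zero. -/
theorem internalDiff_internalDiff :
    internalDiff (A := A) k n m ∘ₗ internalDiff k n m = 0 := by
  classical
  refine Chain.hom_ext fun a α δ hδ => ?_
  have hd : ∀ x y : Idx m n, x ≠ y → Function.update (Function.update α x
      (DGCategory.diff (k := k) _ _ (α x))) y (DGCategory.diff (k := k) _ _ (Function.update α x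
      (DGCategory.diff (k := k) _ _ (α x)) y)) =
      Function.update (Function.update α x (DGCategory.diff (k := k) _ _ (α x))) y
        (DGCategory.diff (k := k) _ _ (α y)) := by
    intro x y h
    rw [Function.update_of_ne h.symm]
  rw [LinearMap.comp_apply, internalDiff_basic a α δ hδ, map_sum, LinearMap.zero_apply]
  simp only [map_smul, internalDiff_basic a _ _ (update_diff_mem hδ _), update_cast_parity,
    frontParity_update, Finset.smul_sum, smul_smul, ← Int.cast_mul, ← paritySign_add]
  rw [← Fintype.sum_prod_type']
  refine Finset.sum_involution (fun q _ => q.swap) ?_ ?_ ?_ ?_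
  · rintro ⟨x, y⟩ -
    simp only [Prod.swap_prod_mk]
    by_cases h : x = y
    · subst h
      have h0 : basic k a (Function.update (Function.update α x
          (DGCategory.diff (k := k) _ _ (α x))) x (DGCategory.diff (k := k) _ _
          (Function.update α x (DGCategory.diff (k := k) _ _ (α x)) x))) = 0 :=
        basic_eq_zero a _ x (by simp [DGCategory.diff_diff])
      rw [h0]; simp
    · rw [hd x y h, hd y x (Ne.symm h), Function.update_comm h, ← add_smul, ← Int.cast_add]
      have : ∀ a b c d : ZMod 2, c = d + 1 → paritySign (a + (b + c)) + paritySign (b + (a + d)) = 0 := by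
        decide
      rw [this, Int.cast_zero, zero_smul]
      have := ReadLT.total.swap x y h
      by_cases h' : ReadLT x y <;> (simp [this, h']; try rfl)
  · rintro ⟨x, y⟩ - hxy h
    simp only [Prod.swap_prod_mk, Prod.mk.injEq] at h
    obtain rfl := h.1
    apply hxy
    have h0 : basic k a (Function.update (Function.update α y
          (DGCategory.diff (k := k) _ _ (α y))) y (DGCategory.diff (k := k) _ _
          (Function.update α y (DGCategory.diff (k := k) _ _ (α y)) y))) = 0 :=
        basic_eq_zero a _ y (by simp [DGCategory.diff_diff])
    simp only [h0, smul_zero]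
  · simp
  · simp

/-! ### Degrees -/

/-- The span of the basic chains with homogeneous entries whose degrees add up to `e`. -/
noncomputable def Chain.degree (k : Type w) [Field k] (A : Type u) [Category.{v} A] [Preadditive A]
    [Linear k A] [DGCategory k A] (n m : ℕ) [NeZero n] (e : ℤ) : Submodule k (Chain k A n m) :=
  Submodule.span k {ξ | ∃ (a : Idx m n → A) (α : ∀ x : Idx m n, (a (next x) ⟶ a x))
    (δ : Idx m n → ℤ), (∀ x, α x ∈ DGCategory.grade (k := k) (a (next x)) (a x) (δ x)) ∧
      ∑ x, δ x = e ∧ ξ = basic k a α}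

theorem Chain.map_degree_le {M : Type*} [AddCommGroup M] [Module k M]
    {φ : Chain k A n m →ₗ[k] M} {e : ℤ} {S : Submodule k M}
    (h : ∀ (a : Idx m n → A) (α : ∀ x : Idx m n, (a (next x) ⟶ a x)) (δ : Idx m n → ℤ),
      (∀ x, α x ∈ DGCategory.grade (k := k) (a (next x)) (a x) (δ x)) → ∑ x, δ x = e →
        φ (basic k a α) ∈ S) : (Chain.degree k A n m e).map φ ≤ S := by
  rw [Submodule.map_le_iff_le_comap, Chain.degree, Submodule.span_le]
  rintro _ ⟨a, α, δ, hδ, he, rfl⟩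
  exact h a α δ hδ he

theorem Regrouping.map_degree (R : Regrouping n m n' m') (e : ℤ) :
    (Chain.degree k A n m e).map R.map ≤ Chain.degree k A n' m' e := by
  refine Chain.map_degree_le fun a α δ hδ he => ?_
  rw [R.map_basic a α δ hδ]
  exact Submodule.smul_mem _ _ (Submodule.subset_span
    ⟨_, _, R.entryDegree δ, R.entry_mem hδ, by rw [R.sum_entryDegree, he], rfl⟩)

theorem internalDiff_degree (e : ℤ) :
    (Chain.degree k A n m e).map (internalDiff k n m) ≤ Chain.degree k A n m (e + 1) := by
  classical
  refine Chain.map_degree_le fun a α δ hδ he => ?_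
  rw [internalDiff_basic a α δ hδ]
  refine Submodule.sum_mem _ fun x _ => Submodule.smul_mem _ _ (Submodule.subset_span
    ⟨_, _, _, update_diff_mem hδ x, ?_, rfl⟩)
  rw [Finset.sum_update_of_mem (Finset.mem_univ x), ← he,
    ← Finset.sum_erase_add _ _ (Finset.mem_univ x), Finset.sdiff_singleton_eq_erase]
  ring

end internal

/-! ### Regroupings as monotone periodic maps of the integers -/

section linearIndex

/-- The number of a position in the cyclic composable order. -/
def lin {m n : ℕ} (y : Idx m n) : ℤ := (y.1 : ℕ) + ((m : ℤ) + 1) * (y.2 : ℕ)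

/-- The position with a given number, which is read modulo the number of positions. -/
def unlin (m n : ℕ) [NeZero n] (z : ℤ) : Idx m n :=
  (⟨(z % ((m : ℤ) + 1)).toNat, by
      have := Int.emod_nonneg z (b := (m : ℤ) + 1) (by omega)
      have := Int.emod_lt_of_pos z (b := (m : ℤ) + 1) (by omega)
      omega⟩,
    ⟨((z / ((m : ℤ) + 1)) % (n : ℤ)).toNat, by
      have hn : 0 < n := Nat.pos_of_ne_zero (NeZero.ne n)
      have := Int.emod_nonneg (z / ((m : ℤ) + 1)) (b := (n : ℤ)) (by omega)
      have := Int.emod_lt_of_pos (z / ((m : ℤ) + 1)) (b := (n : ℤ)) (by omega)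
      omega⟩)

variable {m n : ℕ} [NeZero n]

theorem exists_eq_add_mul (M : ℕ) (hM : 0 < M) (z : ℤ) : ∃ (r : ℕ) (q : ℤ), r < M ∧ z = r + M * q := by
  refine ⟨(z % M).toNat, z / M, ?_, ?_⟩
  · have := Int.emod_nonneg z (b := (M : ℤ)) (by omega)
    have := Int.emod_lt_of_pos z (b := (M : ℤ)) (by omega)
    omega
  · rw [Int.toNat_of_nonneg (Int.emod_nonneg z (by omega)), Int.emod_add_mul_ediv]

theorem add_mul_emod {M r : ℕ} (h : r < M) (q : ℤ) : ((r : ℤ) + M * q) % M = r := by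
  rw [Int.add_mul_emod_self_left, Int.emod_eq_of_lt (by omega) (by omega)]

theorem add_mul_ediv {M r : ℕ} (h : r < M) (q : ℤ) : ((r : ℤ) + M * q) / M = q := by
  rw [Int.add_mul_ediv_left _ _ (by omega), Int.ediv_eq_zero_of_lt (by omega) (by omega), zero_add]

theorem unlin_fst (r : ℕ) (hr : r < m + 1) (q : ℤ) :
    (unlin m n (r + ((m : ℤ) + 1) * q)).1 = ⟨r, hr⟩ := by
  apply Fin.ext
  have := add_mul_emod hr q
  push_cast at this
  simp [unlin, this]

theorem unlin_snd (r : ℕ) (hr : r < m + 1) (q : ℤ) :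
    (((unlin m n (r + ((m : ℤ) + 1) * q)).2 : ℕ) : ℤ) = q % n := by
  have hn : 0 < n := Nat.pos_of_ne_zero (NeZero.ne n)
  have := add_mul_ediv hr q
  push_cast at this
  simp only [unlin, this]
  exact Int.toNat_of_nonneg (Int.emod_nonneg q (by omega))

theorem unlin_eq (r : ℕ) (hr : r < m + 1) (j : Fin n) (c : ℤ) :
    unlin m n (r + ((m : ℤ) + 1) * ((j : ℕ) + n * c)) = (⟨r, hr⟩, j) := by
  refine Prod.ext (unlin_fst r hr _) (Fin.ext ?_)
  have := unlin_snd (n := n) r hr ((j : ℕ) + n * c)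
  rw [add_mul_emod j.isLt] at this
  exact_mod_cast this

theorem exists_unlin (z : ℤ) : ∃ (y : Idx m n) (c : ℤ), z = lin y + (n * (m + 1) : ℕ) * c := by
  obtain ⟨r, q, hr, rfl⟩ := exists_eq_add_mul (m + 1) (by omega) z
  obtain ⟨j, c, hj, rfl⟩ := exists_eq_add_mul n (Nat.pos_of_ne_zero (NeZero.ne n)) q
  refine ⟨(⟨r, hr⟩, ⟨j, hj⟩), c, ?_⟩
  simp only [lin]; push_cast; ring

theorem unlin_lin_add (y : Idx m n) (c : ℤ) : unlin m n (lin y + (n * (m + 1) : ℕ) * c) = y := by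
  have := unlin_eq (n := n) y.1 y.1.isLt y.2 c
  rw [lin]
  convert! this using 2
  push_cast; ring

theorem unlin_lin (y : Idx m n) : unlin m n (lin y) = y := by
  simpa using unlin_lin_add y 0

theorem unlin_add (z c : ℤ) : unlin m n (z + (n * (m + 1) : ℕ) * c) = unlin m n z := by
  obtain ⟨y, d, rfl⟩ := exists_unlin (m := m) (n := n) z
  rw [add_assoc, ← mul_add, unlin_lin_add, unlin_lin_add]

theorem exists_lin_unlin (z : ℤ) : ∃ c : ℤ, lin (unlin m n z) = z + (n * (m + 1) : ℕ) * c := by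
  obtain ⟨y, d, rfl⟩ := exists_unlin (m := m) (n := n) z
  exact ⟨-d, by rw [unlin_lin_add]; ring⟩

/-- In the linear numbering the cyclic order becomes the addition of one modulo the number of
positions. -/
theorem next_eq (y : Idx m n) : next y = unlin m n (lin y + 1) := by
  obtain ⟨r, j⟩ := y
  by_cases h : r = Fin.last m
  · subst h
    rw [next_last]
    have h1 : lin ((Fin.last m, j) : Idx m n) + 1 = ((0 : ℕ) : ℤ) + ((m : ℤ) + 1) * ((j : ℕ) + 1) := by
      simp [lin]; ring
    rw [h1]
    refine Prod.ext (unlin_fst 0 (by omega) _).symm (Fin.ext ?_)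
    have := unlin_snd (m := m) (n := n) 0 (by omega) ((j : ℕ) + 1)
    have h2 : ((j + 1 : Fin n) : ℕ) = ((j : ℕ) + 1) % n := by
      rw [Fin.val_add, Fin.val_one', Nat.add_mod_mod]
    rw [Nat.cast_zero] at this
    simp only
    zify
    rw [this, h2]; push_cast; rfl
  · have hlt : (r : ℕ) < m := by have := Fin.val_lt_last h; simpa using this
    rw [next_of_ne h]
    have := unlin_eq (m := m) (n := n) (r + 1) (by omega) j 0
    rw [show lin (r, j) + 1 = ((r + 1 : ℕ) : ℤ) + ((m : ℤ) + 1) * ((j : ℕ) + n * 0) by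
      simp [lin]; ring, this]
    congr 1; apply Fin.ext
    rw [Fin.val_add_one_of_lt' (by omega)]

theorem next_unlin (z : ℤ) : next (unlin m n z) = unlin m n (z + 1) := by
  obtain ⟨c, hc⟩ := exists_lin_unlin (m := m) (n := n) z
  rw [next_eq, hc, add_right_comm, unlin_add]

theorem next_iterate_unlin (l : ℕ) (z : ℤ) : next^[l] (unlin m n z) = unlin m n (z + l) := by
  induction l with
  | zero => simp
  | succ l ih => rw [Function.iterate_succ_apply', ih, next_unlin]; push_cast; ring_nf

end linearIndex

theorem sum_lin {m n : ℕ} {M : Type*} [AddCommMonoid M] (f : ℤ → M) :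
    ∑ y : Idx m n, f (lin y) = ∑ t ∈ Finset.range (n * (m + 1)), f t := by
  rw [Finset.sum_range]
  refine Fintype.sum_equiv ((Equiv.prodComm _ _).trans finProdFinEquiv) _ _ fun y => ?_
  simp [lin]

/-- Monotone maps `ψ : ℤ → ℤ` with `ψ (y + N') = ψ y + N`. -/
structure IsLift (N' N : ℕ) (ψ : ℤ → ℤ) : Prop where
  mono : Monotone ψ
  add : ∀ y, ψ (y + N') = ψ y + N

theorem IsLift.add_mul {N' N : ℕ} {ψ : ℤ → ℤ} (h : IsLift N' N ψ) (y c : ℤ) :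
    ψ (y + N' * c) = ψ y + N * c := by
  induction c using Int.induction_on with
  | zero => simp
  | succ i ih => rw [mul_add, ← add_assoc, mul_one, h.add, ih]; ring
  | pred i ih =>
    have := h.add (y + N' * (-(i : ℤ) - 1))
    rw [add_assoc, mul_sub, mul_one, sub_add_cancel, ih] at this
    rw [mul_sub, mul_one]; linarith

theorem IsLift.comp {N N' N'' : ℕ} {ψ ψ' : ℤ → ℤ} (h : IsLift N' N ψ) (h' : IsLift N'' N' ψ') :
    IsLift N'' N (ψ ∘ ψ') :=
  ⟨h.mono.comp h'.mono, fun y => by simp [h'.add, h.add]⟩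

theorem isLift_id (N : ℕ) : IsLift N N id := ⟨monotone_id, fun _ => rfl⟩

theorem IsLift.add_const {N' N : ℕ} {ψ : ℤ → ℤ} (h : IsLift N' N ψ) (c : ℤ) :
    IsLift N' N (fun y => ψ y + c) :=
  ⟨fun _ _ hxy => by have := h.mono hxy; simpa using this, fun y => by simp only [h.add]; ring⟩

namespace Regrouping

variable {n m n' m' n'' m'' : ℕ} [NeZero n] [NeZero n'] [NeZero n'']

/-- The regrouping in which `ψ y` is the number of the last old entry used by the new entry with
the number `y`. -/
def ofLift (n m n' m' : ℕ) [NeZero n] [NeZero n'] (ψ : ℤ → ℤ)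
    (h : IsLift (n' * (m' + 1)) (n * (m + 1)) ψ) : Regrouping n m n' m' where
  start y := unlin m n (ψ (lin y - 1) + 1)
  len y := (ψ (lin y) - ψ (lin y - 1)).toNat
  chain y := by
    have h1 : ψ (lin y - 1) ≤ ψ (lin y) := h.mono (by omega)
    obtain ⟨c, hc⟩ := exists_lin_unlin (m := m') (n := n') (lin y + 1)
    rw [next_iterate_unlin, next_eq, hc, add_sub_right_comm, add_sub_cancel_right, h.add_mul,
      add_right_comm _ _ (1 : ℤ), unlin_add]
    congr 1; omega
  total := by
    rw [sum_lin (fun z => (ψ z - ψ (z - 1)).toNat)]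
    zify
    have h1 : ∀ t : ℕ, ((ψ t - ψ ((t : ℤ) - 1)).toNat : ℤ) =
        ψ (((t + 1 : ℕ) : ℤ) - 1) - ψ ((t : ℤ) - 1) := by
      intro t
      have h1 : ψ ((t : ℤ) - 1) ≤ ψ t := h.mono (by omega)
      rw [Int.toNat_of_nonneg (by omega)]; push_cast; rw [add_sub_cancel_right]
    simp only [h1]
    rw [Finset.sum_range_sub (fun t : ℕ => ψ ((t : ℤ) - 1))]
    have := h.add (-1)
    push_cast at this ⊢
    rw [show (n' : ℤ) * (m' + 1) - 1 = -1 + n' * (m' + 1) by ring, this]; ring_nf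

/-- The last old entry reached by a new entry is the one reached by its last intermediate factor, so
the maps of integers compose in the order opposite to that of the regroupings. -/
theorem ofLift_comp {ψ ψ' : ℤ → ℤ} (h : IsLift (n' * (m' + 1)) (n * (m + 1)) ψ)
    (h' : IsLift (n'' * (m'' + 1)) (n' * (m' + 1)) ψ') :
    (ofLift n' m' n'' m'' ψ' h').comp (ofLift n m n' m' ψ h) =
      ofLift n m n'' m'' (ψ ∘ ψ') (h.comp h') := by
  -- Passing to a position and back changes a number only by a multiple of the period. The map `ψ`
  -- carries this to a multiple of its own period, which drops out of all differences and of
  -- `unlin`.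
  have key : ∀ z : ℤ, ∃ c : ℤ, ∀ d : ℤ, ψ (lin (unlin m' n' z) + d) =
      ψ (z + d) + (n * (m + 1) : ℕ) * c := by
    intro z
    obtain ⟨c, hc⟩ := exists_lin_unlin (m := m') (n := n') z
    exact ⟨c, fun d => by rw [hc, add_right_comm, h.add_mul]⟩
  refine ext_of (fun y => ?_) (fun y => ?_)
  · simp only [comp, ofLift, Function.comp]
    obtain ⟨c, hc⟩ := key (ψ' (lin y - 1) + 1)
    have := hc (-1)
    rw [← sub_eq_add_neg] at this
    rw [this, add_right_comm, unlin_add]; ring_nf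
  · simp only [comp, ofLift, Function.comp, next_iterate_unlin]
    zify
    have h1 : ∀ t : ℕ, ((ψ (lin (unlin m' n' (ψ' (lin y - 1) + 1 + t))) -
        ψ (lin (unlin m' n' (ψ' (lin y - 1) + 1 + t)) - 1)).toNat : ℤ) =
        ψ (ψ' (lin y - 1) + ((t + 1 : ℕ) : ℤ)) - ψ (ψ' (lin y - 1) + t) := by
      intro t
      obtain ⟨c, hc⟩ := key (ψ' (lin y - 1) + 1 + t)
      have h2 := hc (-1)
      have h3 := hc 0
      rw [← sub_eq_add_neg] at h2
      rw [add_zero, add_zero] at h3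
      rw [h2, h3]
      have : ψ (ψ' (lin y - 1) + 1 + t + -1) ≤ ψ (ψ' (lin y - 1) + 1 + t) := h.mono (by omega)
      rw [Int.toNat_of_nonneg (by omega)]
      push_cast
      ring_nf
    simp only [h1]
    rw [Finset.sum_range_sub (fun t : ℕ => ψ (ψ' (lin y - 1) + t))]
    have h4 : ψ' (lin y - 1) ≤ ψ' (lin y) := h'.mono (by omega)
    have h5 : ψ (ψ' (lin y - 1)) ≤ ψ (ψ' (lin y)) := h.mono h4
    rw [Int.toNat_of_nonneg (by omega), Int.toNat_of_nonneg (by omega)]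
    simp

/-- The regrouping that changes nothing. -/
def refl (n m : ℕ) [NeZero n] : Regrouping n m n m where
  start y := y
  len _ := 1
  chain _ := rfl
  total := by simp [Nat.mul_comm]

theorem ofLift_id (n m : ℕ) [NeZero n] : ofLift n m n m id (isLift_id _) = refl n m := by
  refine ext_of (fun y => ?_) (fun y => ?_)
  · simp [ofLift, refl, unlin_lin]
  · simp [ofLift, refl]

theorem refl_map {k : Type w} [Field k] {A : Type u} [Category.{v} A] [Preadditive A] [Linear k A]
    [DGCategory k A] : (refl n m).map (k := k) (A := A) = LinearMap.id := by
  refine Chain.hom_ext fun a α δ hδ => ?_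
  rw [map_basic _ a α δ hδ]
  have hp : ∀ x, (refl n m).place x = ⟨x, ⟨0, Nat.one_pos⟩⟩ := fun x =>
    (refl n m).place_slot ⟨x, ⟨0, Nat.one_pos⟩⟩
  have h1 : (refl n m).koszul (fun x => (δ x : ZMod 2)) = 1 := by
    classical
    rw [koszul_eq, crossing, Finset.sum_eq_zero, paritySign_zero]
    intro x _
    refine Finset.sum_eq_zero fun y _ => if_neg ?_
    rintro ⟨h1, h2⟩
    rw [NewReadLT, hp x, hp y] at h2
    simp only [lt_irrefl, and_false, or_false] at h2
    have hxy : x ≠ y := fun h => ReadLT.total.irrefl x (by rw [← h] at h1; exact h1)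
    exact (ReadLT.total.swap x y hxy).1 h2 h1
  rw [h1, Int.cast_one, one_smul, LinearMap.id_apply]
  congr 1
  funext y
  exact (Category.id_comp _).trans (Category.id_comp _)

end Regrouping

/-! ### Operators of monotone periodic maps. -/

section cyclicOperators

variable (k : Type w) [Field k] (A : Type u) [Category.{v} A] [Preadditive A] [Linear k A]
  [DGCategory k A] (n m n' m' n'' m'' : ℕ) [NeZero n] [NeZero n'] [NeZero n'']

open Classical in
/-- The operator on chains given by a monotone periodic map. -/
noncomputable def cyclicOp (ψ : ℤ → ℤ) : Chain k A n m →ₗ[k] Chain k A n' m' :=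
  if h : IsLift (n' * (m' + 1)) (n * (m + 1)) ψ then (Regrouping.ofLift n m n' m' ψ h).map else 0

variable {n m n' m' n'' m''} {k A}

theorem cyclicOp_eq {ψ : ℤ → ℤ} (h : IsLift (n' * (m' + 1)) (n * (m + 1)) ψ) :
    cyclicOp k A n m n' m' ψ = (Regrouping.ofLift n m n' m' ψ h).map := dif_pos h

theorem cyclicOp_comp {ψ ψ' : ℤ → ℤ} (h : IsLift (n' * (m' + 1)) (n * (m + 1)) ψ)
    (h' : IsLift (n'' * (m'' + 1)) (n' * (m' + 1)) ψ') :
    cyclicOp k A n' m' n'' m'' ψ' ∘ₗ cyclicOp k A n m n' m' ψ =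
      cyclicOp k A n m n'' m'' (ψ ∘ ψ') := by
  rw [cyclicOp_eq h, cyclicOp_eq h', cyclicOp_eq (h.comp h'), ← Regrouping.map_comp,
    Regrouping.ofLift_comp]

theorem cyclicOp_id : cyclicOp k A n m n m id = LinearMap.id := by
  rw [cyclicOp_eq (isLift_id _), Regrouping.ofLift_id, Regrouping.refl_map]

/-- A lift matters only up to full turns of the source matrix. This is why the `n`-th power of the
rotation is the identity. -/
theorem cyclicOp_add {ψ : ℤ → ℤ} (h : IsLift (n' * (m' + 1)) (n * (m + 1)) ψ) (c : ℤ) :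
    cyclicOp k A n m n' m' (fun y => ψ y + (n * (m + 1) : ℕ) * c) = cyclicOp k A n m n' m' ψ := by
  rw [cyclicOp_eq h, cyclicOp_eq (h.add_const _)]
  congr 1
  refine Regrouping.ext_of (fun y => ?_) (fun y => ?_)
  · simp only [Regrouping.ofLift]
    rw [add_right_comm, unlin_add]
  · simp [Regrouping.ofLift]

/-- There is no condition on `ψ`, since the default value `0` commutes as well; `cyclicHom` relies
on this. -/
theorem cyclicOp_internalDiff (ψ : ℤ → ℤ) :
    cyclicOp k A n m n' m' ψ ∘ₗ internalDiff k n m =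
      internalDiff k n' m' ∘ₗ cyclicOp k A n m n' m' ψ := by
  rw [cyclicOp]
  split_ifs with h
  · exact Regrouping.map_internalDiff _
  · simp

theorem cyclicOp_degree (ψ : ℤ → ℤ) (e : ℤ) :
    (Chain.degree k A n m e).map (cyclicOp k A n m n' m' ψ) ≤ Chain.degree k A n' m' e := by
  rw [cyclicOp]
  split_ifs with h
  · exact Regrouping.map_degree _ e
  · simp

end cyclicOperators

/-! ### Simplicial operators -/

/-- Monotone maps `θ` from `{0, …, N' - 1}` to `{0, …, N - 1}`. -/
structure Valid (N N' : ℕ) (θ : ℕ → ℕ) : Prop where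
  pos : 0 < N'
  lt : ∀ i < N', θ i < N
  mono : ∀ i j, i ≤ j → j < N' → θ i ≤ θ j

/-- The periodic extension of a map from `{0, …, N' - 1}` to `{0, …, N - 1}`. -/
def periodic (N N' : ℕ) (θ : ℕ → ℕ) (y : ℤ) : ℤ := θ (y % N').toNat + N * (y / N')

theorem periodic_apply (N : ℕ) {N' : ℕ} (θ : ℕ → ℕ) {r : ℕ} (hr : r < N') (q : ℤ) :
    periodic N N' θ (r + N' * q) = θ r + N * q := by
  rw [periodic, add_mul_emod hr, add_mul_ediv hr, Int.toNat_natCast]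

theorem periodic_congr (N : ℕ) {N' : ℕ} {θ θ' : ℕ → ℕ} (h0 : 0 < N') (h : ∀ i < N', θ i = θ' i) :
    periodic N N' θ = periodic N N' θ' := by
  funext y
  obtain ⟨r, q, hr, rfl⟩ := exists_eq_add_mul N' h0 y
  rw [periodic_apply N θ hr, periodic_apply N θ' hr, h r hr]

theorem Valid.isLift {N N' : ℕ} {θ : ℕ → ℕ} (h : Valid N N' θ) :
    IsLift N' N (periodic N N' θ) where
  mono y z hyz := by
    obtain ⟨r, q, hr, rfl⟩ := exists_eq_add_mul N' h.pos y
    obtain ⟨r', q', hr', rfl⟩ := exists_eq_add_mul N' h.pos z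
    rw [periodic_apply N θ hr, periodic_apply N θ hr']
    have h1 := h.lt r hr
    rcases lt_trichotomy q q' with hq | rfl | hq
    · have : (N : ℤ) * (q + 1) ≤ N * q' := by gcongr; omega
      linarith
    · have := h.mono r r' (by omega) hr'
      omega
    · exfalso
      have : (N' : ℤ) * (q' + 1) ≤ N' * q := by gcongr; omega
      linarith
  add y := by
    obtain ⟨r, q, hr, rfl⟩ := exists_eq_add_mul N' h.pos y
    rw [show (r : ℤ) + N' * q + N' = r + N' * (q + 1) by ring, periodic_apply N θ hr,
      periodic_apply N θ hr]
    ring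

theorem periodic_comp {N N' N'' : ℕ} {θ θ' : ℕ → ℕ} (h' : Valid N' N'' θ') :
    periodic N N' θ ∘ periodic N' N'' θ' = periodic N N'' (θ ∘ θ') := by
  funext y
  obtain ⟨r, q, hr, rfl⟩ := exists_eq_add_mul N'' h'.pos y
  rw [Function.comp, periodic_apply N' θ' hr, periodic_apply N θ (h'.lt r hr),
    periodic_apply N _ hr]
  rfl

theorem periodic_id {N : ℕ} (h : 0 < N) : periodic N N id = id := by
  funext y
  obtain ⟨r, q, hr, rfl⟩ := exists_eq_add_mul N h y
  rw [periodic_apply N id hr]; rfl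

/-- The map applied in every block separately. -/
def block (N N' : ℕ) (θ : ℕ → ℕ) (y : ℕ) : ℕ := θ (y % N') + N * (y / N')

theorem block_apply (N : ℕ) {N' : ℕ} (θ : ℕ → ℕ) {r : ℕ} (hr : r < N') (q : ℕ) :
    block N N' θ (r + N' * q) = θ r + N * q := by
  rw [block, Nat.add_mul_mod_self_left, Nat.mod_eq_of_lt hr, Nat.add_mul_div_left _ _ (by omega),
    Nat.div_eq_of_lt hr, zero_add]

theorem exists_eq_add_mul_of_lt {n N y : ℕ} (h : y < n * N) :
    ∃ r q, r < N ∧ q < n ∧ y = r + N * q := by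
  have hN : 0 < N := Nat.pos_of_ne_zero (by rintro rfl; simp at h)
  exact ⟨y % N, y / N, Nat.mod_lt _ hN, Nat.div_lt_of_lt_mul (by rwa [Nat.mul_comm]),
    (Nat.mod_add_div y N).symm⟩

theorem add_mul_lt {n N r q : ℕ} (hr : r < N) (hq : q < n) : r + N * q < n * N := by
  have : N * (q + 1) ≤ N * n := Nat.mul_le_mul_left _ hq
  rw [Nat.mul_comm n]; linarith

theorem Valid.block {n N N' : ℕ} {θ : ℕ → ℕ} (hn : 0 < n) (h : Valid N N' θ) :
    Valid (n * N) (n * N') (block N N' θ) where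
  pos := Nat.mul_pos hn h.pos
  lt y hy := by
    obtain ⟨r, q, hr, hq, rfl⟩ := exists_eq_add_mul_of_lt hy
    rw [block_apply N θ hr]
    exact add_mul_lt (h.lt r hr) hq
  mono y z hyz hz := by
    obtain ⟨r, q, hr, hq, rfl⟩ := exists_eq_add_mul_of_lt (hyz.trans_lt hz)
    obtain ⟨r', q', hr', hq', rfl⟩ := exists_eq_add_mul_of_lt hz
    rw [block_apply N θ hr, block_apply N θ hr']
    have h1 := h.lt r hr
    rcases lt_trichotomy q q' with hq | rfl | hq
    · have : N * (q + 1) ≤ N * q' := Nat.mul_le_mul_left _ hq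
      linarith
    · have := h.mono r r' (by omega) hr'
      omega
    · exfalso
      have : N' * (q' + 1) ≤ N' * q := Nat.mul_le_mul_left _ hq
      linarith

/-- Repeating `θ` in `n` blocks before extending it periodically changes nothing. Thus an operator
of the complex of `A^{⊗n}`, acting on all columns alike, and an operator of the subdivision of the
chains of `A` have the same lift. -/
theorem periodic_block {n N N' : ℕ} (hN' : 0 < N') (θ : ℕ → ℕ) (hn : 0 < n) :
    periodic (n * N) (n * N') (block N N' θ) = periodic N N' θ := by
  funext y
  obtain ⟨r, q, hr, rfl⟩ := exists_eq_add_mul (n * N') (Nat.mul_pos hn hN') y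
  obtain ⟨i, j, hi, hj, rfl⟩ := exists_eq_add_mul_of_lt hr
  rw [periodic_apply _ _ hr, block_apply N θ hi]
  have : ((i + N' * j : ℕ) : ℤ) + (n * N' : ℕ) * q = i + N' * (j + n * q) := by push_cast; ring
  rw [this, periodic_apply N θ hi]
  push_cast; ring

theorem block_block {n N N' : ℕ} (hN' : 0 < N') (θ : ℕ → ℕ) (hn : 0 < n) :
    block (n * N) (n * N') (block N N' θ) = block N N' θ := by
  funext y
  have h := Nat.mod_lt y (Nat.mul_pos hn hN')
  obtain ⟨i, j, hi, hj, e⟩ := exists_eq_add_mul_of_lt h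
  have hy := Nat.mod_add_div y (n * N')
  generalize y / (n * N') = q at *
  rw [e] at hy h
  rw [← hy, block_apply _ _ h, block_apply N θ hi]
  have : i + N' * j + n * N' * q = i + N' * (j + n * q) := by ring
  rw [this, block_apply N θ hi]
  ring

/-! ### Signed sums over words -/

/-- The words of length `m` in the letters `0, …, n - 1`. -/
def words (n : ℕ) : ℕ → Finset (List ℕ)
  | 0 => {[]}
  | m + 1 => (Finset.range n ×ˢ words n m).image fun p => p.1 :: p.2

/-- The sign of the permutation that sorts a word. -/
def wordSign : List ℕ → ℤ
  | [] => 1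
  | a :: w => (-1) ^ w.countP (· < a) * wordSign w

section words

variable {M : Type*} [AddCommGroup M]

theorem sum_words_zero (n : ℕ) (G : List ℕ → M) : ∑ w ∈ words n 0, G w = G [] := by
  simp [words]

theorem sum_words_succ (n m : ℕ) (G : List ℕ → M) :
    ∑ w ∈ words n (m + 1), G w = ∑ a ∈ Finset.range n, ∑ w ∈ words n m, G (a :: w) := by
  rw [words, Finset.sum_image, Finset.sum_product]
  rintro p - q - h
  simp only [List.cons.injEq] at h
  exact Prod.ext h.1 h.2

theorem sum_words_add (n i j : ℕ) (G : List ℕ → M) :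
    ∑ w ∈ words n (i + j), G w = ∑ u ∈ words n i, ∑ v ∈ words n j, G (u ++ v) := by
  induction i generalizing G with
  | zero => simp [sum_words_zero]
  | succ i ih => rw [Nat.succ_add, sum_words_succ, sum_words_succ]; simp [ih]

theorem mem_words {n m : ℕ} {w : List ℕ} :
    w ∈ words n m ↔ w.length = m ∧ ∀ a ∈ w, a < n := by
  induction m generalizing w with
  | zero =>
    simp only [words, Finset.mem_singleton, List.length_eq_zero_iff, iff_self_and]
    rintro rfl; simp
  | succ m ih =>
    cases w with
    | nil => simp [words]
    | cons a w =>
      simp only [words, Finset.mem_image, Finset.mem_product, Finset.mem_range, Prod.exists,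
        List.cons.injEq, List.length_cons, Nat.add_right_cancel_iff,
        List.mem_cons, forall_eq_or_imp]
      constructor
      · rintro ⟨b, v, ⟨h1, h2⟩, rfl, rfl⟩
        exact ⟨(ih.1 h2).1, h1, (ih.1 h2).2⟩
      · rintro ⟨h1, h2, h3⟩
        exact ⟨a, w, ⟨h2, ih.2 ⟨h1, h3⟩⟩, rfl, rfl⟩

/-- The number of inversions changes by exactly one. -/
theorem wordSign_swap (u v : List ℕ) {a b : ℕ} (h : a ≠ b) :
    wordSign (u ++ a :: b :: v) = - wordSign (u ++ b :: a :: v) := by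
  induction u with
  | nil =>
    simp only [List.nil_append, wordSign, List.countP_cons, pow_add]
    rcases lt_or_gt_of_ne h with h | h <;> simp [h, h.not_gt] <;> ring
  | cons c u ih =>
    simp only [List.cons_append, wordSign, ih, List.countP_append, List.countP_cons, mul_neg]
    rw [Nat.add_right_comm (List.countP _ v)]

/-- The additional copy of `a` forms inversions with the larger letters in front of it and with the
smaller letters behind it. -/
theorem wordSign_double (u v : List ℕ) (a : ℕ) :
    wordSign (u ++ a :: a :: v) =
      (-1) ^ (u.countP (a < ·) + v.countP (· < a)) * wordSign (u ++ a :: v) := by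
  induction u with
  | nil => simp [wordSign]
  | cons c u ih =>
    simp only [List.cons_append, wordSign, ih, List.countP_append, List.countP_cons, pow_add]
    by_cases h : a < c <;> simp [h] <;> ring

theorem wordSign_double_head (v : List ℕ) (a : ℕ) : wordSign (a :: a :: v) = wordSign v := by
  simp only [wordSign, List.countP_cons, lt_irrefl, decide_false, Bool.false_eq_true, if_false,
    add_zero, ← mul_assoc, ← pow_add]
  rw [Even.neg_one_pow ⟨_, rfl⟩, one_mul]

theorem wordSign_append_singleton (v : List ℕ) (a : ℕ) :
    wordSign (v ++ [a]) = (-1) ^ v.countP (a < ·) * wordSign v := by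
  induction v with
  | nil => simp [wordSign]
  | cons c v ih =>
    simp only [List.cons_append, wordSign, ih, List.countP_append, List.countP_cons, pow_add]
    by_cases h : a < c <;> simp [h] <;> ring

/-- Opposite off-diagonal terms are matched by an involution, so no division by two is needed. -/
theorem sum_antisymm {ι : Type*} [DecidableEq ι] (s : Finset ι) (f : ι → ι → M)
    (h : ∀ a b, a ≠ b → f a b = - f b a) : ∑ a ∈ s, ∑ b ∈ s, f a b = ∑ a ∈ s, f a a := by
  have h1 : ∀ a b, f a b = (if a = b then f a a else 0) + (if a = b then 0 else f a b) := by
    intro a b; split_ifs with h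
    · subst h; simp
    · simp
  have h2 : ∑ a ∈ s, ∑ b ∈ s, (if a = b then 0 else f a b) = 0 := by
    rw [← Finset.sum_product']
    refine Finset.sum_involution (fun q _ => q.swap) ?_ ?_ ?_ ?_
    · rintro ⟨x, y⟩ -
      by_cases hxy : x = y
      · simp [hxy]
      · simp [hxy, Ne.symm hxy, h x y hxy]
    · rintro ⟨x, y⟩ - hxy hs
      simp only [Prod.swap_prod_mk, Prod.mk.injEq] at hs
      simp [hs.1] at hxy
    · rintro ⟨x, y⟩ hxy
      simpa [and_comm] using hxy
    · simp
  rw [Finset.sum_congr rfl fun a _ => Finset.sum_congr rfl fun b _ => h1 a b]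
  simp only [Finset.sum_add_distrib, h2, add_zero]
  refine Finset.sum_congr rfl fun a ha => ?_
  simp [ha]

/-- Terms in which two different adjacent letters may be exchanged cancel. -/
theorem sum_words_swap (n i j : ℕ) (G : List ℕ → M)
    (hs : ∀ u a b v, u.length = i → G (u ++ a :: b :: v) = G (u ++ b :: a :: v)) :
    ∑ w ∈ words n (i + (j + 2)), wordSign w • G w =
      ∑ u ∈ words n i, ∑ a ∈ Finset.range n, ∑ v ∈ words n j,
        wordSign (u ++ a :: a :: v) • G (u ++ a :: a :: v) := by
  rw [sum_words_add]
  refine Finset.sum_congr rfl fun u hu => ?_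
  simp only [sum_words_succ]
  rw [sum_antisymm]
  intro a b hab
  rw [← Finset.sum_neg_distrib]
  refine Finset.sum_congr rfl fun v _ => ?_
  rw [wordSign_swap u v hab, hs u a b v (mem_words.1 hu).1, neg_smul]

/-- The place, in the sorted word, of the `i`-th letter. -/
def letterRank (w : List ℕ) (i : ℕ) : ℕ :=
  w.countP (· < w.getD i 0) + (w.take i).count (w.getD i 0)

theorem letterRank_append (u v : List ℕ) (a : ℕ) :
    letterRank (u ++ a :: v) u.length = (u ++ a :: v).countP (· < a) + u.count a := by
  simp [letterRank]

theorem length_eq_countP (u : List ℕ) (a : ℕ) :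
    u.length = u.countP (· < a) + u.count a + u.countP (a < ·) := by
  induction u with
  | nil => rfl
  | cons c u ih =>
    simp only [List.length_cons, List.countP_cons, List.count_cons, ih]
    rcases lt_trichotomy c a with h | rfl | h
    · simp [h, h.not_gt, h.ne]; omega
    · simp; omega
    · simp [h, h.not_gt, h.ne']; omega

theorem countP_lt_add_count_le (w : List ℕ) {a b : ℕ} (h : a < b) :
    w.countP (· < a) + w.count a ≤ w.countP (· < b) := by
  induction w with
  | nil => simp
  | cons c w ih =>
    simp only [List.countP_cons, List.count_cons, beq_iff_eq, decide_eq_true_eq]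
    split_ifs <;> omega

theorem count_take_lt {w : List ℕ} {i j : ℕ} (hij : i < j) (hi : i < w.length) :
    (w.take i).count (w.getD i 0) < (w.take j).count (w.getD i 0) := by
  have h1 : (w.take (i + 1)).Sublist (w.take j) := List.take_sublist_take_left hij
  have h2 := h1.count_le (w.getD i 0)
  rw [List.take_succ_eq_append_getElem hi, List.count_append, List.getD_eq_getElem _ _ hi] at h2
  rw [List.getD_eq_getElem _ _ hi]
  simp at h2; omega

theorem letterRank_lt' {w : List ℕ} {i : ℕ} (hi : i < w.length) :
    letterRank w i < w.countP (· < w.getD i 0) + w.count (w.getD i 0) := by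
  have := count_take_lt hi hi
  rw [List.take_length] at this
  simp only [letterRank]; omega

/-- Sorting a word permutes its places: the ranks of different letters lie in disjoint intervals,
and those of equal letters increase from left to right. -/
theorem sum_letterRank (w : List ℕ) (F : ℕ → M) :
    ∑ i ∈ Finset.range w.length, F (letterRank w i) = ∑ x ∈ Finset.range w.length, F x := by
  have hmaps : Set.MapsTo (letterRank w) (Finset.range w.length) (Finset.range w.length) := by
    intro i hi
    simp only [Finset.coe_range, Set.mem_Iio] at hi ⊢
    have h1 := letterRank_lt' hi
    have h2 := length_eq_countP w (w.getD i 0)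
    omega
  have hlt : ∀ i j, i < j → j < w.length → letterRank w i ≠ letterRank w j := by
    intro i j hij hj
    have h1 := letterRank_lt' (hij.trans hj)
    have h2 := letterRank_lt' hj
    rcases lt_trichotomy (w.getD i 0) (w.getD j 0) with h | h | h
    · have := countP_lt_add_count_le w h
      simp only [letterRank] at *; omega
    · have := count_take_lt hij (hij.trans hj)
      simp only [letterRank, h] at *; omega
    · have := countP_lt_add_count_le w h
      simp only [letterRank] at *; omega
  have hinj : Set.InjOn (letterRank w) (Finset.range w.length) := by
    intro i hi j hj hij
    simp only [Finset.coe_range, Set.mem_Iio] at hi hj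
    rcases lt_trichotomy i j with h | h | h
    · exact absurd hij (hlt i j h hj)
    · exact h
    · exact absurd hij.symm (hlt j i h hi)
  exact Finset.sum_nbij (letterRank w) hmaps hinj
    (Finset.surjOn_of_injOn_of_card_le _ hmaps hinj le_rfl) (fun _ _ => rfl)

/-- In an alternating sum over the adjacent pairs of letters only the pairs of equal letters
contribute, and these correspond to the letters of the words that are shorter by one. -/
theorem sum_words_adjacent (n m : ℕ) (G : ℕ → List ℕ → M) (G' : List ℕ → ℕ → M)
    (hs : ∀ u a b v, G u.length (u ++ a :: b :: v) = G u.length (u ++ b :: a :: v))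
    (hd : ∀ u a v, u ++ a :: v ∈ words n m → G u.length (u ++ a :: a :: v) =
      G' (u ++ a :: v) ((u ++ a :: v).countP (· < a) + u.count a)) :
    ∑ i ∈ Finset.range m, (-1 : ℤ) ^ (i + 1) • ∑ w ∈ words n (m + 1), wordSign w • G i w =
      ∑ w ∈ words n m, wordSign w • ∑ x ∈ Finset.range m, (-1 : ℤ) ^ (x + 1) • G' w x := by
  have h1 : ∀ i ∈ Finset.range m,
      (-1 : ℤ) ^ (i + 1) • ∑ w ∈ words n (m + 1), wordSign w • G i w =
      ∑ w ∈ words n m, wordSign w • (-1 : ℤ) ^ (letterRank w i + 1) • G' w (letterRank w i) := by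
    intro i hi
    rw [Finset.mem_range] at hi
    obtain ⟨j, rfl⟩ : ∃ j, m = i + (j + 1) := ⟨m - i - 1, by omega⟩
    rw [show i + (j + 1) + 1 = i + (j + 2) by ring, sum_words_swap, sum_words_add, Finset.smul_sum]
    · refine Finset.sum_congr rfl fun u hu => ?_
      rw [sum_words_succ, Finset.smul_sum]
      refine Finset.sum_congr rfl fun a ha => ?_
      rw [Finset.smul_sum]
      refine Finset.sum_congr rfl fun v hv => ?_
      rw [mem_words] at hu hv
      have hw : u ++ a :: v ∈ words n (i + (j + 1)) := by
        rw [mem_words]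
        refine ⟨by simp [hu.1, hv.1], ?_⟩
        simp only [List.mem_append, List.mem_cons]
        rintro b (hb | rfl | hb)
        · exact hu.2 b hb
        · simpa using ha
        · exact hv.2 b hb
      obtain ⟨rfl, -⟩ := hu
      rw [letterRank_append, hd u a v hw, wordSign_double]
      simp only [smul_smul]
      congr 1
      rw [← mul_assoc, mul_comm (wordSign _)]
      congr 1
      rw [← pow_add]
      apply neg_one_pow_congr
      -- The face number `u.length` splits into the letters of `u` below, equal to and above `a`.
      -- Those above cancel against the sign of the doubling, and what is left is the rank of `a` in
      -- the whole word.
      have := length_eq_countP u a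
      simp only [List.countP_append, List.countP_cons, lt_irrefl, decide_false, Bool.false_eq_true,
        if_false]
      rw [this]
      simp only [Nat.even_add, Nat.even_add_one]
      tauto
    · rintro u a b v rfl; exact hs u a b v
  rw [Finset.sum_congr rfl h1, Finset.sum_comm]
  refine Finset.sum_congr rfl fun w hw => ?_
  rw [← Finset.smul_sum]
  congr 1
  obtain ⟨rfl, -⟩ := mem_words.1 hw
  exact sum_letterRank w (fun x => (-1 : ℤ) ^ (x + 1) • G' w x)

/-! ### The signed numbers of words and of shuffles -/

/-- The number of the words of length `r` in `l` letters, counted with signs. -/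
def signedWords (r l : ℕ) : ℤ := ∑ w ∈ words l r, wordSign w

/-- By `sum_words_swap` only words that begin with a double letter survive. A double letter at the
front does not affect the sign, and there are `l` of them. -/
theorem signedWords_add_two (r l : ℕ) : signedWords (r + 2) l = l * signedWords r l := by
  have := sum_words_swap l 0 r (fun _ => (1 : ℤ)) (by simp)
  simp only [zero_add, smul_eq_mul, mul_one, sum_words_zero, List.nil_append,
    wordSign_double_head] at this
  rw [signedWords, this]
  simp [signedWords]

theorem signedWords_zero (l : ℕ) : signedWords 0 l = 1 := by
  simp [signedWords, sum_words_zero, wordSign]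

theorem signedWords_one (l : ℕ) : signedWords 1 l = l := by
  simp [signedWords, sum_words_succ, sum_words_zero, wordSign]

/-- Both numbers are `l ^ (a + 1)`. The equality allows coefficients with odd and with even indices
to be combined in Pascal's rule. -/
theorem signedWords_odd (a l : ℕ) : signedWords (2 * a + 1) l = signedWords (2 * a + 2) l := by
  induction a with
  | zero => simp [signedWords_add_two, signedWords_zero, signedWords_one]
  | succ a ih =>
    rw [show 2 * (a + 1) + 1 = 2 * a + 1 + 2 by ring, signedWords_add_two, ih,
      show 2 * (a + 1) + 2 = 2 * a + 2 + 2 by ring, ← signedWords_add_two]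

/-- The number of the words of length `r` in two letters that contain the letter `0` exactly `p`
times, counted with signs. -/
def signedPatterns (p r : ℕ) : ℤ := ∑ w ∈ words 2 r, if w.count 0 = p then wordSign w else 0

/-- The surviving words begin with two letters `0` or with two letters `1`. -/
theorem signedPatterns_add_two (p r : ℕ) : signedPatterns p (r + 2) =
    (if 2 ≤ p then signedPatterns (p - 2) r else 0) + signedPatterns p r := by
  have := sum_words_swap 2 0 r (fun w => if w.count 0 = p then (1 : ℤ) else 0) (by
    intro u a b v _
    simp only [List.count_append, List.count_cons]
    rw [Nat.add_right_comm (List.count _ v)])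
  simp only [zero_add, smul_eq_mul, mul_ite, mul_one, mul_zero, sum_words_zero, List.nil_append,
    wordSign_double_head] at this
  rw [signedPatterns, this, Finset.sum_range_succ, Finset.sum_range_one]
  congr 1
  · split_ifs with h
    · refine Finset.sum_congr rfl fun w _ => if_congr ?_ rfl rfl
      simp; omega
    · refine Finset.sum_eq_zero fun w _ => if_neg ?_
      simp; omega

theorem signedY_add_two (p q : ℕ) : signedY (p + 2) (q + 2) = signedY p (q + 2) + signedY (p + 2) q := by
  simp only [signedY, Nat.even_add, even_two, iff_true]
  split_ifs with h
  · have h1 : (p + 2 + (q + 2)) / 2 = (p + q + 2) / 2 + 1 := by omega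
    have h2 : (p + (q + 2)) / 2 = (p + q + 2) / 2 := by omega
    have h3 : (p + 2 + q) / 2 = (p + q + 2) / 2 := by omega
    have h4 : (p + 2) / 2 = p / 2 + 1 := by omega
    rw [h1, h2, h3, h4, Nat.choose_succ_succ]; push_cast; ring
  · simp

/-- Both sides satisfy the same two-step recursion, which on the right is Pascal's rule
`signedY_add_two`; what remains are the cases at the border. -/
theorem signedPatterns_eq (p r : ℕ) :
    signedPatterns p r = if p ≤ r then signedY p (r - p) else 0 := by
  induction r using Nat.strong_induction_on generalizing p with
  | _ r ih =>
    match r with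
    | 0 =>
      by_cases h : p = 0
      · subst h; simp [signedPatterns, sum_words_zero, wordSign, signedY]
      · simp [signedPatterns, sum_words_zero, h, Ne.symm h]
    | 1 =>
      have : signedPatterns p 1 = (if p = 1 then 1 else 0) + (if p = 0 then 1 else 0) := by
        rw [signedPatterns, sum_words_succ, Finset.sum_range_succ, Finset.sum_range_one]
        simp [sum_words_zero, wordSign, eq_comm]
      rw [this]
      match p with
      | 0 => simp [signedY]
      | 1 => simp [signedY]
      | p + 2 => simp
    | r + 2 =>
      rw [signedPatterns_add_two, ih r (by omega), ih r (by omega)]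
      match p with
      | 0 => simp [signedY]
      | 1 =>
        rcases r with _ | r
        · simp [signedY]
        · simp [signedY, Nat.even_add, parity_simps]
      | p + 2 =>
        simp only [Nat.le_add_left, if_true, Nat.add_sub_cancel, Nat.add_le_add_iff_right,
          Nat.add_sub_add_right]
        by_cases h1 : p ≤ r
        · rw [if_pos h1, if_pos h1]
          by_cases h2 : p + 2 ≤ r
          · rw [if_pos h2]
            obtain ⟨q, rfl⟩ : ∃ q, r = p + 2 + q := ⟨r - (p + 2), by omega⟩
            rw [show p + 2 + q - p = q + 2 by omega, Nat.add_sub_cancel_left, signedY_add_two]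
          · rw [if_neg h2, add_zero]
            obtain rfl | rfl : r = p ∨ r = p + 1 := by omega
            · simp [signedY]
            · have h5 : (p + 2 + 1) / 2 = (p + 1) / 2 + 1 := by omega
              have h6 : (p + 2) / 2 = p / 2 + 1 := by omega
              simp only [Nat.add_sub_cancel_left, signedY, Nat.even_add, even_two, iff_true, h5, h6]
              split_ifs with h7
              · have h8 : (p + 1) / 2 = p / 2 := by
                  rcases h7 with ⟨x, rfl⟩ | h7
                  · omega
                  · simp at h7
                rw [h8]; simp
              · rfl
        · rw [if_neg h1, if_neg (by omega), if_neg h1, add_zero]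

end words

/-! ### Simplicial objects and their subdivisions -/

/-- A simplicial object, given by its objects `V N` of simplices with `N ≥ 1` vertices and by its
operators `op N N' θ`, where `θ` is a monotone map from `{0, …, N' - 1}` to `{0, …, N - 1}`. -/
structure SimplicialOps (C : Type u) [Category.{v} C] where
  V : ℕ → C
  op : ∀ (N N' : ℕ) (_ : ℕ → ℕ), V N ⟶ V N'
  op_id : ∀ {N : ℕ}, 0 < N → op N N id = 𝟙 (V N)
  op_comp : ∀ {N N' N'' : ℕ} {θ θ' : ℕ → ℕ}, Valid N N' θ → Valid N' N'' θ' →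
    op N N' θ ≫ op N' N'' θ' = op N N'' (θ ∘ θ')
  op_congr : ∀ {N N' : ℕ} {θ θ' : ℕ → ℕ}, 0 < N' → (∀ i < N', θ i = θ' i) →
    op N N' θ = op N N' θ'

/-- The monotone injection that omits the value `i`. -/
def coface (i x : ℕ) : ℕ := if x < i then x else x + 1

theorem valid_coface {N : ℕ} (h : 0 < N) (i : ℕ) : Valid (N + 1) N (coface i) where
  pos := h
  lt x hx := by unfold coface; split_ifs <;> omega
  mono x y hxy _ := by unfold coface; split_ifs <;> omega

theorem coface_comp {i j : ℕ} (h : i < j) : coface j ∘ coface i = coface i ∘ coface (j - 1) := by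
  funext x; simp only [Function.comp, coface]; split_ifs <;> omega

theorem block_id {N : ℕ} : block N N id = id := by
  funext y; simp [block, Nat.mod_add_div]

theorem block_comp {N N' N'' : ℕ} {θ θ' : ℕ → ℕ} (h' : Valid N' N'' θ') :
    block N N' θ ∘ block N' N'' θ' = block N N'' (θ ∘ θ') := by
  funext y
  have hr := Nat.mod_lt y h'.pos
  rw [← Nat.mod_add_div y N'', Function.comp, block_apply N' θ' hr,
    block_apply N θ (h'.lt _ hr), block_apply N _ hr]
  rfl

/-- The map which sends the vertex `r` to the vertex `r` of the block `s`. -/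
def inBlock (N s r : ℕ) : ℕ := r + N * s

theorem valid_inBlock {n N s : ℕ} (hN : 0 < N) (hs : s < n) : Valid (n * N) N (inBlock N s) where
  pos := hN
  lt r hr := add_mul_lt hr hs
  mono r r' _ _ := by unfold inBlock; omega

theorem block_inBlock {N N' r : ℕ} (θ : ℕ → ℕ) (hr : r < N') (s : ℕ) :
    (block N N' θ ∘ inBlock N' s) r = (inBlock N s ∘ θ) r := by
  simp only [Function.comp, inBlock]; rw [block_apply N θ hr]

namespace SimplicialOps

variable {C : Type u} [Category.{v} C]

/-- The edgewise subdivision of a simplicial object. -/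
def subdivision (X : SimplicialOps C) (n : ℕ) (hn : 0 < n) : SimplicialOps C where
  V N := X.V (n * N)
  op N N' θ := X.op (n * N) (n * N') (block N N' θ)
  op_id {_} hN := by rw [block_id, X.op_id (Nat.mul_pos hn hN)]
  op_comp h h' := by rw [X.op_comp (h.block hn) (h'.block hn), block_comp h']
  op_congr {N N' θ θ'} h0 h := by
    refine X.op_congr (Nat.mul_pos hn h0) fun y _ => ?_
    rw [block, block, h _ (Nat.mod_lt y h0)]

variable [Preadditive C] (X : SimplicialOps C)

/-- The alternating sum of the face maps. -/
def boundary (N : ℕ) : X.V (N + 1) ⟶ X.V N :=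
  ∑ i ∈ Finset.range (N + 1), (-1 : ℤ) ^ i • X.op (N + 1) N (coface i)

theorem op_boundary {N N' : ℕ} {θ : ℕ → ℕ} (h : Valid N (N' + 1) θ) (h' : 0 < N') :
    X.op N (N' + 1) θ ≫ X.boundary N' =
      ∑ i ∈ Finset.range (N' + 1), (-1 : ℤ) ^ i • X.op N N' (θ ∘ coface i) := by
  rw [boundary, Preadditive.comp_sum]
  refine Finset.sum_congr rfl fun i _ => ?_
  rw [Preadditive.comp_zsmul, X.op_comp h (valid_coface h' i)]

theorem boundary_op {N N' : ℕ} {θ : ℕ → ℕ} (h : Valid N N' θ) :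
    X.boundary N ≫ X.op N N' θ =
      ∑ i ∈ Finset.range (N + 1), (-1 : ℤ) ^ i • X.op (N + 1) N' (coface i ∘ θ) := by
  have hN : 0 < N := (Nat.zero_le _).trans_lt (h.lt 0 h.pos)
  rw [boundary, Preadditive.sum_comp]
  refine Finset.sum_congr rfl fun i _ => ?_
  rw [Preadditive.zsmul_comp, X.op_comp (valid_coface hN i) h]

theorem boundary_boundary {N : ℕ} (hN : 0 < N) : X.boundary (N + 1) ≫ X.boundary N = 0 := by
  rw [boundary, Preadditive.sum_comp]
  simp only [Preadditive.zsmul_comp, X.op_boundary (valid_coface (Nat.succ_pos N) _) hN,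
    Finset.smul_sum, smul_smul, ← pow_add]
  rw [← Finset.sum_product']
  -- Two vertices can be omitted in either order. The involution exchanges the two orders, which
  -- give the same operator by `coface_comp` but opposite signs.
  refine Finset.sum_involution
    (fun q _ => if q.2 < q.1 then (q.2, q.1 - 1) else (q.2 + 1, q.1)) ?_ ?_ ?_ ?_
  · rintro ⟨i, j⟩ h
    simp only
    split_ifs with hij
    · simp only
      rw [coface_comp hij, ← add_smul]
      obtain ⟨i, rfl⟩ : ∃ i', i = i' + 1 := ⟨i - 1, by omega⟩
      rw [Nat.add_sub_cancel, show i + 1 + j = j + i + 1 by ring, pow_succ (-1 : ℤ) (j + i)]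
      simp
    · simp only
      rw [coface_comp (show i < j + 1 by omega), Nat.add_sub_cancel, ← add_smul,
        add_right_comm j 1 i, pow_succ (-1 : ℤ) (j + i), add_comm j i]
      simp
  · rintro ⟨i, j⟩ h - heq
    simp only at heq
    split_ifs at heq with hij <;> simp only [Prod.mk.injEq] at heq <;> omega
  · rintro ⟨i, j⟩ h
    simp only [Finset.mem_product, Finset.mem_range] at h ⊢
    split_ifs <;> simp only <;> omega
  · rintro ⟨i, j⟩ h
    simp only
    by_cases hij : j < i
    · simp only [hij, if_true]
      rw [if_neg (by omega)]
      congr 1; omega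
    · simp only [hij, if_false]
      rw [if_pos (by omega)]
      rfl

/-- The boundary of the subdivision. -/
def blockBoundary (n N : ℕ) : X.V (n * (N + 1)) ⟶ X.V (n * N) :=
  ∑ i ∈ Finset.range (N + 1), (-1 : ℤ) ^ i • X.op (n * (N + 1)) (n * N) (block (N + 1) N (coface i))

/-! ### The subdivision map -/

/-- The vertex of the standard simplex in the row `y % N` and the column `y / N` of the
piece of the subdivision that is given by a word. -/
def wordVertex (N : ℕ) (w : List ℕ) (y : ℕ) : ℕ :=
  w.countP (· < y / N) + (w.take (y % N)).count (y / N)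

theorem wordVertex_apply {N : ℕ} (w : List ℕ) {r : ℕ} (hr : r < N) (j : ℕ) :
    wordVertex N w (r + N * j) = w.countP (· < j) + (w.take r).count j := by
  rw [wordVertex, Nat.add_mul_mod_self_left, Nat.mod_eq_of_lt hr,
    Nat.add_mul_div_left _ _ (by omega), Nat.div_eq_of_lt hr, zero_add]

theorem countP_add_count_le (w : List ℕ) (j r : ℕ) :
    w.countP (· < j) + (w.take r).count j ≤ w.length := by
  have h1 := length_eq_countP w j
  have h2 := (List.take_sublist r w).count_le j
  omega

theorem valid_wordVertex {n m : ℕ} (hn : 0 < n) {w : List ℕ} (hw : w.length = m) :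
    Valid (m + 1) (n * (m + 1)) (wordVertex (m + 1) w) where
  pos := Nat.mul_pos hn (Nat.succ_pos m)
  lt y hy := by
    have := countP_add_count_le w (y / (m + 1)) (y % (m + 1))
    rw [wordVertex]; omega
  mono y z hyz hz := by
    obtain ⟨r, q, hr, hq, rfl⟩ := exists_eq_add_mul_of_lt (hyz.trans_lt hz)
    obtain ⟨r', q', hr', hq', rfl⟩ := exists_eq_add_mul_of_lt hz
    rw [wordVertex_apply w hr, wordVertex_apply w hr']
    rcases lt_trichotomy q q' with hq | rfl | hq
    · have h1 := countP_lt_add_count_le w hq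
      have h2 := (List.take_sublist r w).count_le q
      omega
    · have h2 := (List.take_sublist_take_left (l := w) (show r ≤ r' by omega)).count_le q
      omega
    · exfalso
      have : (m + 1) * (q' + 1) ≤ (m + 1) * q := Nat.mul_le_mul_left _ hq
      linarith

/-- The subdivision map from the simplices with `m + 1` vertices to those of the subdivision. -/
def subdivide (n m : ℕ) : X.V (m + 1) ⟶ X.V (n * (m + 1)) :=
  ∑ w ∈ words n m, wordSign w • X.op (m + 1) (n * (m + 1)) (wordVertex (m + 1) w)

/-- The omitted row is the only one that lies between the two letters, so their order is no longer
visible; this is the symmetry that `sum_words_adjacent` asks for. -/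
theorem count_take_coface (u v : List ℕ) (a b j r : ℕ) :
    ((u ++ a :: b :: v).take (coface (u.length + 1) r)).count j =
      ((u ++ b :: a :: v).take (coface (u.length + 1) r)).count j := by
  unfold coface
  split_ifs with h
  · rw [List.take_append_of_le_length (by omega), List.take_append_of_le_length (by omega)]
  · obtain ⟨t, rfl⟩ : ∃ t, r = u.length + 1 + t := ⟨r - (u.length + 1), by omega⟩
    rw [show u.length + 1 + t + 1 = u.length + (t + 2) by ring, List.take_length_add_append,
      List.take_length_add_append]
    simp only [List.take_succ_cons, List.count_append, List.count_cons]
    omega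

theorem count_take_double (u v : List ℕ) (a j r : ℕ) :
    ((u ++ a :: a :: v).take (coface (u.length + 1) r)).count j =
      ((u ++ a :: v).take r).count j + if u.length < r ∧ a = j then 1 else 0 := by
  unfold coface
  split_ifs with h h1 h1
  · omega
  · rw [List.take_append_of_le_length (by omega), List.take_append_of_le_length (by omega)]; rfl
  · obtain ⟨t, rfl⟩ : ∃ t, r = u.length + (t + 1) := ⟨r - (u.length + 1), by omega⟩
    rw [add_assoc, List.take_length_add_append, List.take_length_add_append]
    simp only [List.take_succ_cons, List.count_append, List.count_cons, beq_iff_eq, h1.2, if_true]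
    ring
  · have hj : a ≠ j := by rintro rfl; exact h1 ⟨by omega, rfl⟩
    obtain ⟨t, rfl⟩ : ∃ t, r = u.length + (t + 1) := ⟨r - (u.length + 1), by omega⟩
    rw [add_assoc, List.take_length_add_append, List.take_length_add_append]
    simp [List.take_succ_cons, List.count_append, hj]

theorem count_take_append (u v : List ℕ) (a j r : ℕ) :
    (((u ++ a :: v).take r).count j : ℕ) =
      (if u.length < r then u.count j + (if a = j then 1 else 0) +
        (v.take (r - u.length - 1)).count j else (u.take r).count j) := by
  split_ifs with h h1
  · obtain ⟨t, rfl⟩ : ∃ t, r = u.length + (t + 1) := ⟨r - (u.length + 1), by omega⟩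
    rw [List.take_length_add_append]
    simp [List.take_succ_cons, List.count_append, h1]
    ring
  · obtain ⟨t, rfl⟩ : ∃ t, r = u.length + (t + 1) := ⟨r - (u.length + 1), by omega⟩
    rw [List.take_length_add_append]
    simp [List.take_succ_cons, List.count_append, h1]
  · rw [List.take_append_of_le_length (by omega)]

/-- Doubling a letter of a word amounts to omitting the vertex after its rank. -/
theorem vertex_double (u v : List ℕ) (a j r : ℕ) :
    (u ++ a :: a :: v).countP (· < j) +
        ((u ++ a :: a :: v).take (coface (u.length + 1) r)).count j =
      coface ((u ++ a :: v).countP (· < a) + u.count a + 1)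
        ((u ++ a :: v).countP (· < j) + ((u ++ a :: v).take r).count j) := by
  rw [count_take_double]
  have h1 : (u ++ a :: a :: v).countP (· < j) = (u ++ a :: v).countP (· < j) +
      if a < j then 1 else 0 := by
    simp only [List.countP_append, List.countP_cons, decide_eq_true_eq]; ring
  rw [h1]
  rcases lt_trichotomy a j with h | rfl | h
  · have h2 := countP_lt_add_count_le (u ++ a :: v) h
    have h3 : u.count a < (u ++ a :: v).count a := by simp
    rw [if_pos h, if_neg (by omega), coface, if_neg (by omega)]; omega
  · rw [if_neg (lt_irrefl _)]
    by_cases h : u.length < r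
    · have h3 := count_take_append u v a a r
      rw [if_pos h, if_pos rfl] at h3
      rw [if_pos ⟨h, rfl⟩, coface, if_neg (by omega)]; omega
    · have h3 := count_take_append u v a a r
      rw [if_neg h] at h3
      have h4 := (List.take_sublist r u).count_le a
      rw [if_neg (by omega), coface, if_pos (by omega)]; omega
  · have h2 := countP_lt_add_count_le (u ++ a :: v) h
    have h3 := (List.take_sublist r (u ++ a :: v)).count_le j
    rw [if_neg (by omega), if_neg (by omega), coface, if_pos (by omega)]; omega

/-- For the inner faces, different adjacent letters cancel, and a double letter gives an inner face
of the original simplex, numbered by the rank of the letter (`vertex_double`). The outer faces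
delete the first or the last letter. Deleting a last letter `a` yields the same simplex as deleting
a first letter `a + 1`, with the opposite sign, so only the first letter `0` and the last letter `n
- 1` survive. These give the outer faces of the original simplex. -/
theorem subdivide_boundary (n m : ℕ) (hn : 0 < n) :
    X.subdivide n (m + 1) ≫ X.blockBoundary n (m + 1) =
      X.boundary (m + 1) ≫ X.subdivide n m := by
  have hpos : 0 < n * (m + 1) := Nat.mul_pos hn (Nat.succ_pos m)
  set E : ℕ → List ℕ → (X.V (m + 2) ⟶ X.V (n * (m + 1))) := fun i w =>
    X.op (m + 2) (n * (m + 1)) (fun y => w.countP (· < y / (m + 1)) +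
      (w.take (coface i (y % (m + 1)))).count (y / (m + 1))) with hE
  set E' : List ℕ → ℕ → (X.V (m + 2) ⟶ X.V (n * (m + 1))) := fun w x =>
    X.op (m + 2) (n * (m + 1)) (coface x ∘ wordVertex (m + 1) w) with hE'
  have hL : X.subdivide n (m + 1) ≫ X.blockBoundary n (m + 1) =
      ∑ i ∈ Finset.range (m + 2), (-1 : ℤ) ^ i • ∑ w ∈ words n (m + 1), wordSign w • E i w := by
    rw [subdivide, Preadditive.sum_comp]
    simp only [Finset.smul_sum]
    rw [Finset.sum_comm]
    refine Finset.sum_congr rfl fun w hw => ?_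
    have hw' := (mem_words.1 hw).1
    rw [Preadditive.zsmul_comp, blockBoundary, Preadditive.comp_sum, Finset.smul_sum]
    refine Finset.sum_congr rfl fun i _ => ?_
    rw [Preadditive.comp_zsmul, smul_comm]
    congr 2
    refine (X.op_comp (valid_wordVertex hn hw')
      ((valid_coface (Nat.succ_pos m) i).block hn)).trans (X.op_congr hpos fun y _ => ?_)
    have hr := Nat.mod_lt y (Nat.succ_pos m)
    have h1 := (valid_coface (Nat.succ_pos m) i).lt _ hr
    rw [Function.comp, block, wordVertex_apply w h1]
  have hR : X.boundary (m + 1) ≫ X.subdivide n m =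
      ∑ w ∈ words n m, wordSign w • ∑ x ∈ Finset.range (m + 2), (-1 : ℤ) ^ x • E' w x := by
    rw [subdivide, Preadditive.comp_sum]
    refine Finset.sum_congr rfl fun w hw => ?_
    rw [Preadditive.comp_zsmul, X.boundary_op (valid_wordVertex hn (mem_words.1 hw).1)]
  have hmid := sum_words_adjacent n m (fun i w => E (i + 1) w) (fun w x => E' w (x + 1))
    (fun u a b v => by
      refine X.op_congr hpos fun y _ => ?_
      rw [count_take_coface]
      congr 1
      simp only [List.countP_append, List.countP_cons]; omega)
    (fun u a v hw => by
      refine X.op_congr hpos fun y _ => ?_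
      rw [vertex_double, Function.comp, wordVertex])
  have hfirst : ∑ w ∈ words n (m + 1), wordSign w • E 0 w =
      ∑ v ∈ words n m, ∑ a ∈ Finset.range n, ((-1) ^ v.countP (· < a) * wordSign v) •
        X.op (m + 2) (n * (m + 1)) (fun y => wordVertex (m + 1) v y +
          if a ≤ y / (m + 1) then 1 else 0) := by
    rw [sum_words_succ, Finset.sum_comm]
    refine Finset.sum_congr rfl fun v _ => Finset.sum_congr rfl fun a _ => ?_
    rw [wordSign]
    congr 1
    refine X.op_congr hpos fun y _ => ?_
    simp only [coface, Nat.not_lt_zero, if_false, List.take_succ_cons, List.countP_cons,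
      List.count_cons, wordVertex, decide_eq_true_eq, beq_iff_eq]
    split_ifs <;> omega
  have hlast : ∑ w ∈ words n (m + 1), wordSign w • E (m + 1) w =
      ∑ v ∈ words n m, ∑ a ∈ Finset.range n, ((-1) ^ v.countP (a < ·) * wordSign v) •
        X.op (m + 2) (n * (m + 1)) (fun y => wordVertex (m + 1) v y +
          if a < y / (m + 1) then 1 else 0) := by
    rw [sum_words_add]
    refine Finset.sum_congr rfl fun v hv => ?_
    rw [sum_words_succ]
    refine Finset.sum_congr rfl fun a _ => ?_
    rw [sum_words_zero, wordSign_append_singleton]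
    congr 1
    refine X.op_congr hpos fun y _ => ?_
    have hr : y % (m + 1) < m + 1 := Nat.mod_lt y (Nat.succ_pos m)
    simp only [coface, hr, if_true, List.countP_append, wordVertex, List.countP_cons,
      List.countP_nil, decide_eq_true_eq]
    rw [List.take_append_of_le_length (by rw [(mem_words.1 hv).1]; omega)]
    omega
  rw [hL, hR, Finset.sum_range_succ, Finset.sum_range_succ', hmid, hfirst, hlast, Finset.smul_sum,
    Finset.smul_sum, ← Finset.sum_add_distrib, ← Finset.sum_add_distrib]
  refine Finset.sum_congr rfl fun v hv => ?_
  obtain ⟨hv1, hv2⟩ := mem_words.1 hv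
  obtain ⟨l, rfl⟩ : ∃ l, n = l + 1 := ⟨n - 1, by omega⟩
  have h0 : ((-1 : ℤ) ^ v.countP (· < 0) * wordSign v) • X.op (m + 2) ((l + 1) * (m + 1))
      (fun y => wordVertex (m + 1) v y + if 0 ≤ y / (m + 1) then 1 else 0) =
      wordSign v • E' v 0 := by
    have : v.countP (· < 0) = 0 := by rw [List.countP_eq_zero]; simp
    rw [this, pow_zero, one_mul]
    rfl
  have h1 : ((-1 : ℤ) ^ v.countP (l < ·) * wordSign v) • X.op (m + 2) ((l + 1) * (m + 1))
      (fun y => wordVertex (m + 1) v y + if l < y / (m + 1) then 1 else 0) =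
      wordSign v • E' v (m + 1) := by
    have : v.countP (l < ·) = 0 := by
      rw [List.countP_eq_zero]; intro a ha; have := hv2 a ha; simp; omega
    rw [this, pow_zero, one_mul]
    congr 1
    refine X.op_congr hpos fun y hy => ?_
    have h2 := (valid_wordVertex (n := l + 1) hn hv1).lt y hy
    have h3 : y / (m + 1) < l + 1 := Nat.div_lt_of_lt_mul (by rwa [Nat.mul_comm])
    rw [if_neg (by omega), Function.comp, coface, if_pos h2]; rfl
  -- The signs are opposite because the letters of `v` above `a` and those below `a + 1` are
  -- together all `m` letters.
  have h2 : (-1 : ℤ) ^ (m + 1) • ∑ a ∈ Finset.range l, ((-1 : ℤ) ^ v.countP (a < ·) * wordSign v) •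
        X.op (m + 2) ((l + 1) * (m + 1)) (fun y => wordVertex (m + 1) v y +
          if a < y / (m + 1) then 1 else 0) =
      - ∑ a ∈ Finset.range l, ((-1 : ℤ) ^ v.countP (· < a + 1) * wordSign v) •
        X.op (m + 2) ((l + 1) * (m + 1)) (fun y => wordVertex (m + 1) v y +
          if a + 1 ≤ y / (m + 1) then 1 else 0) := by
    rw [Finset.smul_sum, ← Finset.sum_neg_distrib]
    refine Finset.sum_congr rfl fun a _ => ?_
    rw [smul_smul, ← neg_smul]
    congr 1
    have h3 : v.countP (a < ·) + v.countP (· < a + 1) = m := by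
      have := List.length_eq_countP_add_countP (fun b => decide (b < a + 1)) (l := v)
      have h4 : v.countP (a < ·) = v.countP (fun b => ¬ decide (b < a + 1)) := by
        congr 1; funext b; simp
      omega
    have h5 : (-1 : ℤ) ^ v.countP (a < ·) * (-1) ^ v.countP (a < ·) = 1 := by
      rw [← pow_add, Even.neg_one_pow ⟨_, rfl⟩]
    rw [← h3, pow_succ, pow_add]
    linear_combination (-(-1 : ℤ) ^ v.countP (· < a + 1) * wordSign v) * h5
  rw [Finset.sum_range_succ' (fun a => ((-1 : ℤ) ^ v.countP (· < a) * wordSign v) • _),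
    Finset.sum_range_succ (fun a => ((-1 : ℤ) ^ v.countP (a < ·) * wordSign v) • _), smul_add,
    smul_add, h2, h0, h1, Finset.sum_range_succ (fun x => (-1 : ℤ) ^ x • E' v x),
    Finset.sum_range_succ' (fun x => (-1 : ℤ) ^ x • E' v x), smul_add, smul_add,
    smul_comm ((-1 : ℤ) ^ (m + 1))]
  simp only [pow_zero, one_smul]
  abel

end SimplicialOps

/-! ### Decompositions of words -/

section decompositions

variable {M : Type*} [AddCommGroup M]

/-- The places of the letter `s` in a word, marked by `0` among the letters `1`. -/
def mark (s : ℕ) : List ℕ → List ℕ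
  | [] => []
  | a :: w => (if a = s then 0 else 1) :: mark s w

/-- The word of the letters other than `s`, renumbered. -/
def omitLetter (s : ℕ) : List ℕ → List ℕ
  | [] => []
  | a :: w => if a = s then omitLetter s w else (if a < s then a else a - 1) :: omitLetter s w

theorem sum_range_coface {s n : ℕ} (hs : s ≤ n) (f : ℕ → M) :
    ∑ a ∈ Finset.range (n + 1), f a = f s + ∑ b ∈ Finset.range n, f (coface s b) := by
  obtain ⟨t, rfl⟩ := Nat.exists_eq_add_of_le hs
  rw [show s + t + 1 = s + 1 + t by ring, Finset.sum_range_add, Finset.sum_range_succ,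
    Finset.sum_range_add (fun b => f (coface s b))]
  have h1 : ∀ x ∈ Finset.range s, f (coface s x) = f x := fun x hx => by
    rw [coface, if_pos (Finset.mem_range.1 hx)]
  have h2 : ∀ x ∈ Finset.range t, f (coface s (s + x)) = f (s + 1 + x) := fun x _ => by
    rw [coface, if_neg (by omega)]; congr 1; ring
  rw [Finset.sum_congr rfl h1, Finset.sum_congr rfl h2]
  abel

/-- A word amounts to the places of the letter `s` together with the word of the remaining letters,
and all such pairs occur. -/
theorem sum_words_mark {s n : ℕ} (hs : s ≤ n) (m : ℕ) (G : List ℕ → List ℕ → M) :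
    ∑ w ∈ words (n + 1) m, G (mark s w) (omitLetter s w) =
      ∑ κ ∈ words 2 m, ∑ τ ∈ words n (κ.count 1), G κ τ := by
  induction m generalizing G with
  | zero => simp [sum_words_zero, mark, omitLetter]
  | succ m ih =>
    rw [sum_words_succ, sum_words_succ, sum_range_coface hs, Finset.sum_range_succ,
      Finset.sum_range_one]
    congr 1
    · simpa [mark, omitLetter] using ih fun κ τ => G (0 :: κ) τ
    · have h : ∀ κ : List ℕ, (1 :: κ).count 1 = κ.count 1 + 1 := fun κ => by simp
      simp only [h, sum_words_succ]
      rw [Finset.sum_comm (s := words 2 m)]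
      refine Finset.sum_congr rfl fun b _ => ?_
      have h1 : coface s b ≠ s := by unfold coface; split_ifs <;> omega
      have h2 : (if coface s b < s then coface s b else coface s b - 1) = b := by
        unfold coface; split_ifs <;> omega
      simp only [mark, omitLetter, if_neg h1, h2]
      exact ih fun κ τ => G (1 :: κ) (b :: τ)

theorem count_mark (s : ℕ) (w : List ℕ) : (mark s w).count 0 = w.count s := by
  induction w with
  | nil => rfl
  | cons a w ih => by_cases h : a = s <;> simp [mark, ih, h]

theorem take_mark (s r : ℕ) (w : List ℕ) : (mark s w).take r = mark s (w.take r) := by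
  induction w generalizing r with
  | nil => simp [mark]
  | cons a w ih => cases r with
    | zero => simp [mark]
    | succ r => simp [mark, ih]

theorem countP_omitLetter (s a : ℕ) (w : List ℕ) :
    w.countP (· < a) = (omitLetter s w).countP (· < if a ≤ s then a else a - 1) +
      if s < a then (mark s w).count 0 else 0 := by
  induction w with
  | nil => simp [omitLetter, mark]
  | cons b w ih =>
    rw [List.countP_cons, ih]
    by_cases h : b = s
    · subst h
      simp only [omitLetter, mark, if_true, List.count_cons_self, decide_eq_true_eq]
      split_ifs <;> omega
    · simp only [omitLetter, mark, if_neg h, List.countP_cons, List.count_cons, decide_eq_true_eq]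
      simp
      split_ifs <;> omega

/-- The inversions among the letters other than `s` are those of the reduced word. For every pair of
an `s` and another letter, the sign of the marks records whether the `s` comes second. For a larger
letter this is an inversion; for a smaller one it is the absence of one, and correcting all these
pairs costs the first factor. -/
theorem wordSign_mark (s : ℕ) (w : List ℕ) :
    wordSign w = (-1) ^ ((omitLetter s w).countP (· < s) * (mark s w).count 0) *
      wordSign (mark s w) * wordSign (omitLetter s w) := by
  induction w with
  | nil => simp [wordSign, mark, omitLetter]
  | cons a w ih =>
    have h1 : (mark s w).countP (· < 1) = (mark s w).count 0 := by
      rw [List.count]; congr 1; funext x; simp [beq_eq_decide]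
    rw [wordSign, ih, countP_omitLetter s a w]
    rcases lt_trichotomy a s with h | rfl | h
    · simp only [omitLetter, mark, if_neg h.ne, h, if_pos h.le, if_neg h.not_gt, add_zero,
        wordSign, h1, List.countP_cons, decide_true, if_true, List.count_cons]
      have h5 : (-1 : ℤ) ^ (mark s w).count 0 * (-1) ^ (mark s w).count 0 = 1 := by
        rw [← pow_add, Even.neg_one_pow ⟨_, rfl⟩]
      simp only [add_mul, one_mul, pow_add, beq_iff_eq, one_ne_zero, if_false, add_zero]
      linear_combination (-(-1 : ℤ) ^ (omitLetter s w).countP (· < a) *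
        (-1) ^ ((omitLetter s w).countP (· < s) * (mark s w).count 0) *
        wordSign (mark s w) * wordSign (omitLetter s w)) * h5
    · simp [omitLetter, mark, wordSign]
      ring
    · simp only [omitLetter, mark, if_neg h.ne', if_neg h.not_gt, if_neg h.not_ge, if_pos h,
        wordSign, h1, List.countP_cons, List.count_cons]
      rw [if_neg (by simp; omega)]
      simp [pow_add]
      ring

/-- The words with a given number of small letters, counted with signs. -/
theorem sum_words_countP (s t p r : ℕ) :
    (∑ w ∈ words (s + t) r, if w.countP (· < s) = p then wordSign w else 0) =
      signedPatterns p r * (signedWords p s * signedWords (r - p) t) := by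
  induction r using Nat.strong_induction_on generalizing p with
  | _ r ih =>
    match r with
    | 0 =>
      rw [signedPatterns_eq, sum_words_zero]
      rcases p with _ | p <;> simp [wordSign, signedY, signedWords_zero]
    | 1 =>
      rw [signedPatterns_eq, sum_words_succ]
      simp only [sum_words_zero, Finset.sum_range_add]
      have h1 : ∀ x ∈ Finset.range s, (if List.countP (· < s) [x] = p then wordSign [x] else 0) =
          if p = 1 then 1 else 0 := by
        intro x hx
        simp [Finset.mem_range.1 hx, wordSign, eq_comm]
      have h2 : ∀ x ∈ Finset.range t, (if List.countP (· < s) [s + x] = p then wordSign [s + x] else 0) =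
          if p = 0 then 1 else 0 := by
        intro x hx
        simp [wordSign, eq_comm]
      rw [Finset.sum_congr rfl h1, Finset.sum_congr rfl h2]
      match p with
      | 0 => simp [signedY, signedWords_zero, signedWords_one]
      | 1 => simp [signedY, signedWords_zero, signedWords_one]
      | p + 2 => simp
    | r + 2 =>
      -- The number of small letters does not depend on the order of the first two letters, so only
      -- words that begin with a double letter survive. That letter is small or large, which
      -- reproduces the recursion of `signedPatterns`.
      have := sum_words_swap (s + t) 0 r (fun w => if w.countP (· < s) = p then (1 : ℤ) else 0) (by
        intro u a b v _
        simp only [List.countP_append, List.countP_cons]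
        rw [Nat.add_right_comm (List.countP _ v)])
      simp only [zero_add, smul_eq_mul, mul_ite, mul_one, mul_zero, sum_words_zero,
        List.nil_append, wordSign_double_head] at this
      rw [this, Finset.sum_range_add]
      have h1 : ∀ x ∈ Finset.range s,
          (∑ v ∈ words (s + t) r, if List.countP (· < s) (x :: x :: v) = p then wordSign v else 0) =
          if 2 ≤ p then signedPatterns (p - 2) r *
            (signedWords (p - 2) s * signedWords (r - (p - 2)) t) else 0 := by
        intro x hx
        rw [← ih r (by omega)]
        split_ifs with h
        · refine Finset.sum_congr rfl fun w _ => if_congr ?_ rfl rfl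
          simp [Finset.mem_range.1 hx]; omega
        · refine Finset.sum_eq_zero fun w _ => if_neg ?_
          simp [Finset.mem_range.1 hx]; omega
      have h2 : ∀ x ∈ Finset.range t,
          (∑ v ∈ words (s + t) r, if List.countP (· < s) ((s + x) :: (s + x) :: v) = p
            then wordSign v else 0) =
          signedPatterns p r * (signedWords p s * signedWords (r - p) t) := by
        intro x hx
        rw [← ih r (by omega)]
        refine Finset.sum_congr rfl fun w _ => if_congr ?_ rfl rfl
        simp
      rw [Finset.sum_congr rfl h1, Finset.sum_congr rfl h2, signedPatterns_add_two, add_mul]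
      simp only [Finset.sum_const, Finset.card_range, nsmul_eq_mul]
      congr 1
      · split_ifs with h
        · obtain ⟨p, rfl⟩ := Nat.exists_eq_add_of_le' h
          rw [signedWords_add_two, Nat.add_sub_cancel, Nat.add_sub_add_right]
          ring
        · simp
      · by_cases h : p ≤ r
        · rw [show r + 2 - p = r - p + 2 by omega, signedWords_add_two]
          ring
        · rw [signedPatterns_eq, if_neg h]; simp

end decompositions

theorem count_one_words {κ : List ℕ} {M : ℕ} (h : κ ∈ words 2 M) : κ.count 1 = M - κ.count 0 := by
  rw [mem_words] at h
  obtain ⟨rfl, h⟩ := h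
  have h1 := length_eq_countP κ 0
  have h2 : κ.countP (0 < ·) = κ.count 1 := by
    rw [List.count]
    refine List.countP_congr fun x hx => ?_
    have := h x hx
    simp; omega
  simp only [Nat.not_lt_zero] at h1
  have h3 : κ.countP (fun _ => decide False) = 0 := by rw [List.countP_eq_zero]; simp
  omega

namespace SimplicialOps

variable {C : Type u} [Category.{v} C] [Preadditive C] (X : SimplicialOps C)

/-! ### Shuffles with degenerate simplices -/

/-- The sum, over the shuffles of `l` steps with `M - l` constant ones, of the simplices with
`M + 1` vertices that are obtained from the path `θ 0, …, θ l`. -/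
def shuffle (N M l : ℕ) (θ : ℕ → ℕ) : X.V N ⟶ X.V (M + 1) :=
  ∑ κ ∈ words 2 M, wordSign κ •
    if κ.count 0 = l then X.op N (M + 1) fun y => θ ((κ.take y).count 0) else 0

variable {X} in
theorem shuffle_congr {N M l : ℕ} {θ θ' : ℕ → ℕ} (h : ∀ c ≤ l, θ c = θ' c) :
    X.shuffle N M l θ = X.shuffle N M l θ' := by
  refine Finset.sum_congr rfl fun κ _ => ?_
  congr 1
  split_ifs with hl
  · refine X.op_congr (Nat.succ_pos M) fun y _ => h _ ?_
    rw [← hl]; exact (List.take_sublist y κ).count_le 0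
  · rfl

theorem valid_path {N M l : ℕ} {θ : ℕ → ℕ} (hθ : Valid N (l + 1) θ) {κ : List ℕ}
    (hκ : κ.count 0 = l) : Valid N (M + 1) fun y => θ ((κ.take y).count 0) where
  pos := Nat.succ_pos M
  lt y _ := hθ.lt _ (by have := (List.take_sublist y κ).count_le 0; omega)
  mono y z hyz _ := hθ.mono _ _ ((List.take_sublist_take_left hyz).count_le 0)
    (by have := (List.take_sublist z κ).count_le 0; omega)

/-- Without constant steps the only shuffle is the path itself. -/
theorem shuffle_full (M : ℕ) : X.shuffle (M + 1) M M id = 𝟙 (X.V (M + 1)) := by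
  rw [shuffle, Finset.sum_eq_single (List.replicate M 0)]
  · have h : wordSign (List.replicate M 0) = 1 := by
      induction M with
      | zero => rfl
      | succ M ih => simp [List.replicate_succ, wordSign, ih, List.countP_replicate]
    rw [h, one_smul, if_pos (by simp), ← X.op_id (Nat.succ_pos M)]
    refine X.op_congr (Nat.succ_pos M) fun y hy => ?_
    simp; omega
  · intro κ hκ hne
    rw [if_neg, smul_zero]
    intro h
    refine hne ?_
    have h1 := (mem_words.1 hκ).1
    rw [List.eq_replicate_iff]
    refine ⟨h1, fun b hb => ?_⟩
    exact ((List.count_eq_length.1 (h.trans h1.symm)) b hb).symm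
  · intro h
    exact absurd (mem_words.2 ⟨by simp, fun a ha => by simp [List.mem_replicate] at ha; omega⟩) h

theorem boundary_shuffle {N M l : ℕ} {θ : ℕ → ℕ} (hθ : Valid N (l + 1) θ) :
    X.boundary N ≫ X.shuffle N M l θ =
      ∑ x ∈ Finset.range (N + 1), (-1 : ℤ) ^ x • X.shuffle (N + 1) M l (coface x ∘ θ) := by
  have : ∀ κ ∈ words 2 M, X.boundary N ≫ (wordSign κ •
      if κ.count 0 = l then X.op N (M + 1) fun y => θ ((κ.take y).count 0) else 0) =
      ∑ x ∈ Finset.range (N + 1), (-1 : ℤ) ^ x • (wordSign κ • if κ.count 0 = l then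
        X.op (N + 1) (M + 1) fun y => (coface x ∘ θ) ((κ.take y).count 0) else 0) := by
    intro κ _
    split_ifs with h
    · rw [Preadditive.comp_zsmul, X.boundary_op (valid_path hθ h), Finset.smul_sum]
      refine Finset.sum_congr rfl fun x _ => ?_
      rw [smul_comm]; rfl
    · simp
  rw [shuffle, Preadditive.comp_sum, Finset.sum_congr rfl this, Finset.sum_comm]
  refine Finset.sum_congr rfl fun x _ => ?_
  rw [shuffle, Finset.smul_sum]

/-- A Leibniz rule for the shuffle product with a constant simplex. Faces between a step and a
constant step cancel in pairs, and faces between two steps give the faces of the path. As the number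
`M + 1 - l` of constant steps is even, the alternating sum of the equal faces of the constant
simplex leaves one shuffle with one constant step fewer. -/
theorem shuffle_boundary {N M l : ℕ} {θ : ℕ → ℕ} (hθ : Valid N (l + 1) θ)
    (hl : Even (M + 1 + l)) :
    X.shuffle N (M + 1) l θ ≫ X.boundary (M + 1) =
      (if 0 < l then ∑ x ∈ Finset.range (l + 1),
        (-1 : ℤ) ^ x • X.shuffle N M (l - 1) (θ ∘ coface x) else 0) +
      (-1 : ℤ) ^ l • X.shuffle N M l θ := by
  set E : ℕ → List ℕ → (X.V N ⟶ X.V (M + 1)) := fun i κ => if κ.count 0 = l then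
    X.op N (M + 1) fun y => θ ((κ.take (coface i y)).count 0) else 0 with hE
  -- In sorted order the letters `0` come first. So a rank below `κ.count 0` belongs to a doubled
  -- step, which skips a vertex of the path, and a larger rank to a doubled constant step.
  set E' : List ℕ → ℕ → (X.V N ⟶ X.V (M + 1)) := fun κ x =>
    if x < κ.count 0 then (if κ.count 0 + 1 = l then
      X.op N (M + 1) fun y => θ (coface (x + 1) ((κ.take y).count 0)) else 0)
    else (if κ.count 0 = l then X.op N (M + 1) fun y => θ ((κ.take y).count 0) else 0) with hE'
  have hL : X.shuffle N (M + 1) l θ ≫ X.boundary (M + 1) =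
      ∑ i ∈ Finset.range (M + 2), (-1 : ℤ) ^ i • ∑ κ ∈ words 2 (M + 1), wordSign κ • E i κ := by
    rw [shuffle, Preadditive.sum_comp]
    simp only [Finset.smul_sum]
    rw [Finset.sum_comm]
    refine Finset.sum_congr rfl fun κ hκ => ?_
    simp only [hE]
    split_ifs with h
    · rw [Preadditive.zsmul_comp, X.op_boundary (valid_path hθ h) (Nat.succ_pos M),
        Finset.smul_sum]
      refine Finset.sum_congr rfl fun i _ => ?_
      rw [smul_comm]; rfl
    · simp
  have hmid := sum_words_adjacent 2 M (fun i κ => E (i + 1) κ) E'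
    (fun u a b v => by
      simp only [hE, count_take_coface]
      refine if_congr ?_ rfl rfl
      simp only [List.count_append, List.count_cons]
      rw [Nat.add_right_comm (List.count 0 v)])
    (fun u a v hw => by
      have ha : a < 2 := (mem_words.1 hw).2 a (by simp)
      have h1 : (u ++ a :: a :: v).count 0 = (u ++ a :: v).count 0 + if a = 0 then 1 else 0 := by
        simp [List.count_append, List.count_cons]; ring
      have h2 := fun r => vertex_double u v a 0 r
      have h3 : ∀ w : List ℕ, w.countP (· < 0) = 0 := fun w => by
        rw [List.countP_eq_zero]; simp
      simp only [h3, zero_add] at h2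
      have h4 : (u ++ a :: v).countP (· < a) + u.count a < (u ++ a :: v).count 0 ↔ a = 0 := by
        rcases Nat.eq_zero_or_pos a with rfl | ha'
        · rw [h3]; simp
        · have := countP_lt_add_count_le (u ++ a :: v) ha'
          omega
      simp only [hE, hE', h1, h2, h4]
      by_cases h : a = 0
      · simp only [h, if_true]
      · simp only [h, if_false, add_zero]
        split_ifs with h5
        · refine X.op_congr (Nat.succ_pos M) fun y _ => ?_
          rw [coface, if_pos]
          have := countP_lt_add_count_le (u ++ a :: v) (Nat.pos_of_ne_zero h)
          have := (List.take_sublist y (u ++ a :: v)).count_le 0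
          omega
        · rfl)
  have h3 : ∀ w : List ℕ, w.countP (· < 0) = 0 := fun w => by
    rw [List.countP_eq_zero]; simp
  have hfirst : ∑ κ ∈ words 2 (M + 1), wordSign κ • E 0 κ =
      (if 0 < l then X.shuffle N M (l - 1) (θ ∘ coface 0) else 0) +
        (-1 : ℤ) ^ l • X.shuffle N M l θ := by
    rw [sum_words_succ, Finset.sum_range_succ, Finset.sum_range_one]
    congr 1
    · rcases l with _ | l
      · simp [hE]
      · rw [if_pos (Nat.succ_pos l), Nat.add_sub_cancel]
        refine Finset.sum_congr rfl fun κ _ => ?_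
        rw [wordSign, h3, pow_zero, one_mul]
        simp only [hE, Nat.not_lt_zero, List.count_cons_self, Nat.add_right_cancel_iff,
          coface, if_false, List.take_succ_cons, Function.comp]
    · rw [shuffle, Finset.smul_sum]
      refine Finset.sum_congr rfl fun κ _ => ?_
      have h1 : κ.countP (· < 1) = κ.count 0 := by
        rw [List.count]; congr 1; funext x; simp [beq_eq_decide]
      have h2 : ∀ w : List ℕ, (1 :: w).count 0 = w.count 0 := fun w => by simp
      simp only [hE, wordSign, coface, Nat.not_lt_zero, if_false, List.take_succ_cons, h1, h2]
      split_ifs with h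
      · rw [h, mul_smul]
      · simp
  have hlast : (-1 : ℤ) ^ (M + 1) • ∑ κ ∈ words 2 (M + 1), wordSign κ • E (M + 1) κ =
      (if 0 < l then (-1 : ℤ) ^ l • X.shuffle N M (l - 1) (θ ∘ coface l) else 0) +
        (-1 : ℤ) ^ (M + 1) • X.shuffle N M l θ := by
    have hE1 : ∀ κ ∈ words 2 M, ∀ a, E (M + 1) (κ ++ [a]) =
        if κ.count 0 + (if a = 0 then 1 else 0) = l then
          X.op N (M + 1) fun y => θ ((κ.take y).count 0) else 0 := by
      intro κ hκ a
      simp only [hE]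
      refine if_ctx_congr ?_ (fun _ => X.op_congr (Nat.succ_pos M) fun y hy => ?_) (fun _ => rfl)
      · simp [List.count_cons]
      · rw [coface, if_pos hy, List.take_append_of_le_length]
        rw [(mem_words.1 hκ).1]; omega
    have h2 : ∀ κ : List ℕ, κ.countP (1 < ·) = 0 ∨ ∃ a ∈ κ, 1 < a := by
      intro κ
      by_cases h : ∃ a ∈ κ, 1 < a
      · exact Or.inr h
      · left; rw [List.countP_eq_zero]; push Not at h; simpa using h
    rw [sum_words_add]
    simp only [sum_words_succ, sum_words_zero, Finset.sum_range_succ, Finset.sum_range_zero,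
      zero_add]
    rw [Finset.sum_add_distrib, smul_add]
    congr 1
    · rcases l with _ | l
      · rw [Finset.sum_eq_zero fun κ hκ => ?_]
        · simp
        · rw [hE1 κ hκ]; simp
      · rw [if_pos (Nat.succ_pos l), Nat.add_sub_cancel, shuffle, Finset.smul_sum, Finset.smul_sum]
        refine Finset.sum_congr rfl fun κ hκ => ?_
        have h1 := length_eq_countP κ 0
        rw [h3, zero_add, (mem_words.1 hκ).1] at h1
        rw [hE1 κ hκ, wordSign_append_singleton]
        simp only [if_true, Nat.add_right_cancel_iff]
        split_ifs with h
        · rw [smul_smul, smul_smul, ← mul_assoc, ← pow_add]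
          have h4 : X.op N (M + 1) (fun y => (θ ∘ coface (l + 1)) ((κ.take y).count 0)) =
              X.op N (M + 1) fun y => θ ((κ.take y).count 0) := by
            refine X.op_congr (Nat.succ_pos M) fun y _ => ?_
            have := (List.take_sublist y κ).count_le 0
            rw [Function.comp, coface, if_pos (by omega)]
          rw [h4]
          congr 2
          apply neg_one_pow_congr
          rw [h1, h]
          simp only [Nat.even_add, Nat.even_add_one]
          tauto
        · simp
    · rw [shuffle]
      congr 1
      refine Finset.sum_congr rfl fun κ hκ => ?_
      rw [hE1 κ hκ, wordSign_append_singleton]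
      rcases h2 κ with h | ⟨a, ha, h⟩
      · simp [h]
      · exact absurd ((mem_words.1 hκ).2 a ha) (by omega)
  have hmiddle : ∑ κ ∈ words 2 M, wordSign κ • ∑ x ∈ Finset.range M, (-1 : ℤ) ^ (x + 1) • E' κ x =
      (if 0 < l then ∑ x ∈ Finset.range (l - 1), (-1 : ℤ) ^ (x + 1) •
        X.shuffle N M (l - 1) (θ ∘ coface (x + 1)) else 0) + (-1 : ℤ) ^ (l + 1) •
          X.shuffle N M l θ := by
    have h5 : (if 0 < l then ∑ x ∈ Finset.range (l - 1), (-1 : ℤ) ^ (x + 1) •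
        X.shuffle N M (l - 1) (θ ∘ coface (x + 1)) else 0) =
        ∑ κ ∈ words 2 M, wordSign κ • if κ.count 0 + 1 = l then
          ∑ x ∈ Finset.range (κ.count 0), (-1 : ℤ) ^ (x + 1) •
            X.op N (M + 1) (fun y => θ (coface (x + 1) ((κ.take y).count 0))) else 0 := by
      rcases l with _ | l
      · simp
      · simp only [Nat.succ_pos, if_true, Nat.add_sub_cancel, shuffle, Finset.smul_sum,
          Nat.add_right_cancel_iff]
        rw [Finset.sum_comm]
        refine Finset.sum_congr rfl fun κ _ => ?_
        split_ifs with h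
        · rw [h, Finset.smul_sum]
          exact Finset.sum_congr rfl fun x _ => smul_comm _ _ _
        · simp
    rw [h5, shuffle, Finset.smul_sum, ← Finset.sum_add_distrib]
    refine Finset.sum_congr rfl fun κ hκ => ?_
    rw [smul_comm ((-1 : ℤ) ^ (l + 1)), ← smul_add]
    congr 1
    have h6 : κ.count 0 ≤ M := by
      rw [← (mem_words.1 hκ).1]; exact List.count_le_length
    obtain ⟨d, hd⟩ := Nat.exists_eq_add_of_le h6
    rw [show Finset.range M = Finset.range (κ.count 0 + d) by rw [← hd], Finset.sum_range_add]
    congr 1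
    · have h7 : ∀ x ∈ Finset.range (κ.count 0), (-1 : ℤ) ^ (x + 1) • E' κ x =
          if κ.count 0 + 1 = l then (-1 : ℤ) ^ (x + 1) • X.op N (M + 1)
            (fun y => θ (coface (x + 1) ((κ.take y).count 0))) else 0 := by
        intro x hx
        simp only [hE', if_pos (Finset.mem_range.1 hx), smul_ite, smul_zero]
      rw [Finset.sum_congr rfl h7]
      split_ifs <;> simp
    · have h7 : ∀ x ∈ Finset.range d, (-1 : ℤ) ^ (κ.count 0 + x + 1) • E' κ (κ.count 0 + x) =
          (-1 : ℤ) ^ x • (-1 : ℤ) ^ (κ.count 0 + 1) • if κ.count 0 = l then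
            X.op N (M + 1) fun y => θ ((κ.take y).count 0) else 0 := by
        intro x _
        simp only [hE', if_neg (show ¬ κ.count 0 + x < κ.count 0 by omega)]
        rw [smul_smul, ← pow_add]
        congr 2; ring
      -- Here `d` is the number of letters `1`. If the other letters are `l` in number, it is odd by
      -- `hl`, so one of the alternating equal terms remains.
      rw [Finset.sum_congr rfl h7, ← Finset.sum_smul, neg_one_geom_sum]
      split_ifs with h8 h9 h9
      · exfalso
        rw [hd, h9] at hl
        simp only [Nat.even_add, Nat.even_add_one] at hl
        tauto
      · simp
      · rw [one_smul, h9]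
      · simp
  rw [hL, Finset.sum_range_succ, Finset.sum_range_succ', hmid, hlast, hmiddle, pow_zero, one_smul,
    hfirst]
  -- The remainders of the inner faces and of the last face cancel; the one of the first face stays.
  have hs : (-1 : ℤ) ^ (l + 1) • X.shuffle N M l θ + (-1 : ℤ) ^ (M + 1) • X.shuffle N M l θ = 0 := by
    rw [← add_smul, pow_succ, neg_one_pow_congr (m := M + 1) (n := l)]
    · simp
    · simpa [Nat.even_add] using hl
  rcases l with _ | l
  · simp only [lt_irrefl, if_false] at hs ⊢
    rw [eq_neg_of_add_eq_zero_left hs]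
    abel
  · simp only [Nat.succ_pos, if_true, Nat.add_sub_cancel] at hs ⊢
    rw [Finset.sum_range_succ, Finset.sum_range_succ']
    rw [pow_zero, one_smul]
    rw [eq_neg_of_add_eq_zero_left hs]
    abel

end SimplicialOps

/-! ### The coefficients of the homotopy. -/

/-- The coefficient `T^{p+1,q}_{m+1,n}`, multiplied by `n`. -/
def shuffleCoeff (n m p q : ℕ) : ℤ :=
  (-1) ^ (p * (m - p - q)) * signedY p q *
    ∑ s ∈ Finset.range n, signedWords p s * signedWords q (n - 1 - s)

theorem shuffleCoeff_zero (n m : ℕ) : shuffleCoeff n m 0 0 = n := by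
  simp [shuffleCoeff, signedY, signedWords_zero]

theorem shuffleCoeff_succ (n m p q : ℕ) (h : p + q ≤ m) :
    shuffleCoeff n (m + 1) p q = (-1) ^ p * shuffleCoeff n m p q := by
  rw [shuffleCoeff, shuffleCoeff, show m + 1 - p - q = m - p - q + 1 by omega, mul_add, mul_one,
    pow_add]
  ring

theorem shuffleCoeff_odd_odd (n m : ℕ) {p q : ℕ} (hp : ¬ Even p) (hq : ¬ Even q) :
    shuffleCoeff n m p q = 0 := by
  simp [shuffleCoeff, signedY, hp, hq]

theorem sum_signedWords_odd_left (n a q : ℕ) :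
    ∑ s ∈ Finset.range n, signedWords (2 * a + 1) s * signedWords q (n - 1 - s) =
      ∑ s ∈ Finset.range n, signedWords (2 * a + 2) s * signedWords q (n - 1 - s) := by
  simp only [signedWords_odd]

/-- Pascal's rule for the coefficients. -/
theorem shuffleCoeff_even (n m a b : ℕ) (hm : 2 * a + 2 * b ≤ m) (hab : 0 < a + b) :
    shuffleCoeff n m (2 * a) (2 * b) =
      (if 0 < a then (-1) ^ (m + 1) * shuffleCoeff n m (2 * a - 1) (2 * b) else 0) +
      (if 0 < b then shuffleCoeff n m (2 * a) (2 * b - 1) else 0) := by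
  have hpow : ∀ c d : ℕ, (-1 : ℤ) ^ (2 * c * d) = 1 := fun c d =>
    Even.neg_one_pow ⟨c * d, by ring⟩
  have hY : ∀ c d : ℕ, signedY (2 * c) (2 * d) = ((c + d).choose c : ℤ) := by
    intro c d
    rw [signedY, if_pos (Or.inl (even_two_mul c)), show (2 * c + 2 * d) / 2 = c + d by omega,
      show 2 * c / 2 = c by omega]
  have hY1 : ∀ c d : ℕ, signedY (2 * c + 1) (2 * d) = ((c + d).choose c : ℤ) := by
    intro c d
    rw [signedY, if_pos (Or.inr (even_two_mul d)), show (2 * c + 1 + 2 * d) / 2 = c + d by omega,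
      show (2 * c + 1) / 2 = c by omega]
  have hY2 : ∀ c d : ℕ, signedY (2 * c) (2 * d + 1) = ((c + d).choose c : ℤ) := by
    intro c d
    rw [signedY, if_pos (Or.inl (even_two_mul c)), show (2 * c + (2 * d + 1)) / 2 = c + d by omega,
      show 2 * c / 2 = c by omega]
  -- The sign in the recursion cancels the sign of the coefficient with odd first index, since the
  -- total exponent is even. The sums of the numbers `N` on both sides agree by `signedWords_odd`,
  -- and the factors `Y` obey Pascal's rule.
  have hodd : ∀ c d : ℕ, 2 * c + 2 + 2 * d ≤ m → (-1 : ℤ) ^ (m + 1) *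
      (-1) ^ ((2 * c + 1) * (m - (2 * c + 1) - 2 * d)) = 1 := by
    intro c d h
    rw [← pow_add]
    refine Even.neg_one_pow ⟨m - c - d + c * (m - (2 * c + 1) - 2 * d), ?_⟩
    obtain ⟨e, rfl⟩ := Nat.exists_eq_add_of_le h
    rw [show 2 * c + 2 + 2 * d + e - (2 * c + 1) - 2 * d = 1 + e by omega,
      show 2 * c + 2 + 2 * d + e - c - d = c + 2 + d + e by omega]
    ring
  rcases a with _ | a <;> rcases b with _ | b
  · simp at hab
  · have := hY2 0 b
    have := hY 0 (b + 1)
    simp only [mul_zero] at *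
    simp only [shuffleCoeff, mul_add, mul_one, show 2 * b + 2 - 1 = 2 * b + 1 by omega] at *
    simp_all [signedWords_odd]
  · have h1 := hY1 a 0
    have h2 := hY (a + 1) 0
    have h3 := hodd a 0 (by omega)
    simp only [mul_zero, Nat.sub_zero, add_zero] at *
    simp only [shuffleCoeff, mul_add, mul_one, show 2 * a + 2 - 1 = 2 * a + 1 by omega] at *
    rw [h1, h2, sum_signedWords_odd_left]
    simp only [Nat.choose_self, Nat.cast_one, mul_one, Nat.succ_pos, if_true, lt_irrefl, if_false,
      add_zero, ← mul_assoc, Nat.sub_zero]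
    rw [h3, show 2 * a + 2 = 2 * (a + 1) by ring, hpow]
  · have h1 := hY1 a (b + 1)
    have h2 := hY (a + 1) (b + 1)
    have h3 := hodd a (b + 1) (by omega)
    have h4 := hY2 (a + 1) b
    simp only [shuffleCoeff, Nat.succ_pos, if_true, hpow,
      show 2 * (a + 1) - 1 = 2 * a + 1 by omega, show 2 * (b + 1) - 1 = 2 * b + 1 by omega, h1, h2,
      h4, sum_signedWords_odd_left]
    rw [show 2 * a + 2 = 2 * (a + 1) by ring, ← mul_assoc, ← mul_assoc, h3, one_mul, one_mul,
      one_mul, show a + 1 + (b + 1) = a + (b + 1) + 1 by ring, Nat.choose_succ_succ]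
    simp only [signedWords_odd, show 2 * b + 2 = 2 * (b + 1) by ring]
    rw [show a + 1 + b = a + (b + 1) by ring]
    push_cast
    ring

theorem sum_pairs_extend {M : Type*} [AddCommMonoid M] {N K : ℕ} (hK : N ≤ K) (f : ℕ → ℕ → M)
    (hf : ∀ p q, N ≤ p + q → f p q = 0) :
    ∑ p ∈ Finset.range K, ∑ q ∈ Finset.range K, f p q =
      ∑ p ∈ Finset.range N, ∑ q ∈ Finset.range N, f p q := by
  have hsub : Finset.range N ⊆ Finset.range K := Finset.range_subset_range.2 hK
  rw [← Finset.sum_subset hsub]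
  · refine Finset.sum_congr rfl fun p _ => (Finset.sum_subset hsub fun q _ hq => hf _ _ ?_).symm
    simp at hq; omega
  · intro p _ hp
    refine Finset.sum_eq_zero fun q _ => hf _ _ ?_
    simp at hp; omega

theorem sum_shift {M : Type*} [AddCommMonoid M] (K : ℕ) (h : ℕ → M) (h0 : h 0 = 0) (hK : h K = 0) :
    ∑ p ∈ Finset.range K, h (p + 1) = ∑ p ∈ Finset.range K, h p := by
  have h1 := Finset.sum_range_succ h K
  have h2 := Finset.sum_range_succ' h K
  rw [hK, add_zero] at h1
  rw [h0, add_zero] at h2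
  rw [← h1, h2]

namespace SimplicialOps

variable {C : Type u} [Category.{v} C] [Preadditive C] (X : SimplicialOps C)

/-! ### The columns of the subdivision -/

/-- The projection of the subdivision to the simplices of the column `s`. -/
def column (n N s : ℕ) : X.V (n * N) ⟶ X.V N := X.op (n * N) N (inBlock N s)

theorem blockBoundary_column {n N s : ℕ} (hN : 0 < N) (hs : s < n) :
    X.blockBoundary n N ≫ X.column n N s = X.column n (N + 1) s ≫ X.boundary N := by
  rw [column, column, X.op_boundary (valid_inBlock (Nat.succ_pos N) hs) hN, blockBoundary,
    Preadditive.sum_comp]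
  refine Finset.sum_congr rfl fun i _ => ?_
  rw [Preadditive.zsmul_comp, X.op_comp ((valid_coface hN i).block (Nat.zero_lt_of_lt hs))
    (valid_inBlock hN hs)]
  congr 1
  exact X.op_congr hN fun r hr => block_inBlock _ hr s

/-- In the column `s` of the piece of a word, a vertex is the number of letters below `s` plus the
number of letters `s` read so far. So the simplex depends only on the pattern `κ` of the places of
`s` and on the number `p` of smaller letters: it is a path starting at `p`, shuffled with constant
steps. Summing the signs over the words with given `κ` and `p`, which leaves `q` larger letters,
produces the coefficient by `sum_words_countP`. -/
theorem subdivide_column (n m : ℕ) {s : ℕ} (hs : s ≤ n) :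
    X.subdivide (n + 1) m ≫ X.column (n + 1) (m + 1) s =
      ∑ p ∈ Finset.range (m + 1), ∑ q ∈ Finset.range (m + 1), if p + q ≤ m then
        ((-1) ^ (p * (m - p - q)) * signedY p q * (signedWords p s * signedWords q (n - s))) •
          X.shuffle (m + 1) m (m - p - q) (p + ·) else 0 := by
  have h1 : X.subdivide (n + 1) m ≫ X.column (n + 1) (m + 1) s =
      ∑ w ∈ words (n + 1) m, (fun κ τ : List ℕ =>
        ((-1) ^ (τ.countP (· < s) * κ.count 0) * wordSign κ * wordSign τ) •
          X.op (m + 1) (m + 1) fun y => τ.countP (· < s) + (κ.take y).count 0)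
        (mark s w) (omitLetter s w) := by
    rw [subdivide, Preadditive.sum_comp]
    refine Finset.sum_congr rfl fun w hw => ?_
    simp only
    rw [← wordSign_mark, Preadditive.zsmul_comp, column, X.op_comp
      (valid_wordVertex (Nat.succ_pos n) (mem_words.1 hw).1)
      (valid_inBlock (Nat.succ_pos m) (Nat.lt_succ_of_le hs))]
    congr 1
    refine X.op_congr (Nat.succ_pos m) fun y hy => ?_
    rw [Function.comp, inBlock, wordVertex_apply w hy, take_mark, count_mark,
      countP_omitLetter s s w]
    simp
  rw [h1]
  refine (sum_words_mark hs m (fun κ τ : List ℕ =>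
    ((-1 : ℤ) ^ (τ.countP (· < s) * κ.count 0) * wordSign κ * wordSign τ) •
      X.op (m + 1) (m + 1) fun y => τ.countP (· < s) + (κ.take y).count 0)).trans ?_
  -- For given `κ` and `p` only `q = κ.count 1 - p` can contribute.
  have h2 : ∀ κ ∈ words 2 m, ∀ p, (∑ q ∈ Finset.range (m + 1), if p + q ≤ m then
        ((-1) ^ (p * (m - p - q)) * signedY p q * (signedWords p s * signedWords q (n - s))) •
          wordSign κ • (if κ.count 0 = m - p - q then
            X.op (m + 1) (m + 1) fun y => p + (κ.take y).count 0 else 0) else 0) =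
      ((-1) ^ (p * κ.count 0) * wordSign κ * (signedPatterns p (κ.count 1) *
        (signedWords p s * signedWords (κ.count 1 - p) (n - s)))) •
          X.op (m + 1) (m + 1) fun y => p + (κ.take y).count 0 := by
    intro κ hκ p
    have h3 := count_one_words hκ
    have h4 : κ.count 0 ≤ m := by
      rw [← (mem_words.1 hκ).1]; exact List.count_le_length
    rw [signedPatterns_eq]
    split_ifs with h5
    · rw [Finset.sum_eq_single (κ.count 1 - p)]
      · rw [if_pos (by omega), if_pos (by omega), smul_smul,
          show m - p - (κ.count 1 - p) = κ.count 0 by omega]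
        congr 1; ring
      · intro q _ hq
        split_ifs <;> first | omega | simp
      · intro h; simp at h; omega
    · rw [zero_mul, mul_zero, zero_smul]
      refine Finset.sum_eq_zero fun q _ => ?_
      split_ifs <;> first | omega | simp
  have h3 : ∀ κ ∈ words 2 m, ∑ τ ∈ words n (κ.count 1),
      ((-1 : ℤ) ^ (τ.countP (· < s) * κ.count 0) * wordSign κ * wordSign τ) •
          (X.op (m + 1) (m + 1) fun y => τ.countP (· < s) + (κ.take y).count 0) =
      ∑ p ∈ Finset.range (m + 1), ((-1) ^ (p * κ.count 0) * wordSign κ *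
        (signedPatterns p (κ.count 1) *
        (signedWords p s * signedWords (κ.count 1 - p) (n - s)))) •
          X.op (m + 1) (m + 1) fun y => p + (κ.take y).count 0 := by
    intro κ hκ
    have h4 : ∀ p, signedPatterns p (κ.count 1) *
        (signedWords p s * signedWords (κ.count 1 - p) (n - s)) =
        ∑ τ ∈ words n (κ.count 1), if τ.countP (· < s) = p then wordSign τ else 0 := by
      intro p
      rw [← sum_words_countP, Nat.add_sub_cancel' hs]
    simp only [h4, Finset.mul_sum, Finset.sum_smul]
    rw [Finset.sum_comm]
    refine Finset.sum_congr rfl fun τ hτ => ?_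
    rw [Finset.sum_eq_single (τ.countP (· < s))]
    · simp
    · intro p _ hp
      rw [if_neg (Ne.symm hp)]; simp
    · intro h
      have h5 : τ.countP (· < s) ≤ τ.length := List.countP_le_length
      have h6 := (mem_words.1 hτ).1
      have h7 := count_one_words hκ
      simp at h; omega
  rw [Finset.sum_congr rfl h3, Finset.sum_comm]
  refine Finset.sum_congr rfl fun p _ => ?_
  rw [← Finset.sum_congr rfl fun κ hκ => h2 κ hκ p, Finset.sum_comm]
  refine Finset.sum_congr rfl fun q _ => ?_
  split_ifs
  · rw [shuffle, Finset.smul_sum]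
  · simp

theorem sum_subdivide_column {n : ℕ} (hn : 0 < n) (m : ℕ) :
    ∑ s ∈ Finset.range n, X.subdivide n m ≫ X.column n (m + 1) s =
      ∑ p ∈ Finset.range (m + 1), ∑ q ∈ Finset.range (m + 1), if p + q ≤ m then
        shuffleCoeff n m p q • X.shuffle (m + 1) m (m - p - q) (p + ·) else 0 := by
  obtain ⟨n, rfl⟩ : ∃ n', n = n' + 1 := ⟨n - 1, by omega⟩
  rw [Finset.sum_congr rfl fun s hs =>
    X.subdivide_column n m (Nat.lt_succ_iff.1 (Finset.mem_range.1 hs)), Finset.sum_comm]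
  refine Finset.sum_congr rfl fun p _ => ?_
  rw [Finset.sum_comm]
  refine Finset.sum_congr rfl fun q _ => ?_
  split_ifs
  · rw [← Finset.sum_smul, shuffleCoeff, Finset.mul_sum]; simp
  · simp

/-! ### The homotopy for the sum of the columns -/

/-- The homotopy between the sum of the columns of the subdivision and `n` times the identity. -/
def psi (n N : ℕ) : X.V N ⟶ X.V (N + 1) :=
  (-1 : ℤ) ^ N • ∑ p ∈ Finset.range N, ∑ q ∈ Finset.range N, if p + q < N ∧ Odd (p + q) then
    shuffleCoeff n (N - 1) p q • X.shuffle N N (N - 1 - p - q) (p + ·) else 0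

/-- These are the faces of the ambient simplex as seen by a path that starts at `p`. The `p` faces
in front of it shift the path by one, the `l + 2` faces in the middle are those of the path, and the
`q` faces behind it leave it unchanged. An alternating sum of equal terms survives only if their
number is odd. -/
theorem sum_coface_add (p q l m : ℕ) (hm : m + 1 = p + (l + 2) + q) :
    (-1 : ℤ) ^ p • ∑ x ∈ Finset.range (m + 1),
        (-1 : ℤ) ^ x • X.shuffle (m + 1) m l (coface x ∘ (p + ·)) =
      ∑ x ∈ Finset.range (l + 2), (-1 : ℤ) ^ x • X.shuffle (m + 1) m l ((p + ·) ∘ coface x) -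
        (if Even p then 0 else X.shuffle (m + 1) m l (p + 1 + ·)) +
        (-1 : ℤ) ^ l • (if Even q then 0 else X.shuffle (m + 1) m l (p + ·)) := by
  have hsq : ∀ a : ℕ, (-1 : ℤ) ^ a * (-1) ^ a = 1 := fun a => by
    rw [← pow_add, Even.neg_one_pow ⟨_, rfl⟩]
  have h1 : ∀ x ∈ Finset.range p, (-1 : ℤ) ^ x • X.shuffle (m + 1) m l (coface x ∘ (p + ·)) =
      (-1 : ℤ) ^ x • X.shuffle (m + 1) m l (p + 1 + ·) := by
    intro x hx
    have := Finset.mem_range.1 hx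
    congr 1
    refine shuffle_congr fun c _ => ?_
    rw [Function.comp, coface, if_neg (by omega)]; ring
  have h2 : ∀ x ∈ Finset.range (l + 2),
      (-1 : ℤ) ^ p • (-1 : ℤ) ^ (p + x) • X.shuffle (m + 1) m l (coface (p + x) ∘ (p + ·)) =
      (-1 : ℤ) ^ x • X.shuffle (m + 1) m l ((p + ·) ∘ coface x) := by
    intro x _
    rw [smul_smul, pow_add, ← mul_assoc, hsq, one_mul]
    congr 1
    refine shuffle_congr fun c _ => ?_
    simp only [Function.comp, coface]
    split_ifs <;> omega
  have h3 : ∀ x ∈ Finset.range q, (-1 : ℤ) ^ p • (-1 : ℤ) ^ (p + (l + 2) + x) •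
      X.shuffle (m + 1) m l (coface (p + (l + 2) + x) ∘ (p + ·)) =
      (-1 : ℤ) ^ x • (-1 : ℤ) ^ l • X.shuffle (m + 1) m l (p + ·) := by
    intro x _
    rw [smul_smul, smul_smul]
    have h4 : (-1 : ℤ) ^ p * (-1) ^ (p + (l + 2) + x) = (-1) ^ x * (-1) ^ l := by
      linear_combination ((-1 : ℤ) ^ (l + x)) * hsq p
    rw [h4]
    congr 1
    refine shuffle_congr fun c hc => ?_
    rw [Function.comp, coface, if_pos (by omega)]
  rw [show Finset.range (m + 1) = Finset.range (p + (l + 2) + q) by rw [hm],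
    Finset.sum_range_add, Finset.sum_range_add, smul_add, smul_add,
    Finset.sum_congr rfl h1, Finset.smul_sum (s := Finset.range (l + 2)),
    Finset.sum_congr rfl h2, Finset.smul_sum (s := Finset.range q), Finset.sum_congr rfl h3,
    ← Finset.sum_smul, ← Finset.sum_smul, neg_one_geom_sum, neg_one_geom_sum]
  by_cases hp : Even p <;> by_cases hq : Even q
  · simp [hp, hq]
  · simp [hp, hq]
  · simp [hp, hq, (Nat.not_even_iff_odd.1 hp).neg_one_pow]; abel
  · simp [hp, hq, (Nat.not_even_iff_odd.1 hp).neg_one_pow]; abel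

theorem valid_add {p l N : ℕ} (h : p + l < N) : Valid N (l + 1) (p + ·) where
  pos := Nat.succ_pos l
  lt x hx := by omega
  mono x y hxy _ := by omega

/-- In what `(p, q)` contributes to the homotopy relation the faces of the path cancel between the
two summands. There remain the shuffle with the same `(p, q)`, from the constant simplex, and one
neighbour: `(p, q + 1)` if `q` is odd and `(p + 1, q)` if `p` is odd. -/
theorem psi_term (n m p q : ℕ) (hpq : p + q ≤ m) (hodd : Odd (p + q)) :
    ((-1 : ℤ) ^ (m + 1) • shuffleCoeff n m p q •
        (X.shuffle (m + 1) (m + 1) (m - p - q) (p + ·) ≫ X.boundary (m + 1))) +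
      (if p + q < m then (-1 : ℤ) ^ m • shuffleCoeff n (m - 1) p q •
        ∑ x ∈ Finset.range (m + 1), (-1 : ℤ) ^ x •
          X.shuffle (m + 1) m (m - 1 - p - q) (coface x ∘ (p + ·)) else 0) =
      shuffleCoeff n m p q • (X.shuffle (m + 1) m (m - p - q) (p + ·) +
        if p + q < m then (if Even p then X.shuffle (m + 1) m (m - p - (q + 1)) (p + ·) else
          (-1 : ℤ) ^ (m + 1) • X.shuffle (m + 1) m (m - (p + 1) - q) (p + 1 + ·)) else 0) := by
  rw [X.shuffle_boundary (valid_add (by omega)) (by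
    rw [show m + 1 + (m - p - q) = 2 * (m - p - q) + (p + q + 1) by omega]
    exact (even_two_mul _).add hodd.add_one)]
  by_cases h : p + q < m
  · obtain ⟨l, rfl⟩ := Nat.exists_eq_add_of_lt h
    have hc : shuffleCoeff n (p + q + l + 1 - 1) p q =
        (-1) ^ p * shuffleCoeff n (p + q + l + 1) p q := by
      rw [Nat.add_sub_cancel, shuffleCoeff_succ _ _ _ _ (by omega), ← mul_assoc, ← pow_add,
        Even.neg_one_pow ⟨_, rfl⟩, one_mul]
    have hs : (-1 : ℤ) ^ (p + q + l + 1) = (-1) ^ l := by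
      rw [show p + q + l + 1 = (p + q + 1) + l by ring, pow_add, hodd.add_one.neg_one_pow, one_mul]
    rw [if_pos h, if_pos h, hc, mul_comm ((-1 : ℤ) ^ p), mul_smul,
      show p + q + l + 1 - p - q = l + 1 by omega,
      show p + q + l + 1 - 1 - p - q = l by omega,
      X.sum_coface_add p q l (p + q + l + 1) (by omega), show p + q + l + 1 - p - (q + 1) = l by omega,
      show p + q + l + 1 - (p + 1) - q = l by omega, if_pos (Nat.succ_pos l), Nat.add_sub_cancel,
      pow_succ (-1 : ℤ) (p + q + l + 1), hs, smul_comm _ (shuffleCoeff _ _ _ _),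
      smul_comm _ (shuffleCoeff _ _ _ _), ← smul_add]
    congr 1
    generalize ∑ x ∈ Finset.range (l + 2), (-1 : ℤ) ^ x •
      X.shuffle (p + q + l + 1 + 1) (p + q + l + 1) l ((p + ·) ∘ coface x) = S
    rw [pow_succ (-1 : ℤ) l]
    by_cases hp : Even p
    · have hq : ¬ Even q := by
        intro hq; exact (Nat.not_even_iff_odd.2 hodd) (hp.add hq)
      simp only [hp, hq, if_true, if_false]
      rcases neg_one_pow_eq_or ℤ l with he | he <;> rw [he] <;> simp <;> abel
    · have hq : Even q := by
        by_contra hq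
        exact (Nat.not_even_iff_odd.2 hodd)
          ((Nat.not_even_iff_odd.1 hp).add_odd (Nat.not_even_iff_odd.1 hq))
      simp only [hp, hq, if_true, if_false, smul_zero]
      rcases neg_one_pow_eq_or ℤ l with he | he <;> rw [he] <;> simp <;> abel
  · obtain rfl : m = p + q := by omega
    rw [if_neg (by omega), if_neg h, if_neg h, show p + q - p - q = 0 by omega,
      hodd.add_one.neg_one_pow]
    simp

/-- By `psi_term` a pair with odd sum contributes to itself and to a neighbouring pair of even
numbers. A pair of even numbers other than `(0, 0)` thus receives its coefficient from its lower
neighbours, by Pascal's rule, and a pair of odd numbers has coefficient zero. Only `(0, 0)` receives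
nothing; its shuffle is the identity, with coefficient `n`. -/
theorem psi_boundary {n : ℕ} (hn : 0 < n) (m : ℕ) :
    X.psi n (m + 1) ≫ X.boundary (m + 1) + X.boundary m ≫ X.psi n m =
      ∑ s ∈ Finset.range n, X.subdivide n m ≫ X.column n (m + 1) s -
        (n : ℤ) • 𝟙 (X.V (m + 1)) := by
  set B : ℕ → ℕ → (X.V (m + 1) ⟶ X.V (m + 1)) := fun p q =>
    X.shuffle (m + 1) m (m - p - q) (p + ·) with hB
  -- Extension by zero, so that indices can be shifted without attention to the border.
  set Q : ℕ → ℕ → (X.V (m + 1) ⟶ X.V (m + 1)) := fun p q => if p + q ≤ m then B p q else 0 with hQ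
  -- The contributions that a pair `(p, q)` of even numbers receives from `(p - 1, q)`, in `h1`, and
  -- from `(p, q - 1)`, in `h2`.
  set h1 : ℕ → ℕ → (X.V (m + 1) ⟶ X.V (m + 1)) := fun p q => if Even p ∧ Even q ∧ 0 < p then
    (shuffleCoeff n m (p - 1) q) • (-1 : ℤ) ^ (m + 1) • Q p q else 0 with hh1
  set h2 : ℕ → ℕ → (X.V (m + 1) ⟶ X.V (m + 1)) := fun p q => if Even p ∧ Even q ∧ 0 < q then
    (shuffleCoeff n m p (q - 1)) • Q p q else 0 with hh2
  have e1 : X.psi n (m + 1) ≫ X.boundary (m + 1) =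
      ∑ p ∈ Finset.range (m + 1), ∑ q ∈ Finset.range (m + 1), if p + q ≤ m ∧ Odd (p + q) then
        (-1 : ℤ) ^ (m + 1) • shuffleCoeff n m p q •
        (X.shuffle (m + 1) (m + 1) (m - p - q) (p + ·) ≫ X.boundary (m + 1)) else 0 := by
    simp only [psi, Preadditive.zsmul_comp, Preadditive.sum_comp, Finset.smul_sum,
      Nat.lt_succ_iff, Nat.add_sub_cancel]
    refine Finset.sum_congr rfl fun p _ => Finset.sum_congr rfl fun q _ => ?_
    split_ifs <;> simp
  have e2 : X.boundary m ≫ X.psi n m =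
      ∑ p ∈ Finset.range (m + 1), ∑ q ∈ Finset.range (m + 1), if p + q < m ∧ Odd (p + q) then
        (-1 : ℤ) ^ m • shuffleCoeff n (m - 1) p q •
        ∑ x ∈ Finset.range (m + 1), (-1 : ℤ) ^ x •
          X.shuffle (m + 1) m (m - 1 - p - q) (coface x ∘ (p + ·)) else 0 := by
    rw [sum_pairs_extend (Nat.le_succ m) _ fun p q h => if_neg (by omega)]
    simp only [psi, Preadditive.comp_zsmul, Preadditive.comp_sum, Finset.smul_sum]
    refine Finset.sum_congr rfl fun p _ => Finset.sum_congr rfl fun q _ => ?_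
    split_ifs with h
    · rw [Preadditive.comp_zsmul, X.boundary_shuffle (valid_add (by omega))]
      simp only [Finset.smul_sum]
    · simp
  have e3 : ∀ p q, (if p + q ≤ m ∧ Odd (p + q) then
        (-1 : ℤ) ^ (m + 1) • shuffleCoeff n m p q •
        (X.shuffle (m + 1) (m + 1) (m - p - q) (p + ·) ≫ X.boundary (m + 1)) else 0) +
      (if p + q < m ∧ Odd (p + q) then
        (-1 : ℤ) ^ m • shuffleCoeff n (m - 1) p q •
        ∑ x ∈ Finset.range (m + 1), (-1 : ℤ) ^ x •
          X.shuffle (m + 1) m (m - 1 - p - q) (coface x ∘ (p + ·)) else 0) =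
      (if Odd (p + q) then shuffleCoeff n m p q • Q p q else 0) + h1 (p + 1) q + h2 p (q + 1) := by
    intro p q
    by_cases hodd : Odd (p + q)
    · by_cases hle : p + q ≤ m
      · have := X.psi_term n m p q hle hodd
        simp only [hle, hodd, and_true, if_true]
        rw [this, smul_add, add_assoc]
        simp only [hQ, hB, if_pos hle]
        congr 1
        have ha : p + 1 + q ≤ m ↔ p + q < m := by omega
        have hb : p + (q + 1) ≤ m ↔ p + q < m := by omega
        by_cases hp : Even p
        · have hq : ¬ Even q := by
            intro hq; exact (Nat.not_even_iff_odd.2 hodd) (hp.add hq)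
          simp only [hh1, hh2, hQ, hB, hp, hq, Nat.even_add_one, ha, hb]
          simp
        · have hq : Even q := by
            by_contra hq
            exact (Nat.not_even_iff_odd.2 hodd)
              ((Nat.not_even_iff_odd.1 hp).add_odd (Nat.not_even_iff_odd.1 hq))
          simp only [hh1, hh2, hQ, hB, hp, hq, Nat.even_add_one, ha, hb]
          simp
      · rw [if_neg (by omega), if_neg (by omega)]
        simp only [hh1, hh2, hQ, if_neg hle, if_neg (show ¬ p + 1 + q ≤ m by omega),
          if_neg (show ¬ p + (q + 1) ≤ m by omega)]
        simp
    · have ha : ¬ (Even (p + 1) ∧ Even q ∧ 0 < p + 1) := by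
        rintro ⟨h, h', -⟩
        rw [← Nat.not_even_iff_odd] at hodd
        simp only [Nat.even_add, Nat.even_add_one] at *; tauto
      have hb : ¬ (Even p ∧ Even (q + 1) ∧ 0 < q + 1) := by
        rintro ⟨h, h', -⟩
        rw [← Nat.not_even_iff_odd] at hodd
        simp only [Nat.even_add, Nat.even_add_one] at *; tauto
      simp only [hh1, hh2, if_neg ha, if_neg hb, hodd, and_false, if_false, add_zero]
  have e4 : ∀ p q, (if Odd (p + q) then shuffleCoeff n m p q • Q p q else 0) + h1 p q + h2 p q =
      (if p + q ≤ m then shuffleCoeff n m p q • B p q else 0) -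
        (if p = 0 then if q = 0 then (n : ℤ) • 𝟙 (X.V (m + 1)) else 0 else 0) := by
    intro p q
    by_cases hle : p + q ≤ m
    · simp only [hQ, hh1, hh2, if_pos hle]
      by_cases hp : Even p <;> by_cases hq : Even q
      · rw [if_neg (Nat.not_odd_iff_even.2 (hp.add hq)), zero_add]
        simp only [hp, hq, true_and]
        obtain ⟨a, rfl⟩ := hp.two_dvd
        obtain ⟨b, rfl⟩ := hq.two_dvd
        by_cases hab : 0 < a + b
        · rw [shuffleCoeff_even n m a b hle hab, add_smul]
          have h3 : (if 2 * a = 0 then if 2 * b = 0 then (n : ℤ) • 𝟙 (X.V (m + 1)) else 0 else 0)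
              = 0 := by
            split_ifs
            · omega
            · rfl
            · rfl
          rw [h3, sub_zero]
          congr 1
          · by_cases h : 0 < a
            · rw [if_pos (by omega), if_pos h, smul_smul, mul_comm]
            · rw [if_neg (by omega), if_neg h, zero_smul]
          · by_cases h : 0 < b
            · rw [if_pos (by omega), if_pos h]
            · rw [if_neg (by omega), if_neg h, zero_smul]
        · obtain ⟨rfl, rfl⟩ : a = 0 ∧ b = 0 := by omega
          have h4 : B 0 0 = 𝟙 (X.V (m + 1)) := by
            rw [← X.shuffle_full]
            exact shuffle_congr fun c _ => by simp
          simp [shuffleCoeff_zero, h4]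
      · have : q ≠ 0 := by rintro rfl; simp at hq
        rw [if_pos (by rw [← Nat.not_even_iff_odd]; simp [Nat.even_add, hp, hq])]
        simp [hp, hq, this]
      · have : p ≠ 0 := by rintro rfl; simp at hp
        rw [if_pos (by rw [← Nat.not_even_iff_odd]; simp [Nat.even_add, hp, hq])]
        simp [hp, hq, this]
      · have : p ≠ 0 := by rintro rfl; simp at hp
        rw [if_neg (by rw [Nat.not_odd_iff_even]; simp [Nat.even_add, hp, hq])]
        simp [hp, hq, this, shuffleCoeff_odd_odd]
    · simp only [hQ, hh1, hh2, if_neg hle]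
      have : (if p = 0 then if q = 0 then (n : ℤ) • 𝟙 (X.V (m + 1)) else 0 else 0) = 0 := by
        split_ifs
        · omega
        · rfl
        · rfl
      rw [this]; simp
  have e5 : ∑ p ∈ Finset.range (m + 1), ∑ q ∈ Finset.range (m + 1), h1 (p + 1) q =
      ∑ p ∈ Finset.range (m + 1), ∑ q ∈ Finset.range (m + 1), h1 p q := by
    refine sum_shift (m + 1) (fun p => ∑ q ∈ Finset.range (m + 1), h1 p q) ?_ ?_
    · exact Finset.sum_eq_zero fun q _ => by simp [hh1]
    · refine Finset.sum_eq_zero fun q _ => ?_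
      simp only [hh1, hQ, if_neg (show ¬ m + 1 + q ≤ m by omega), smul_zero, ite_self]
  have e6 : ∑ p ∈ Finset.range (m + 1), ∑ q ∈ Finset.range (m + 1), h2 p (q + 1) =
      ∑ p ∈ Finset.range (m + 1), ∑ q ∈ Finset.range (m + 1), h2 p q := by
    refine Finset.sum_congr rfl fun p _ => sum_shift (m + 1) (h2 p) ?_ ?_
    · simp [hh2]
    · simp only [hh2, hQ, if_neg (show ¬ p + (m + 1) ≤ m by omega), smul_zero, ite_self]
  have e7 : ∑ p ∈ Finset.range (m + 1), ∑ q ∈ Finset.range (m + 1),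
      (if p = 0 then if q = 0 then (n : ℤ) • 𝟙 (X.V (m + 1)) else 0 else 0) =
        (n : ℤ) • 𝟙 (X.V (m + 1)) := by
    rw [Finset.sum_eq_single 0]
    · simp
    · intro p _ hp; simp [hp]
    · simp
  rw [e1, e2, ← Finset.sum_add_distrib, X.sum_subdivide_column hn, ← e7, ← Finset.sum_sub_distrib]
  simp only [← Finset.sum_add_distrib, ← Finset.sum_sub_distrib, e3]
  refine Eq.trans ?_ (Finset.sum_congr rfl fun p _ => Finset.sum_congr rfl fun q _ => e4 p q)
  simp only [Finset.sum_add_distrib, e5, e6]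

end SimplicialOps

/-- The bookkeeping of a simplicial prism whose cells are numbered by `a`. The faces `i < a` and `i
> a + 1` of the cells are cells over the faces and cancel; the faces `a` and `a + 1` are shared by
consecutive cells and telescope. -/
theorem sum_prism {M : Type*} [AddCommGroup M] (m : ℕ) (T U : ℕ → ℕ → M) (P : ℕ → M)
    (h1 : ∀ a i, a ≤ m → i < a → T a i = U i (a - 1))
    (h2 : ∀ a i, a + 1 < i → i ≤ m + 1 → T a i = U (i - 1) a)
    (h3 : ∀ a, a ≤ m → T a a = P a) (h4 : ∀ a, a ≤ m → T a (a + 1) = P (a + 1)) :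
    ∑ a ∈ Finset.range (m + 1), ∑ i ∈ Finset.range (m + 2), (-1 : ℤ) ^ (a + i) • T a i +
      ∑ i ∈ Finset.range (m + 1), ∑ a ∈ Finset.range m, (-1 : ℤ) ^ (i + a) • U i a =
        P 0 - P (m + 1) := by
  have e1 : ∀ a ∈ Finset.range (m + 1),
      ∑ i ∈ Finset.range (m + 2), (-1 : ℤ) ^ (a + i) • T a i = (P a - P (a + 1)) +
        (∑ i ∈ Finset.range m, (if i < a then (-1 : ℤ) ^ (a + i) • U i (a - 1) else 0) +
          ∑ i ∈ Finset.range m, if a ≤ i then (-1 : ℤ) ^ (a + i) • U (i + 1) a else 0) := by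
    intro a ha
    have ha : a ≤ m := Nat.lt_succ_iff.1 (Finset.mem_range.1 ha)
    rw [sum_range_coface (by omega : a ≤ m + 1), sum_range_coface ha, ← Finset.sum_add_distrib,
      h3 a ha, coface, if_neg (lt_irrefl a), h4 a ha, Even.neg_one_pow ⟨a, rfl⟩, ← add_assoc a a 1,
      pow_succ, Even.neg_one_pow ⟨a, rfl⟩, ← add_assoc]
    congr 1
    · simp [sub_eq_add_neg]
    · refine Finset.sum_congr rfl fun i hi => ?_
      have hi := Finset.mem_range.1 hi
      by_cases hia : i < a
      · simp only [coface, hia, if_true, if_neg hia.not_ge, add_zero]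
        rw [h1 a i ha hia]
      · simp only [coface, hia, if_false, if_neg (show ¬ i + 1 < a by omega),
          if_pos (not_lt.1 hia), zero_add]
        rw [h2 a (i + 1 + 1) (by omega) (by omega), ← add_assoc, ← add_assoc, pow_succ, pow_succ]
        simp
  rw [Finset.sum_congr rfl e1, Finset.sum_add_distrib, Finset.sum_range_sub', add_assoc,
    Finset.sum_add_distrib]
  have e2 : ∑ a ∈ Finset.range (m + 1), ∑ i ∈ Finset.range m,
      (if i < a then (-1 : ℤ) ^ (a + i) • U i (a - 1) else 0) =
      - ∑ i ∈ Finset.range (m + 1), ∑ a ∈ Finset.range m,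
        if i ≤ a then (-1 : ℤ) ^ (i + a) • U i a else 0 := by
    rw [Finset.sum_range_succ', Finset.sum_comm, Finset.sum_range_succ _ m, neg_add,
      ← Finset.sum_neg_distrib]
    congr 1
    · refine Finset.sum_congr rfl fun i _ => ?_
      rw [← Finset.sum_neg_distrib]
      refine Finset.sum_congr rfl fun a _ => ?_
      rw [Nat.add_sub_cancel, show a + 1 + i = i + a + 1 by ring, pow_succ]
      by_cases h : i ≤ a
      · rw [if_pos (by omega), if_pos h]; simp
      · rw [if_neg (by omega), if_neg h]; simp
    · rw [Finset.sum_eq_zero fun i _ => by simp, Finset.sum_eq_zero fun a ha => ?_, neg_zero]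
      have := Finset.mem_range.1 ha
      rw [if_neg (by omega)]
  have e3 : ∑ a ∈ Finset.range (m + 1), ∑ i ∈ Finset.range m,
      (if a ≤ i then (-1 : ℤ) ^ (a + i) • U (i + 1) a else 0) =
      - ∑ i ∈ Finset.range (m + 1), ∑ a ∈ Finset.range m,
        if i ≤ a then 0 else (-1 : ℤ) ^ (i + a) • U i a := by
    rw [Finset.sum_range_succ, Finset.sum_comm, Finset.sum_range_succ' _ m, neg_add,
      ← Finset.sum_neg_distrib]
    congr 1
    · refine Finset.sum_congr rfl fun i _ => ?_
      rw [← Finset.sum_neg_distrib]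
      refine Finset.sum_congr rfl fun a _ => ?_
      rw [show i + 1 + a = a + i + 1 by ring, pow_succ]
      by_cases h : a ≤ i
      · rw [if_pos h, if_neg (by omega)]; simp
      · rw [if_neg h, if_pos (by omega)]; simp
    · rw [Finset.sum_eq_zero fun i hi => ?_, Finset.sum_eq_zero fun a _ => by simp, neg_zero]
      have := Finset.mem_range.1 hi
      rw [if_neg (by omega)]
  have e4 : ∑ i ∈ Finset.range (m + 1), ∑ a ∈ Finset.range m, (-1 : ℤ) ^ (i + a) • U i a =
      ∑ i ∈ Finset.range (m + 1), ∑ a ∈ Finset.range m,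
        (if i ≤ a then (-1 : ℤ) ^ (i + a) • U i a else 0) +
      ∑ i ∈ Finset.range (m + 1), ∑ a ∈ Finset.range m,
        if i ≤ a then 0 else (-1 : ℤ) ^ (i + a) • U i a := by
    simp only [← Finset.sum_add_distrib]
    refine Finset.sum_congr rfl fun i _ => Finset.sum_congr rfl fun a _ => ?_
    split_ifs <;> simp
  rw [e2, e3, e4]
  abel

/-! ### Moving the columns of a subdivision -/

/-- Two choices `b`, `b'` of a block for each of the `n` columns, such that the columns can be moved
from the blocks `b` to the blocks `b'` without crossing. -/
structure Interleaved (n B : ℕ) (b b' : ℕ → ℕ) : Prop where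
  le : ∀ j < n, b j ≤ b' j
  lt : ∀ j j', j < j' → j' < n → b' j < b j'
  bound : ∀ j < n, b' j < B

/-- The map that sends the rows `< a` of the column `j` to the block `b j`, the others to
the block `b' j`. -/
def splitMap (N a : ℕ) (b b' : ℕ → ℕ) (y : ℕ) : ℕ :=
  y % N + N * if y % N < a then b (y / N) else b' (y / N)

/-- The side of a prism from the blocks `b` to the blocks `b'`, where the row `a` is doubled. -/
def prismMap (N a : ℕ) (b b' : ℕ → ℕ) (y : ℕ) : ℕ :=
  if y % (N + 1) ≤ a then y % (N + 1) + N * b (y / (N + 1))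
  else y % (N + 1) - 1 + N * b' (y / (N + 1))

theorem prismMap_apply (N a : ℕ) (b b' : ℕ → ℕ) {r : ℕ} (hr : r < N + 1) (j : ℕ) :
    prismMap N a b b' (r + (N + 1) * j) = if r ≤ a then r + N * b j else r - 1 + N * b' j := by
  rw [prismMap, Nat.add_mul_mod_self_left, Nat.mod_eq_of_lt hr,
    Nat.add_mul_div_left _ _ (by omega), Nat.div_eq_of_lt hr, zero_add]

theorem splitMap_apply (N a : ℕ) (b b' : ℕ → ℕ) {r : ℕ} (hr : r < N) (j : ℕ) :
    splitMap N a b b' (r + N * j) = r + N * if r < a then b j else b' j := by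
  rw [splitMap, Nat.add_mul_mod_self_left, Nat.mod_eq_of_lt hr,
    Nat.add_mul_div_left _ _ (by omega), Nat.div_eq_of_lt hr, zero_add]

/-- Inside a column the map increases because `b j ≤ b' j`, and from one column to a later one
because the former ends in a block before the one where the latter begins. -/
theorem valid_prismMap {n B N a : ℕ} {b b' : ℕ → ℕ} (hn : 0 < n) (h : Interleaved n B b b')
    (ha : a < N) : Valid (B * N) (n * (N + 1)) (prismMap N a b b') where
  pos := Nat.mul_pos hn (Nat.succ_pos N)
  lt y hy := by
    obtain ⟨r, j, hr, hj, rfl⟩ := exists_eq_add_mul_of_lt hy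
    rw [prismMap_apply N a b b' hr]
    split_ifs
    · exact add_mul_lt (by omega) ((h.le j hj).trans_lt (h.bound j hj))
    · exact add_mul_lt (by omega) (h.bound j hj)
  mono y z hyz hz := by
    obtain ⟨r, j, hr, hj, rfl⟩ := exists_eq_add_mul_of_lt (hyz.trans_lt hz)
    obtain ⟨r', j', hr', hj', rfl⟩ := exists_eq_add_mul_of_lt hz
    rw [prismMap_apply N a b b' hr, prismMap_apply N a b b' hr']
    rcases lt_trichotomy j j' with hjj | rfl | hjj
    · have h1 : N * (b' j + 1) ≤ N * b j' := Nat.mul_le_mul_left _ (h.lt j j' hjj hj')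
      have h2 : N * b j ≤ N * b' j := Nat.mul_le_mul_left _ (h.le j hj)
      have h3 : N * b j' ≤ N * b' j' := Nat.mul_le_mul_left _ (h.le j' hj')
      rw [mul_add, mul_one] at h1
      split_ifs <;> omega
    · have h2 : N * b j ≤ N * b' j := Nat.mul_le_mul_left _ (h.le j hj)
      split_ifs <;> omega
    · exfalso
      have : (N + 1) * (j' + 1) ≤ (N + 1) * j := Nat.mul_le_mul_left _ hjj
      linarith

namespace SimplicialOps

variable {C : Type u} [Category.{v} C] [Preadditive C] (X : SimplicialOps C)

/-- The homotopy that moves the columns from the blocks `b` to the blocks `b'`. -/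
def prism (n L N : ℕ) (b b' : ℕ → ℕ) : X.V L ⟶ X.V (n * (N + 1)) :=
  ∑ a ∈ Finset.range N, (-1 : ℤ) ^ a • X.op L (n * (N + 1)) (prismMap N a b b')

/-- The map to the subdivision which is given by a block for each column. -/
def blocks (n L N : ℕ) (b : ℕ → ℕ) : X.V L ⟶ X.V (n * N) :=
  X.op L (n * N) fun y => y % N + N * b (y / N)

/-- This is `sum_prism` with the common faces `P a`, in which the rows below `a` are still in the
blocks `b`. So `P 0` lies entirely in the blocks `b'` and `P (m + 1)` entirely in the blocks `b`. -/
theorem prism_boundary {n B : ℕ} (m : ℕ) {b b' : ℕ → ℕ} (hn : 0 < n) (h : Interleaved n B b b') :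
    X.prism n (B * (m + 1)) (m + 1) b b' ≫ X.blockBoundary n (m + 1) +
      X.blockBoundary B m ≫ X.prism n (B * m) m b b' =
        X.blocks n (B * (m + 1)) (m + 1) b' - X.blocks n (B * (m + 1)) (m + 1) b := by
  have hB : 0 < B := (Nat.zero_le _).trans_lt (h.bound 0 hn)
  have hpos : 0 < n * (m + 1) := Nat.mul_pos hn (Nat.succ_pos m)
  set T : ℕ → ℕ → (X.V (B * (m + 1)) ⟶ X.V (n * (m + 1))) := fun a i =>
    X.op _ _ (prismMap (m + 1) a b b' ∘ block (m + 2) (m + 1) (coface i)) with hT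
  set U : ℕ → ℕ → (X.V (B * (m + 1)) ⟶ X.V (n * (m + 1))) := fun i a =>
    X.op _ _ (block (m + 1) m (coface i) ∘ prismMap m a b b') with hU
  set P : ℕ → (X.V (B * (m + 1)) ⟶ X.V (n * (m + 1))) := fun a =>
    X.op _ _ (splitMap (m + 1) a b b') with hP
  have key : ∀ a i r j, r < m + 1 → (prismMap (m + 1) a b b' ∘ block (m + 2) (m + 1) (coface i))
      (r + (m + 1) * j) = if coface i r ≤ a then coface i r + (m + 1) * b j
        else coface i r - 1 + (m + 1) * b' j := by
    intro a i r j hr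
    rw [Function.comp, block_apply _ _ hr, prismMap_apply]
    unfold coface; split_ifs <;> omega
  have key2 : ∀ a i r j, a < m → r < m + 1 → (block (m + 1) m (coface i) ∘ prismMap m a b b')
      (r + (m + 1) * j) = if r ≤ a then coface i r + (m + 1) * b j
        else coface i (r - 1) + (m + 1) * b' j := by
    intro a i r j ha hr
    rw [Function.comp, prismMap_apply _ _ _ _ hr]
    split_ifs
    · rw [block_apply _ _ (by omega)]
    · rw [block_apply _ _ (by omega)]
  have e1 : X.prism n (B * (m + 1)) (m + 1) b b' ≫ X.blockBoundary n (m + 1) =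
      ∑ a ∈ Finset.range (m + 1), ∑ i ∈ Finset.range (m + 2), (-1 : ℤ) ^ (a + i) • T a i := by
    rw [prism, Preadditive.sum_comp]
    refine Finset.sum_congr rfl fun a ha => ?_
    rw [blockBoundary, Preadditive.comp_sum]
    refine Finset.sum_congr rfl fun i _ => ?_
    rw [Preadditive.zsmul_comp, Preadditive.comp_zsmul, smul_smul, ← pow_add,
      X.op_comp (valid_prismMap hn h (Finset.mem_range.1 ha))
        ((valid_coface (Nat.succ_pos m) i).block hn)]
  have e2 : X.blockBoundary B m ≫ X.prism n (B * m) m b b' =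
      ∑ i ∈ Finset.range (m + 1), ∑ a ∈ Finset.range m, (-1 : ℤ) ^ (i + a) • U i a := by
    rw [blockBoundary, Preadditive.sum_comp]
    refine Finset.sum_congr rfl fun i _ => ?_
    rw [prism, Preadditive.comp_sum]
    refine Finset.sum_congr rfl fun a ha => ?_
    have ha := Finset.mem_range.1 ha
    rw [Preadditive.zsmul_comp, Preadditive.comp_zsmul, smul_smul, ← pow_add,
      X.op_comp ((valid_coface (by omega) i).block hB) (valid_prismMap hn h ha)]
  have e3 : X.blocks n (B * (m + 1)) (m + 1) b' = P 0 := rfl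
  have e4 : X.blocks n (B * (m + 1)) (m + 1) b = P (m + 1) := by
    refine X.op_congr hpos fun y _ => ?_
    rw [splitMap, if_pos (Nat.mod_lt y (Nat.succ_pos m))]
  rw [e1, e2, e3, e4]
  refine sum_prism m T U P ?_ ?_ ?_ ?_
  · intro a i ha hi
    refine X.op_congr hpos fun y hy => ?_
    obtain ⟨r, j, hr, hj, rfl⟩ := exists_eq_add_mul_of_lt hy
    rw [key _ _ _ _ hr, key2 _ _ _ _ (by omega) hr]
    unfold coface
    split_ifs <;> omega
  · intro a i hai hi
    refine X.op_congr hpos fun y hy => ?_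
    obtain ⟨r, j, hr, hj, rfl⟩ := exists_eq_add_mul_of_lt hy
    rw [key _ _ _ _ hr, key2 _ _ _ _ (by omega) hr]
    unfold coface
    split_ifs <;> omega
  · intro a ha
    refine X.op_congr hpos fun y hy => ?_
    obtain ⟨r, j, hr, hj, rfl⟩ := exists_eq_add_mul_of_lt hy
    rw [key _ _ _ _ hr, splitMap_apply _ _ _ _ hr]
    unfold coface
    split_ifs <;> omega
  · intro a ha
    refine X.op_congr hpos fun y hy => ?_
    obtain ⟨r, j, hr, hj, rfl⟩ := exists_eq_add_mul_of_lt hy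
    rw [key _ _ _ _ hr, splitMap_apply _ _ _ _ hr]
    unfold coface
    split_ifs <;> omega

/-- The homotopy that moves the columns, the last one first, from the first `n` blocks to the
blocks `b`. -/
def moveColumns (n L N : ℕ) (b : ℕ → ℕ) : X.V L ⟶ X.V (n * (N + 1)) :=
  ∑ k ∈ Finset.range n, X.prism n L N (fun j => if n ≤ j + k then b j else j)
    fun j => if n ≤ j + (k + 1) then b j else j

/-- After `k` moves the last `k` columns are in their final blocks. Since `b` is strictly increasing
and `j ≤ b j`, moving the last columns first never makes two columns cross, and the boundaries of
the `n` prisms telescope. -/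
theorem moveColumns_boundary {n B m L L' : ℕ} (hL : L = B * m)
    (hL' : L' = B * (m + 1)) {b : ℕ → ℕ} (hn : 0 < n)
    (hle : ∀ j < n, j ≤ b j) (hlt : ∀ j j', j < j' → j' < n → b j < b j') (hb : ∀ j < n, b j < B) :
    X.moveColumns n L' (m + 1) b ≫ X.blockBoundary n (m + 1) +
      (∑ i ∈ Finset.range (m + 1), (-1 : ℤ) ^ i • X.op L' L (block (m + 1) m (coface i))) ≫
        X.moveColumns n L m b = X.blocks n L' (m + 1) b - X.blocks n L' (m + 1) id := by
  -- The sizes enter through equations because `n * (n * m)` and `n * n * m` are different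
  -- expressions.
  subst hL hL'
  have h : ∀ k, Interleaved n B (fun j => if n ≤ j + k then b j else j)
      fun j => if n ≤ j + (k + 1) then b j else j := by
    intro k
    refine ⟨fun j hj => ?_, fun j j' hj hj' => ?_, fun j hj => ?_⟩
    · have := hle j hj
      split_ifs <;> omega
    · have h1 := hlt j j' hj hj'
      have h2 := hle j' hj'
      split_ifs <;> omega
    · have h1 := hle j hj
      have h2 := hb j hj
      split_ifs <;> omega
  change _ + X.blockBoundary B m ≫ _ = _
  rw [moveColumns, moveColumns, Preadditive.sum_comp, Preadditive.comp_sum,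
    ← Finset.sum_add_distrib, Finset.sum_congr rfl fun k _ => X.prism_boundary m hn (h k),
    Finset.sum_range_sub fun k => X.blocks n (B * (m + 1)) (m + 1) fun j => if n ≤ j + k then b j else j]
  congr 1
  · unfold blocks; simp
  · refine X.op_congr (Nat.mul_pos hn (Nat.succ_pos m)) fun y hy => ?_
    have : y / (m + 1) < n := Nat.div_lt_of_lt_mul (by rwa [Nat.mul_comm])
    simp only [add_zero, if_neg (not_le.2 this), id]

end SimplicialOps

/-! ### The twofold subdivision and the homotopy for the reverse composite. -/

namespace SimplicialOps

section

variable {C : Type u} [Category.{v} C] (X : SimplicialOps C)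

/-- The blocks of the twofold subdivision come in `n` groups of `n`. A column of the subdivision
takes the block with the same number `s` out of every group `j`. -/
theorem subdivision_column {n : ℕ} (hn : 0 < n) {N : ℕ} (hN : 0 < N) (s : ℕ) :
    (X.subdivision n hn).column n N s = X.blocks n (n * (n * N)) N fun j => s + n * j := by
  refine X.op_congr (Nat.mul_pos hn hN) fun y _ => ?_
  rw [block, inBlock]; ring

end

variable {C : Type u} [Category.{v} C] [Preadditive C] (X : SimplicialOps C)

/-- The subdivision map of the subdivision. -/
def subdivideTwice (n : ℕ) (hn : 0 < n) (m : ℕ) : X.V (n * (m + 1)) ⟶ X.V (n * (n * (m + 1))) :=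
  (X.subdivision n hn).subdivide n m

/-- The homotopy for the sum of the columns of the subdivision of the subdivision. -/
def blockPsi (n : ℕ) (hn : 0 < n) (N : ℕ) : X.V (n * N) ⟶ X.V (n * (N + 1)) :=
  (X.subdivision n hn).psi n N

/-- The boundary of the subdivision of the subdivision. -/
def twiceBoundary (n N : ℕ) : X.V (n * (n * (N + 1))) ⟶ X.V (n * (n * N)) :=
  ∑ i ∈ Finset.range (N + 1), (-1 : ℤ) ^ i •
    X.op (n * (n * (N + 1))) (n * (n * N)) (block (N + 1) N (coface i))

/-- This is `subdivide_boundary` for the subdivision itself; `block_block` identifies the faces of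
its subdivision. -/
theorem subdivideTwice_boundary {n : ℕ} (hn : 0 < n) (m : ℕ) :
    X.subdivideTwice n hn (m + 1) ≫ X.twiceBoundary n (m + 1) =
      X.blockBoundary n (m + 1) ≫ X.subdivideTwice n hn m := by
  have h : (X.subdivision n hn).blockBoundary n (m + 1) = X.twiceBoundary n (m + 1) := by
    refine Finset.sum_congr rfl fun i _ => ?_
    congr 1
    exact X.op_congr (Nat.mul_pos hn (Nat.mul_pos hn (Nat.succ_pos m))) fun y _ =>
      congrFun (block_block (Nat.succ_pos m) _ hn) y
  rw [← h]
  exact (X.subdivision n hn).subdivide_boundary n m hn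

theorem blockPsi_boundary {n : ℕ} (hn : 0 < n) (m : ℕ) :
    X.blockPsi n hn (m + 1) ≫ X.blockBoundary n (m + 1) +
      X.blockBoundary n m ≫ X.blockPsi n hn m =
      ∑ s ∈ Finset.range n, X.subdivideTwice n hn m ≫
        X.blocks n (n * (n * (m + 1))) (m + 1) (fun j => s + n * j) -
          (n : ℤ) • 𝟙 (X.V (n * (m + 1))) := by
  refine ((X.subdivision n hn).psi_boundary hn m).trans ?_
  congr 1
  refine Finset.sum_congr rfl fun s _ => ?_
  rw [X.subdivision_column hn (Nat.succ_pos m)]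
  rfl

/-- The map `subdivideTwice` subdivides every column separately. So subdividing the column `s` alone
means subdividing all of them and keeping the group `s` of `n` consecutive blocks. -/
theorem column_subdivide {n : ℕ} (hn : 0 < n) (m : ℕ) {s : ℕ} (hs : s < n) :
    X.column n (m + 1) s ≫ X.subdivide n m =
      X.subdivideTwice n hn m ≫
        X.blocks n (n * (n * (m + 1))) (m + 1) fun j => j + n * s := by
  have hpos : 0 < n * (m + 1) := Nat.mul_pos hn (Nat.succ_pos m)
  have hb : Valid (n * (n * (m + 1))) (n * (m + 1))
      fun y => y % (m + 1) + (m + 1) * (y / (m + 1) + n * s) := by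
    have : (fun y => y % (m + 1) + (m + 1) * (y / (m + 1) + n * s)) =
        inBlock (n * (m + 1)) s := by
      funext y
      conv_rhs => rw [inBlock, ← Nat.mod_add_div y (m + 1)]
      ring
    rw [this]
    exact valid_inBlock hpos hs
  have hS : X.subdivideTwice n hn m = ∑ w ∈ words n m, wordSign w •
      X.op (n * (m + 1)) (n * (n * (m + 1))) (block (m + 1) (n * (m + 1)) (wordVertex (m + 1) w)) :=
    rfl
  rw [subdivide, hS, Preadditive.comp_sum, Preadditive.sum_comp]
  refine Finset.sum_congr rfl fun w hw => ?_
  have hw' := valid_wordVertex hn (mem_words.1 hw).1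
  rw [Preadditive.comp_zsmul, Preadditive.zsmul_comp]
  congr 1
  refine (X.op_comp (valid_inBlock (Nat.succ_pos m) hs) hw').trans ?_
  refine Eq.trans ?_ (X.op_comp (hw'.block hn) hb).symm
  refine X.op_congr hpos fun y hy => ?_
  simp only [Function.comp]
  rw [show y % (m + 1) + (m + 1) * (y / (m + 1) + n * s) =
    y % (m + 1) + (m + 1) * (y / (m + 1)) + n * (m + 1) * s by ring, Nat.mod_add_div,
    block_apply _ _ hy, inBlock]

/-- The homotopy that moves the columns from the blocks `s + n j` to the blocks `j + n s`. -/
def regroupColumns (n s N : ℕ) : X.V (n * (n * N)) ⟶ X.V (n * (N + 1)) :=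
  X.moveColumns n (n * (n * N)) N (fun j => j + n * s) -
    X.moveColumns n (n * (n * N)) N fun j => s + n * j

theorem regroupColumns_boundary {n : ℕ} (hn : 0 < n) (m : ℕ) {s : ℕ} (hs : s < n) :
    X.regroupColumns n s (m + 1) ≫ X.blockBoundary n (m + 1) +
      X.twiceBoundary n m ≫ X.regroupColumns n s m =
      X.blocks n (n * (n * (m + 1))) (m + 1) (fun j => j + n * s) -
        X.blocks n (n * (n * (m + 1))) (m + 1) fun j => s + n * j := by
  have h1 := X.moveColumns_boundary (n := n) (B := n * n) (m := m) (L := n * (n * m))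
    (L' := n * (n * (m + 1))) (by ring) (by ring) (b := fun j => j + n * s) hn
    (fun j _ => Nat.le_add_right _ _) (fun j j' h _ => by simpa using h)
    (fun j hj => add_mul_lt hj hs)
  have h2 := X.moveColumns_boundary (n := n) (B := n * n) (m := m) (L := n * (n * m))
    (L' := n * (n * (m + 1))) (by ring) (by ring) (b := fun j => s + n * j) hn
    (fun j _ => (Nat.le_mul_of_pos_left j hn).trans (Nat.le_add_left _ _))
    (fun j j' h _ => by simpa using (Nat.mul_lt_mul_left hn).2 h)
    (fun j hj => add_mul_lt hs hj)
  rw [regroupColumns, regroupColumns, Preadditive.sub_comp, Preadditive.comp_sub, twiceBoundary]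
  rw [← eq_sub_iff_add_eq] at h1 h2
  rw [h1, h2]
  abel

/-- The homotopy between the composite of the sum of the columns with the subdivision map and `n`
times the identity. -/
def subdivisionHomotopy (n : ℕ) (hn : 0 < n) : ∀ N : ℕ, X.V (n * N) ⟶ X.V (n * (N + 1))
  | 0 => 0
  | m + 1 => ∑ s ∈ Finset.range n, X.subdivideTwice n hn m ≫ X.regroupColumns n s (m + 1) +
      X.blockPsi n hn (m + 1)

/-- Applied to the subdivision, `psi_boundary` reads one block with the number `s` in every group,
whereas the composite of a column with the subdivision map reads all blocks of the group `s`. As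
`subdivideTwice` is compatible with the boundaries, following it by `regroupColumns` bridges the
difference for each `s`. -/
theorem subdivisionHomotopy_boundary {n : ℕ} (hn : 0 < n) (m : ℕ) :
    X.subdivisionHomotopy n hn (m + 1) ≫ X.blockBoundary n (m + 1) +
      X.blockBoundary n m ≫ X.subdivisionHomotopy n hn m =
      ∑ s ∈ Finset.range n, X.column n (m + 1) s ≫ X.subdivide n m -
        (n : ℤ) • 𝟙 (X.V (n * (m + 1))) := by
  have hpsi := X.blockPsi_boundary hn m
  have hH : X.blockBoundary n m ≫ X.subdivisionHomotopy n hn m =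
      ∑ s ∈ Finset.range n, X.subdivideTwice n hn m ≫ X.twiceBoundary n m ≫
        X.regroupColumns n s m + X.blockBoundary n m ≫ X.blockPsi n hn m := by
    -- The value `0` of the homotopy at the bottom agrees with the general formula, because the sums
    -- in `regroupColumns` and `blockPsi` are empty there.
    rcases m with _ | m
    · have h1 : ∀ s, X.regroupColumns n s 0 = 0 := fun s => by
        simp [regroupColumns, moveColumns, prism]
      have h2 : X.blockPsi n hn 0 = 0 := by
        have : (X.subdivision n hn).psi n 0 = 0 := by simp [psi]
        exact this
      rw [h2, Finset.sum_eq_zero fun s _ => by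
        rw [h1, Limits.comp_zero, Limits.comp_zero]]
      simp [subdivisionHomotopy]
    · rw [subdivisionHomotopy, Preadditive.comp_add, Preadditive.comp_sum]
      congr 1
      refine Finset.sum_congr rfl fun s _ => ?_
      rw [← Category.assoc, ← Category.assoc, X.subdivideTwice_boundary hn m]
  have hK : ∀ s ∈ Finset.range n,
      X.subdivideTwice n hn m ≫ X.regroupColumns n s (m + 1) ≫ X.blockBoundary n (m + 1) +
      X.subdivideTwice n hn m ≫ X.twiceBoundary n m ≫ X.regroupColumns n s m =
      X.column n (m + 1) s ≫ X.subdivide n m -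
        X.subdivideTwice n hn m ≫
          X.blocks n (n * (n * (m + 1))) (m + 1) (fun j => s + n * j) := by
    intro s hs
    rw [X.column_subdivide hn m (Finset.mem_range.1 hs), ← Preadditive.comp_sub,
      ← X.regroupColumns_boundary hn m (Finset.mem_range.1 hs), Preadditive.comp_add]
  have hsum := Finset.sum_congr rfl hK
  rw [Finset.sum_add_distrib, Finset.sum_sub_distrib] at hsum
  rw [hH, subdivisionHomotopy, Preadditive.add_comp, Preadditive.sum_comp]
  simp only [Category.assoc]
  rw [add_add_add_comm, hpsi, hsum]
  abel

end SimplicialOps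

/-! ### Recognising a regrouping by its lift. -/

section nextInjective

variable {m n : ℕ} [NeZero n]

theorem next_injective : Function.Injective (next : Idx m n → Idx m n) := by
  obtain ⟨N, hN⟩ := Nat.exists_eq_succ_of_ne_zero
    (Nat.mul_pos (Nat.pos_of_ne_zero (NeZero.ne n)) (Nat.succ_pos m)).ne'
  have h : ∀ x : Idx m n, next^[N] (next x) = x := fun x => by
    rw [← Function.iterate_succ_apply, ← hN, next_iter_all]; rfl
  intro x y hxy
  rw [← h x, hxy, h y]

theorem unlin_zero : unlin m n 0 = (0, 0) := by
  have := unlin_lin ((0, 0) : Idx m n)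
  simpa [lin] using this

theorem unlin_row_zero (j : Fin n) : unlin m n (((m : ℤ) + 1) * (j : ℕ)) = (0, j) := by
  have := unlin_lin ((0, j) : Idx m n)
  simpa [lin] using this

end nextInjective

namespace Regrouping

variable {n m n' m' : ℕ} [NeZero n] [NeZero n']

/-- A regrouping is determined by the lengths of the composites and by one entry. -/
theorem eq_ofLift (R : Regrouping n m n' m') {ψ : ℤ → ℤ}
    (h : IsLift (n' * (m' + 1)) (n * (m + 1)) ψ)
    (hlen : ∀ y, (R.len y : ℤ) = ψ (lin y) - ψ (lin y - 1)) (c : ℕ)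
    (hstart : next^[c] (R.start (0, 0)) = unlin m n (ψ (-1) + 1 + c)) :
    R = ofLift n m n' m' ψ h := by
  have hl : ∀ y, R.len y = (ofLift n m n' m' ψ h).len y := fun y => by
    have := hlen y
    simp only [ofLift]; omega
  refine ext_of (fun y => ?_) hl
  have h0 : R.start (0, 0) = (ofLift n m n' m' ψ h).start (0, 0) := by
    -- As `next` is injective, the starts may be compared `c` steps later, where the position is
    -- easier to name.
    refine next_injective.iterate c ?_
    rw [hstart]
    simp only [ofLift]
    rw [next_iterate_unlin]
    simp [lin]
  obtain ⟨d, rfl⟩ := exists_iter_zero y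
  induction d with
  | zero => exact h0
  | succ d ih =>
    rw [Function.iterate_succ_apply', ← R.chain, ← (ofLift n m n' m' ψ h).chain, hl, ih]

end Regrouping

theorem IsLift.mul {N N' : ℕ} {ψ : ℤ → ℤ} (h : IsLift N' N ψ) (n : ℕ) :
    IsLift (n * N') (n * N) ψ := by
  refine ⟨h.mono, fun y => ?_⟩
  have := h.add_mul y n
  push_cast
  rw [mul_comm (n : ℤ) N', this, mul_comm (n : ℤ) N]

section periodicLin

variable {m n : ℕ}

theorem periodic_lin (N : ℕ) (θ : ℕ → ℕ) (r : Fin (m + 1)) (j : Fin n) :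
    periodic N (m + 1) θ (lin (r, j)) = θ r + N * (j : ℕ) := by
  have := periodic_apply N θ r.isLt (j : ℕ)
  rw [← this, lin]; push_cast; rfl

theorem periodic_lin_sub (N : ℕ) (θ : ℕ → ℕ) (r : Fin (m + 1)) (j : Fin n) :
    periodic N (m + 1) θ (lin (r, j) - 1) =
      if (r : ℕ) = 0 then (θ m : ℤ) + N * ((j : ℕ) - 1) else θ (r - 1) + N * (j : ℕ) := by
  split_ifs with h
  · have := periodic_apply N θ (Nat.lt_succ_self m) ((j : ℕ) - 1)
    rw [← this, lin]
    congr 1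
    simp only [h]; push_cast; ring
  · have := periodic_apply N θ (show (r : ℕ) - 1 < m + 1 by omega) (j : ℕ)
    rw [← this, lin]
    congr 1
    simp only
    push_cast [show 1 ≤ (r : ℕ) by omega]
    ring

theorem periodic_neg_one (N : ℕ) (θ : ℕ → ℕ) : periodic N (m + 1) θ (-1) = θ m - N := by
  have := periodic_apply N θ (Nat.lt_succ_self m) (-1)
  rw [show (-1 : ℤ) = (m : ℤ) + ((m + 1 : ℕ) : ℤ) * (-1) by push_cast; ring, this]
  ring

end periodicLin

theorem isLift_rotate (n m : ℕ) : IsLift (n * (m + 1)) (n * (m + 1)) (fun y => y - ((m : ℤ) + 1)) :=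
  ⟨fun _ _ h => by simpa using h, fun y => by ring⟩

/-! ### The structural regroupings as periodic maps. -/

section identifications

variable (k : Type w) [Field k] (A : Type u) [Category.{v} A] [Preadditive A] [Linear k A]
  [DGCategory k A] (n m : ℕ) [NeZero n]

/-- The operators of the simplicial object of the twisted Hochschild complex. -/
noncomputable def blockOp (m m' : ℕ) (θ : ℕ → ℕ) : Chain k A n m →ₗ[k] Chain k A n m' :=
  cyclicOp k A n m n m' (periodic (m + 1) (m' + 1) θ)

/-- The composite of the rows `i` and `i + 1` ends in the row `i + 1`, so the lift omits the row
`i`. -/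
theorem faceRegrouping_map (i : Fin (m + 1)) :
    (faceRegrouping n m i).map (k := k) (A := A) = blockOp k A n (m + 1) m (coface i) := by
  rw [blockOp, cyclicOp_eq ((valid_coface (Nat.succ_pos m) i).isLift.mul n)]
  congr 1
  refine Regrouping.eq_ofLift _ _ (fun y => ?_) 0 ?_
  · obtain ⟨r, j⟩ := y
    rw [periodic_lin, periodic_lin_sub]
    simp only [faceRegrouping, coface, Fin.ext_iff]
    have := i.isLt
    have := r.isLt
    push_cast
    split_ifs <;> first | omega | (ring_nf; omega)
  · rw [periodic_neg_one]
    simp only [faceRegrouping, coface, if_neg (show ¬ m < (i : ℕ) by have := i.isLt; omega)]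
    push_cast
    rw [show (m : ℤ) + 1 - (m + 1 + 1) + 1 + 0 = 0 by ring, unlin_zero]
    simp

/-- The twist enters here. Omitting the last row as an end makes each top entry absorb the bottom
entry of the preceding column, which is the effect of `t`; in the linear numbering the exceptional
face is a coface like the others. -/
theorem lastFaceRegrouping_map :
    (lastFaceRegrouping n m).map (k := k) (A := A) = blockOp k A n (m + 1) m (coface (m + 1)) := by
  rw [blockOp, cyclicOp_eq ((valid_coface (Nat.succ_pos m) (m + 1)).isLift.mul n)]
  congr 1
  -- The first new entry starts one step before the top of the first column.
  refine Regrouping.eq_ofLift _ _ (fun y => ?_) 1 ?_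
  · obtain ⟨r, j⟩ := y
    rw [periodic_lin, periodic_lin_sub]
    have := r.isLt
    simp only [lastFaceRegrouping, coface, Fin.ext_iff, Fin.val_zero, if_pos this]
    push_cast
    split_ifs <;> first | omega | (ring_nf; omega)
  · rw [periodic_neg_one]
    simp only [lastFaceRegrouping, coface, if_pos (Nat.lt_succ_self m), if_true,
      Function.iterate_one]
    rw [next_last]
    push_cast
    rw [show (m : ℤ) - (m + 1 + 1) + 1 + 1 = 0 by ring, unlin_zero]
    simp

theorem hochschildDiff_eq : hochschildDiff k A n m =
    ∑ i ∈ Finset.range (m + 2), (-1 : ℤ) ^ i • blockOp k A n (m + 1) m (coface i) := by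
  rw [hochschildDiff, Finset.sum_range_succ, Finset.sum_range, lastFaceRegrouping_map]
  congr 1
  · refine Finset.sum_congr rfl fun i _ => ?_
    rw [faceRegrouping_map, ← Int.cast_smul_eq_zsmul k]
    push_cast; rfl
  · rw [← Int.cast_smul_eq_zsmul k]
    push_cast; rfl

theorem rotateRegrouping_map : (rotateRegrouping n m).map (k := k) (A := A) =
    cyclicOp k A n m n m fun y => y - ((m : ℤ) + 1) := by
  rw [cyclicOp_eq (isLift_rotate n m)]
  congr 1
  refine Regrouping.eq_ofLift _ _ (fun y => ?_) (m + 1) ?_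
  · simp only [rotateRegrouping]; push_cast; ring
  · simp only [rotateRegrouping]
    rw [next_iter_col]
    push_cast
    rw [show (-1 : ℤ) - (m + 1) + 1 + (m + 1) = 0 by ring, unlin_zero]
    simp

/-- No new entry ends outside the column `s`. By periodicity the top entry absorbs everything after
the preceding bottom of that column. -/
theorem columnRegrouping_map (s : Fin n) : (columnRegrouping n m s).map (k := k) (A := A) =
    cyclicOp k A n m 1 m (periodic (n * (m + 1)) (m + 1) (inBlock (m + 1) s)) := by
  have hv := (valid_inBlock (Nat.succ_pos m) s.isLt).isLift
  rw [cyclicOp_eq (by rwa [one_mul])]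
  congr 1
  have hn : 0 < n := Nat.pos_of_ne_zero (NeZero.ne n)
  refine Regrouping.eq_ofLift _ _ (fun y => ?_) 0 ?_
  · obtain ⟨r, j⟩ := y
    rw [periodic_lin, periodic_lin_sub]
    obtain rfl : j = 0 := Subsingleton.elim _ _
    simp only [columnRegrouping, inBlock, Fin.ext_iff, Fin.val_zero]
    split_ifs with h
    · rw [h]; push_cast [show 1 ≤ n by omega]; ring
    · push_cast [show 1 ≤ (r : ℕ) by omega]; ring
  · rw [periodic_neg_one]
    simp only [columnRegrouping, inBlock, if_true]
    have h1 := next_iter_col (m := m) s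
    rw [← unlin_row_zero, next_iterate_unlin] at h1
    rw [Function.iterate_zero, id, ← h1, ← unlin_add _ (-1)]
    congr 1; push_cast; ring

/-- The new entries end at the consecutive numbers `p - 1, p, …`; the last `q` old entries fall to
the top entry by periodicity. -/
theorem wrapRegrouping_map {p q : ℕ} (hp : 1 ≤ p) (hpq : p + q ≤ m + 1) :
    (wrapRegrouping m p q hp hpq).map (k := k) (A := A) =
      cyclicOp k A 1 m 1 (m + 1 - (p + q))
        (periodic (m + 1) (m + 1 - (p + q) + 1) (p - 1 + ·)) := by
  have hv : Valid (m + 1) (m + 1 - (p + q) + 1) (p - 1 + ·) := SimplicialOps.valid_add (by omega)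
  rw [cyclicOp_eq (by rw [one_mul, one_mul]; exact hv.isLift)]
  congr 1
  refine Regrouping.eq_ofLift _ _ (fun y => ?_) 0 ?_
  · obtain ⟨r, j⟩ := y
    rw [periodic_lin, periodic_lin_sub]
    obtain rfl : j = 0 := Subsingleton.elim _ _
    simp only [wrapRegrouping, Fin.ext_iff, Fin.val_zero]
    split_ifs with h
    · rw [h]; push_cast [show 1 ≤ p by omega, show p + q ≤ m + 1 by omega]; ring
    · push_cast [show 1 ≤ (r : ℕ) by omega]; ring
  · rw [periodic_neg_one]
    simp only [wrapRegrouping, if_true, Function.iterate_zero, id]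
    have h1 := next_iter_single (m + 1 - q) (0 : Fin (m + 1)) 0
    rw [zero_add, ← unlin_zero (m := m) (n := 1), next_iterate_unlin] at h1
    rw [← h1, ← unlin_add _ (-1)]
    congr 1
    push_cast [show 1 ≤ p by omega, show p + q ≤ m + 1 by omega, show q ≤ m + 1 by omega]; ring

end identifications

/-! ### The simplicial object of chains -/

/-- The spaces of chains, as the objects of a category. -/
structure ChainObj (k : Type w) (A : Type u) where
  n : ℕ
  m : ℕ
  [ne : NeZero n]

attribute [instance] ChainObj.ne

section category

variable {k : Type w} [Field k] {A : Type u} [Category.{v} A] [Preadditive A] [Linear k A]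
  [DGCategory k A]

/-- The linear maps of chains that commute with the differential of `A` and preserve the degrees
of the morphisms. -/
noncomputable def chainHom (X Y : ChainObj k A) :
    Submodule k (Chain k A X.n X.m →ₗ[k] Chain k A Y.n Y.m) where
  carrier := {f | f ∘ₗ internalDiff k X.n X.m = internalDiff k Y.n Y.m ∘ₗ f ∧
    ∀ e, (Chain.degree k A X.n X.m e).map f ≤ Chain.degree k A Y.n Y.m e}
  add_mem' {f g} hf hg := by
    refine ⟨by rw [LinearMap.add_comp, LinearMap.comp_add, hf.1, hg.1], fun e => ?_⟩
    rintro _ ⟨x, hx, rfl⟩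
    exact Submodule.add_mem _ (hf.2 e ⟨x, hx, rfl⟩) (hg.2 e ⟨x, hx, rfl⟩)
  zero_mem' := by
    refine ⟨by simp, fun e => ?_⟩
    rintro _ ⟨x, hx, rfl⟩
    exact Submodule.zero_mem _
  smul_mem' c f hf := by
    refine ⟨by rw [LinearMap.smul_comp, LinearMap.comp_smul, hf.1], fun e => ?_⟩
    rintro _ ⟨x, hx, rfl⟩
    exact Submodule.smul_mem _ c (hf.2 e ⟨x, hx, rfl⟩)

/-- Compatibility with the differential of `A` and with the degrees is part of a morphism. So it
holds automatically for every map built from the simplicial operators, in particular for the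
homotopies. -/
noncomputable instance : Category (ChainObj k A) where
  Hom X Y := chainHom X Y
  id X := ⟨LinearMap.id, by simp, fun e => by simp⟩
  comp f g := ⟨g.1 ∘ₗ f.1, by
    rw [LinearMap.comp_assoc, f.2.1, ← LinearMap.comp_assoc, g.2.1, LinearMap.comp_assoc],
    fun e => by
      rw [Submodule.map_comp]
      exact (Submodule.map_mono (f.2.2 e)).trans (g.2.2 e)⟩
  id_comp _ := rfl
  comp_id _ := rfl
  assoc _ _ _ := rfl

noncomputable instance : Preadditive (ChainObj k A) where
  homGroup X Y := inferInstanceAs (AddCommGroup (chainHom X Y))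
  add_comp _ _ _ _ _ _ := Subtype.ext (LinearMap.comp_add _ _ _)
  comp_add _ _ _ _ _ _ := Subtype.ext (LinearMap.add_comp _ _ _)

variable (k A)

/-- The operator of a monotone periodic map, as a morphism. -/
noncomputable def cyclicHom (X Y : ChainObj k A) (ψ : ℤ → ℤ) : X ⟶ Y :=
  ⟨cyclicOp k A X.n X.m Y.n Y.m ψ, cyclicOp_internalDiff ψ, cyclicOp_degree ψ⟩

/-- The simplicial object of the chains of a DG category. -/
noncomputable def chainOps : SimplicialOps (ChainObj k A) where
  -- `N` counts vertices, that is, the entries of a chain. The object `V 0` is a spurious copy of `V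
  -- 1`, which enters only through terms that vanish.
  V N := ⟨1, N - 1⟩
  op N N' θ := cyclicHom k A _ _ (periodic N N' θ)
  op_id {N} hN := Subtype.ext (by
    change cyclicOp k A 1 (N - 1) 1 (N - 1) (periodic N N id) = _
    rw [periodic_id hN]; exact cyclicOp_id)
  op_comp {N N' N'' θ θ'} h h' := Subtype.ext (by
    have hN : 0 < N := (Nat.zero_le _).trans_lt (h.lt 0 h.pos)
    refine (cyclicOp_comp ?_ ?_).trans ?_
    · simpa only [one_mul, Nat.sub_add_cancel hN, Nat.sub_add_cancel h.pos] using h.isLift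
    · simpa only [one_mul, Nat.sub_add_cancel h'.pos, Nat.sub_add_cancel h.pos] using h'.isLift
    · rw [periodic_comp h']; rfl)
  op_congr {N N' θ θ'} h0 h := Subtype.ext (by
    change cyclicOp k A 1 (N - 1) 1 (N' - 1) _ = cyclicOp k A 1 (N - 1) 1 (N' - 1) _
    rw [periodic_congr N h0 h])

variable {k A}

/-- The linear map underlying a morphism. -/
noncomputable def chainLin {N N' : ℕ} (f : (chainOps k A).V N ⟶ (chainOps k A).V N') :
    Chain k A 1 (N - 1) →ₗ[k] Chain k A 1 (N' - 1) := f.1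

theorem chainLin_comp {N N' N'' : ℕ} (f : (chainOps k A).V N ⟶ (chainOps k A).V N')
    (g : (chainOps k A).V N' ⟶ (chainOps k A).V N'') :
    chainLin (f ≫ g) = chainLin g ∘ₗ chainLin f := rfl

theorem chainLin_id (N : ℕ) : chainLin (𝟙 ((chainOps k A).V N)) = LinearMap.id := rfl

theorem chainLin_add {N N' : ℕ} (f g : (chainOps k A).V N ⟶ (chainOps k A).V N') :
    chainLin (f + g) = chainLin f + chainLin g := rfl

theorem chainLin_sum {N N' : ℕ} {ι : Type*} (s : Finset ι)
    (f : ι → ((chainOps k A).V N ⟶ (chainOps k A).V N')) :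
    chainLin (∑ i ∈ s, f i) = ∑ i ∈ s, chainLin (f i) :=
  map_sum (AddMonoidHom.mk' (chainLin (k := k) (A := A) (N := N) (N' := N')) chainLin_add) f s

theorem chainLin_zsmul {N N' : ℕ} (c : ℤ) (f : (chainOps k A).V N ⟶ (chainOps k A).V N') :
    chainLin (c • f) = c • chainLin f :=
  map_zsmul (AddMonoidHom.mk' (chainLin (k := k) (A := A) (N := N) (N' := N')) chainLin_add) c f

theorem chainLin_sub {N N' : ℕ} (f g : (chainOps k A).V N ⟶ (chainOps k A).V N') :
    chainLin (f - g) = chainLin f - chainLin g :=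
  map_sub (AddMonoidHom.mk' (chainLin (k := k) (A := A) (N := N) (N' := N')) chainLin_add) f g

theorem chainLin_internalDiff {N N' : ℕ} (f : (chainOps k A).V N ⟶ (chainOps k A).V N') :
    chainLin f ∘ₗ internalDiff k 1 (N - 1) = internalDiff k 1 (N' - 1) ∘ₗ chainLin f := f.2.1

theorem chainLin_degree {N N' : ℕ} (f : (chainOps k A).V N ⟶ (chainOps k A).V N') (e : ℤ) :
    (Chain.degree k A 1 (N - 1) e).map (chainLin f) ≤ Chain.degree k A 1 (N' - 1) e := f.2.2 e

variable (k A)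

theorem chainLin_op (N N' : ℕ) (θ : ℕ → ℕ) : chainLin ((chainOps k A).op N N' θ) =
    cyclicOp k A 1 (N - 1) 1 (N' - 1) (periodic N N' θ) := rfl

/-! ### The twisted complex as the subdivision of the chains. -/

section unroll

variable (n : ℕ) [NeZero n] (m : ℕ)

/-- A column of `n (m + 1)` morphisms as a matrix with `m + 1` rows. -/
noncomputable def fold : Chain k A 1 (n * (m + 1) - 1) →ₗ[k] Chain k A n m :=
  cyclicOp k A _ _ _ _ id

/-- A matrix with `m + 1` rows as a column of `n (m + 1)` morphisms. -/
noncomputable def unfold : Chain k A n m →ₗ[k] Chain k A 1 (n * (m + 1) - 1) :=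
  cyclicOp k A _ _ _ _ id

theorem size_eq : 1 * (n * (m + 1) - 1 + 1) = n * (m + 1) := by
  rw [one_mul, Nat.sub_add_cancel (Nat.mul_pos (Nat.pos_of_ne_zero (NeZero.ne n)) (Nat.succ_pos m))]

theorem isLift_fold : IsLift (n * (m + 1)) (1 * (n * (m + 1) - 1 + 1)) id := by
  rw [size_eq]; exact isLift_id _

theorem isLift_unfold : IsLift (1 * (n * (m + 1) - 1 + 1)) (n * (m + 1)) id := by
  rw [size_eq]; exact isLift_id _

/-- A matrix and its unrolled column have the same linear numbering, so both maps have the identity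
as their lift. The Koszul signs between reading by rows and reading by columns are built into the
operators. -/
theorem fold_unfold : fold k A n m ∘ₗ unfold k A n m = LinearMap.id := by
  rw [fold, unfold, cyclicOp_comp (isLift_unfold n m) (isLift_fold n m)]
  exact cyclicOp_id

theorem unfold_fold : unfold k A n m ∘ₗ fold k A n m = LinearMap.id := by
  rw [fold, unfold, cyclicOp_comp (isLift_fold n m) (isLift_unfold n m)]
  exact cyclicOp_id

/-- A morphism between subdivided chains as a map of matrices. -/
noncomputable def conjugate {m m' : ℕ}
    (f : (chainOps k A).V (n * (m + 1)) ⟶ (chainOps k A).V (n * (m' + 1))) :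
    Chain k A n m →ₗ[k] Chain k A n m' :=
  fold k A n m' ∘ₗ chainLin f ∘ₗ unfold k A n m

theorem conjugate_comp {m m' m'' : ℕ}
    (f : (chainOps k A).V (n * (m + 1)) ⟶ (chainOps k A).V (n * (m' + 1)))
    (g : (chainOps k A).V (n * (m' + 1)) ⟶ (chainOps k A).V (n * (m'' + 1))) :
    conjugate k A n (f ≫ g) = conjugate k A n g ∘ₗ conjugate k A n f := by
  simp only [conjugate, chainLin_comp]
  have := unfold_fold k A n m'
  calc _ = fold k A n m'' ∘ₗ chainLin g ∘ₗ LinearMap.id ∘ₗ chainLin f ∘ₗ unfold k A n m := rfl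
    _ = _ := by rw [← this]; rfl

theorem conjugate_id : conjugate k A n (𝟙 ((chainOps k A).V (n * (m + 1)))) = LinearMap.id := by
  rw [conjugate, chainLin_id]; exact fold_unfold k A n m

theorem conjugate_op {m m' : ℕ} {θ : ℕ → ℕ} (h : Valid (m + 1) (m' + 1) θ) :
    conjugate k A n ((chainOps k A).op (n * (m + 1)) (n * (m' + 1)) (block (m + 1) (m' + 1) θ)) =
      blockOp k A n m m' θ := by
  have hn : 0 < n := Nat.pos_of_ne_zero (NeZero.ne n)
  have hl : IsLift (1 * (n * (m' + 1) - 1 + 1)) (1 * (n * (m + 1) - 1 + 1))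
      (periodic (n * (m + 1)) (n * (m' + 1)) (block (m + 1) (m' + 1) θ)) := by
    rw [size_eq, size_eq]; exact (h.block hn).isLift
  rw [conjugate, chainLin_op, unfold, cyclicOp_comp (isLift_unfold n m) hl, fold,
    cyclicOp_comp ((isLift_unfold n m).comp hl) (isLift_fold n m'), blockOp,
    ← periodic_block (Nat.succ_pos m') θ hn]
  rfl

theorem conjugate_internalDiff {m m' : ℕ}
    (f : (chainOps k A).V (n * (m + 1)) ⟶ (chainOps k A).V (n * (m' + 1))) :
    conjugate k A n f ∘ₗ internalDiff k n m = internalDiff k n m' ∘ₗ conjugate k A n f := by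
  have h1 : unfold k A n m ∘ₗ internalDiff k n m = internalDiff k 1 _ ∘ₗ unfold k A n m :=
    cyclicOp_internalDiff _
  have h2 : fold k A n m' ∘ₗ internalDiff k 1 _ = internalDiff k n m' ∘ₗ fold k A n m' :=
    cyclicOp_internalDiff _
  have h3 := chainLin_internalDiff f
  calc conjugate k A n f ∘ₗ internalDiff k n m
      = (fold k A n m' ∘ₗ chainLin f) ∘ₗ (unfold k A n m ∘ₗ internalDiff k n m) := rfl
    _ = fold k A n m' ∘ₗ (chainLin f ∘ₗ internalDiff k 1 _) ∘ₗ unfold k A n m := by rw [h1]; rfl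
    _ = (fold k A n m' ∘ₗ internalDiff k 1 _) ∘ₗ chainLin f ∘ₗ unfold k A n m := by rw [h3]; rfl
    _ = _ := by rw [h2]; rfl

theorem conjugate_degree {m m' : ℕ}
    (f : (chainOps k A).V (n * (m + 1)) ⟶ (chainOps k A).V (n * (m' + 1))) (e : ℤ) :
    (Chain.degree k A n m e).map (conjugate k A n f) ≤ Chain.degree k A n m' e := by
  rw [conjugate, Submodule.map_comp, Submodule.map_comp]
  exact (Submodule.map_mono ((Submodule.map_mono (cyclicOp_degree _ e)).trans
    (chainLin_degree f e))).trans (cyclicOp_degree _ e)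

theorem conjugate_add {m m' : ℕ}
    (f g : (chainOps k A).V (n * (m + 1)) ⟶ (chainOps k A).V (n * (m' + 1))) :
    conjugate k A n (f + g) = conjugate k A n f + conjugate k A n g := by
  rw [conjugate, chainLin_add, LinearMap.add_comp, LinearMap.comp_add]; rfl

theorem conjugate_zsmul {m m' : ℕ} (c : ℤ)
    (f : (chainOps k A).V (n * (m + 1)) ⟶ (chainOps k A).V (n * (m' + 1))) :
    conjugate k A n (c • f) = c • conjugate k A n f := by
  rw [conjugate, chainLin_zsmul, LinearMap.smul_comp, LinearMap.comp_smul]; rfl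

theorem conjugate_sum {m m' : ℕ} {ι : Type*} (s : Finset ι)
    (f : ι → ((chainOps k A).V (n * (m + 1)) ⟶ (chainOps k A).V (n * (m' + 1)))) :
    conjugate k A n (∑ i ∈ s, f i) = ∑ i ∈ s, conjugate k A n (f i) :=
  map_sum (AddMonoidHom.mk' (conjugate k A n (m := m) (m' := m')) (conjugate_add k A n)) f s

/-- It identifies the twisted Hochschild complex with the edgewise subdivision; the identities for
simplicial objects are transported through it. -/
theorem conjugate_blockBoundary : conjugate k A n ((chainOps k A).blockBoundary n (m + 1)) =
    hochschildDiff k A n m := by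
  rw [hochschildDiff_eq, SimplicialOps.blockBoundary, conjugate_sum]
  refine Finset.sum_congr rfl fun i _ => ?_
  rw [conjugate_zsmul, conjugate_op k A n (valid_coface (Nat.succ_pos m) i)]

theorem chainLin_boundary : chainLin ((chainOps k A).boundary (m + 1)) = hochschildDiff k A 1 m := by
  rw [hochschildDiff_eq, SimplicialOps.boundary, chainLin_sum]
  refine Finset.sum_congr rfl fun i _ => ?_
  rw [chainLin_zsmul]; rfl

theorem chainLin_column (s : Fin n) :
    chainLin ((chainOps k A).column n (m + 1) s) ∘ₗ unfold k A n m =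
      (columnRegrouping n m s).map := by
  rw [SimplicialOps.column, chainLin_op, unfold, cyclicOp_comp (isLift_unfold n m),
    columnRegrouping_map]
  · rfl
  · rw [size_eq, one_mul]
    exact (valid_inBlock (Nat.succ_pos m) s.isLt).isLift

end unroll

end category

/-! ### Words as functions -/

/-- The word of the values of a function. -/
def wordOf {r l : ℕ} (c : Fin r → Fin l) : List ℕ := List.ofFn fun i => (c i : ℕ)

section wordOf

variable {r l : ℕ}

theorem wordOf_length (c : Fin r → Fin l) : (wordOf c).length = r := List.length_ofFn

theorem wordOf_cons (a : Fin l) (c : Fin r → Fin l) :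
    wordOf (Fin.cons a c : Fin (r + 1) → Fin l) = (a : ℕ) :: wordOf c := by
  simp [wordOf, List.ofFn_succ]

theorem countP_ofFn (g : Fin r → ℕ) (p : ℕ → Prop) [DecidablePred p] :
    (List.ofFn g).countP (fun a => decide (p a)) = (Finset.univ.filter fun i => p (g i)).card := by
  induction r with
  | zero => simp
  | succ r ih =>
    rw [List.ofFn_succ, List.countP_cons, ih, Fin.card_filter_univ_succ]
    simp only [decide_eq_true_eq]
    split_ifs <;> rfl

theorem count_wordOf (c : Fin r → Fin l) (a : ℕ) :
    (wordOf c).count a = (Finset.univ.filter fun i => (c i : ℕ) = a).card := by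
  rw [← countP_ofFn (fun i => (c i : ℕ)) (· = a), List.count, wordOf]
  rfl

theorem sum_words_eq_sum_wordOf {M : Type*} [AddCommMonoid M] (r l : ℕ) (G : List ℕ → M) :
    ∑ w ∈ words l r, G w = ∑ c : Fin r → Fin l, G (wordOf c) := by
  induction r generalizing G with
  | zero => simp [words, wordOf]
  | succ r ih =>
    rw [words, Finset.sum_image, Finset.sum_product,
      ← (Fin.consEquiv fun _ : Fin (r + 1) => Fin l).sum_comp, Fintype.sum_prod_type,
      Finset.sum_range]
    · refine Finset.sum_congr rfl fun a _ => ?_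
      rw [ih]
      refine Finset.sum_congr rfl fun c _ => ?_
      rw [← wordOf_cons]; rfl
    · rintro p - q - h
      simp only [List.cons.injEq] at h
      exact Prod.ext h.1 h.2

theorem wordSign_ofFn (g : Fin r → ℕ) : wordSign (List.ofFn g) =
    ∏ i, ∏ j ∈ Finset.Ioi i, if g j < g i then (-1 : ℤ) else 1 := by
  induction r with
  | zero => simp [wordSign]
  | succ r ih =>
    rw [List.ofFn_succ, wordSign, ih, countP_ofFn _ (· < g 0), Fin.prod_univ_succ,
      Fin.prod_Ioi_zero]
    congr 1
    · rw [Finset.prod_ite]; simp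
    · refine Finset.prod_congr rfl fun i _ => ?_
      rw [Fin.prod_Ioi_succ (fun j => if g j < g i.succ then (-1 : ℤ) else 1)]

/-- The permutation sorts the word stably, so its inversions are the pairs of places with a larger
letter in front of a smaller one. -/
theorem sign_rankPerm (c : Fin r → Fin l) :
    (Equiv.Perm.sign (rankPerm c) : ℤ) = wordSign (wordOf c) := by
  rw [Equiv.Perm.sign_eq_prod_prod_Ioi, wordOf, wordSign_ofFn]
  push_cast
  refine Finset.prod_congr rfl fun i _ => Finset.prod_congr rfl fun j hj => ?_
  rw [Finset.mem_Ioi] at hj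
  by_cases h : c j < c i
  · have h1 : rankPerm c j < rankPerm c i := rank_lt_rank c (Or.inl h)
    rw [if_neg h1.not_gt, if_pos (by exact h)]; rfl
  · have h1 : rankPerm c i < rankPerm c j := rank_lt_rank c (by
      rcases (not_lt.1 h).lt_or_eq with h | h
      · exact Or.inl h
      · exact Or.inr ⟨h, hj⟩)
    rw [if_pos h1, if_neg (by exact h)]; rfl

theorem signedN_eq (r l : ℕ) : signedN r l = signedWords r l := by
  rw [signedN, signedWords, sum_words_eq_sum_wordOf]
  exact Finset.sum_congr rfl fun c _ => sign_rankPerm c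

/-- The indices `p`, `m` and `s` are counted from `1` in `coeffT` and from `0` in `shuffleCoeff`. -/
theorem coeffT_eq (k : Type w) [Field k] {p q m n : ℕ} :
    coeffT k (p + 1) q (m + 1) n = (n : k)⁻¹ * (shuffleCoeff n m p q : k) := by
  rw [coeffT, shuffleCoeff]
  congr 3
  · rw [Nat.add_sub_cancel]
    congr 3; omega
  · refine Finset.sum_nbij' (· - 1) (· + 1) (fun s hs => ?_) (fun s hs => ?_) (fun s hs => ?_)
      (fun s hs => ?_) (fun s hs => ?_)
    all_goals simp only [Finset.mem_Icc, Finset.mem_range] at hs ⊢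
    · omega
    · omega
    · omega
    · omega
    · rw [signedN_eq, signedN_eq, Nat.add_sub_cancel, show n - s = n - 1 - (s - 1) by omega]

end wordOf

/-! ### Insertion of identities -/

section insert

open SimplicialOps

theorem comp_finsetSum {R ι M N P : Type*} [Field R] [AddCommGroup M] [AddCommGroup N]
    [AddCommGroup P] [Module R M] [Module R N] [Module R P] (g : N →ₗ[R] P) (s : Finset ι)
    (f : ι → M →ₗ[R] N) : g ∘ₗ ∑ i ∈ s, f i = ∑ i ∈ s, g ∘ₗ f i := by
  ext x; simp

theorem finsetSum_comp {R ι M N P : Type*} [Field R] [AddCommGroup M] [AddCommGroup N]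
    [AddCommGroup P] [Module R M] [Module R N] [Module R P] (s : Finset ι)
    (f : ι → N →ₗ[R] P) (g : M →ₗ[R] N) : (∑ i ∈ s, f i) ∘ₗ g = ∑ i ∈ s, f i ∘ₗ g := by
  ext x; simp

variable {k : Type w} [Field k] {A : Type u} [Category.{v} A] [Preadditive A] [Linear k A]
  [DGCategory k A]

-- The value `θ y` is the index of the last inserted entry up to `y`. It begins with `0`, for the
-- entry at the first position, and increases by one at every further position of `S`.
open Classical in
theorem insertRegrouping_map {m n' m' : ℕ} [NeZero n'] {S : Finset (Idx m' n')}
    (hS : S.card = m + 1) {θ : ℕ → ℕ} (hv : Valid (m + 1) (n' * (m' + 1)) θ)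
    (h0 : (0, 0) ∈ S) (hθ0 : θ 0 = 0) (hθ1 : θ (n' * (m' + 1) - 1) = m)
    (hθ : ∀ y : Idx m' n', y ≠ (0, 0) → θ (y.1 + (m' + 1) * y.2) =
      θ (y.1 + (m' + 1) * y.2 - 1) + if y ∈ S then 1 else 0) :
    (insertRegrouping m n' m' S hS).map (k := k) (A := A) =
      cyclicOp k A 1 m n' m' (periodic (m + 1) (n' * (m' + 1)) θ) := by
  rw [cyclicOp_eq (by rw [one_mul]; exact hv.isLift)]
  congr 1
  have hN := hv.pos
  have hper : ∀ t < n' * (m' + 1), periodic (m + 1) (n' * (m' + 1)) θ t = θ t := fun t ht => by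
    simpa using periodic_apply (m + 1) θ ht 0
  have hneg : periodic (m + 1) (n' * (m' + 1)) θ (-1) = -1 := by
    have := periodic_apply (m + 1) θ (Nat.sub_lt hN Nat.one_pos) (-1)
    rw [hθ1, Nat.cast_sub hN] at this
    rw [show (-1 : ℤ) = ((n' * (m' + 1) : ℕ) : ℤ) - ((1 : ℕ) : ℤ) +
      ((n' * (m' + 1) : ℕ) : ℤ) * (-1) by push_cast; ring, this]
    push_cast; ring
  refine Regrouping.eq_ofLift _ _ (fun y => ?_) 0 ?_
  · have hlin : lin y = ((y.1 + (m' + 1) * y.2 : ℕ) : ℤ) := by rw [lin]; push_cast; rfl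
    have hlt : (y.1 : ℕ) + (m' + 1) * y.2 < n' * (m' + 1) := add_mul_lt y.1.isLt y.2.isLt
    simp only [insertRegrouping]
    rw [hlin]
    by_cases hy : y = (0, 0)
    · subst hy
      rw [hper _ hlt, if_pos h0]
      simp [hneg, hθ0]
    · have hpos : 1 ≤ (y.1 : ℕ) + (m' + 1) * y.2 := by
        by_contra hc
        refine hy (Prod.ext (Fin.ext ?_) (Fin.ext ?_))
        · rw [Fin.val_zero]; omega
        · rw [Fin.val_zero]
          by_contra h2
          have := Nat.mul_pos (Nat.succ_pos m') (Nat.pos_of_ne_zero h2)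
          simp only [Nat.succ_eq_add_one] at this
          omega
      rw [hper _ hlt, show (((y.1 : ℕ) + (m' + 1) * y.2 : ℕ) : ℤ) - 1 =
        (((y.1 : ℕ) + (m' + 1) * y.2 - 1 : ℕ) : ℤ) by push_cast [hpos]; ring,
        hper _ (by omega), hθ y hy]
      push_cast; ring
  · have h2 : (S.filter fun x => ColLT x ((0, 0) : Idx m' n')) = ∅ := by
      apply Finset.filter_false_of_mem
      rintro ⟨x, z⟩ -
      simp [ColLT]
    simp only [insertRegrouping, h2, hneg]
    rw [show (-1 : ℤ) + 1 + ((0 : ℕ) : ℤ) = 0 by norm_num, unlin_zero]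
    rfl

theorem insertRegrouping_chosen_map {n m : ℕ} [NeZero n] (c : Fin m → Fin n) :
    (insertRegrouping m n m (chosen (Fin.cons 0 c : Fin (m + 1) → Fin n))
      (card_chosen _)).map (k := k) (A := A) =
      cyclicOp k A 1 m n m (periodic (m + 1) (n * (m + 1)) (wordVertex (m + 1) (wordOf c))) := by
  have hn : 0 < n := Nat.pos_of_ne_zero (NeZero.ne n)
  have hmem : ∀ y : Idx m n, y ∈ chosen (Fin.cons 0 c : Fin (m + 1) → Fin n) ↔
      (Fin.cons 0 c : Fin (m + 1) → Fin n) y.1 = y.2 := by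
    rintro ⟨r, j⟩
    simp [chosen, Prod.ext_iff]
  have hlen := wordOf_length c
  have hall : ∀ a ∈ wordOf c, a < n := by
    intro a ha
    obtain ⟨i, rfl⟩ := (List.mem_ofFn' _ _).1 ha
    exact (c i).isLt
  have hstep : ∀ j : ℕ, (wordOf c).countP (· < j + 1) =
      (wordOf c).countP (· < j) + (wordOf c).count j := by
    intro j
    generalize wordOf c = w
    induction w with
    | nil => rfl
    | cons a w ih =>
      simp only [List.countP_cons, List.count_cons, ih, decide_eq_true_eq, beq_iff_eq]
      split_ifs <;> omega
  refine insertRegrouping_map _ (valid_wordVertex hn hlen) ?_ ?_ ?_ ?_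
  · rw [hmem]; rfl
  · simpa using wordVertex_apply (wordOf c) (Nat.succ_pos m) 0
  · have h1 := wordVertex_apply (wordOf c) (Nat.lt_succ_self m) (n - 1)
    have h2 := hstep (n - 1)
    rw [Nat.sub_add_cancel hn] at h2
    rw [List.take_of_length_le hlen.le, ← h2, List.countP_eq_length.2 (by simpa using hall),
      hlen] at h1
    rw [show n * (m + 1) - 1 = m + m.succ * (n - 1) by
      obtain ⟨N, rfl⟩ := Nat.exists_eq_succ_of_ne_zero hn.ne'
      simp only [Nat.succ_eq_add_one, Nat.add_sub_cancel]
      rw [Nat.add_mul, Nat.mul_comm N]; omega]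
    exact h1
  · rintro ⟨r, j⟩ hy
    rw [if_congr (hmem _) rfl rfl, wordVertex_apply _ r.isLt]
    rcases Fin.eq_zero_or_eq_succ r with rfl | ⟨i, rfl⟩
    · have hj : (j : ℕ) ≠ 0 := fun h => hy (Prod.ext rfl (Fin.ext h))
      obtain ⟨b, hb⟩ := Nat.exists_eq_succ_of_ne_zero hj
      rw [if_neg (by simpa using fun h : (0 : Fin n) = j => hj (by rw [← h]; rfl))]
      have h1 := wordVertex_apply (wordOf c) (Nat.lt_succ_self m) b
      rw [List.take_of_length_le hlen.le, ← hstep] at h1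
      simp only [Fin.val_zero, List.take_zero, List.count_nil, add_zero, hb, Nat.succ_eq_add_one]
      rw [← h1]
      congr 1
      rw [mul_add]; simp only [Nat.succ_eq_add_one]; omega
    · have h1 := wordVertex_apply (wordOf c) (show (i : ℕ) < m + 1 by omega) j
      have h2 : ((i.succ, j) : Idx m n).1 + (m + 1) * (j : ℕ) - 1 = i + (m + 1) * j := by
        simp only [Fin.val_succ]; omega
      simp only [Fin.val_succ, Fin.cons_succ] at h2 ⊢
      rw [h2, h1, List.take_succ_eq_append_getElem (by rw [hlen]; exact i.isLt), List.count_append,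
        List.count_singleton]
      have h3 : (wordOf c)[(i : ℕ)]'(by rw [hlen]; exact i.isLt) = c i := by simp [wordOf]
      rw [h3, add_assoc]
      simp only [beq_iff_eq, Fin.ext_iff]

/-- The leading letter `0`, forced by `c 0 = 0`, has no smaller letters behind it and does not
change the sign. So the sum runs over the words of length `m` for the remaining rows. -/
theorem mapG_eq {n m : ℕ} [NeZero n] :
    mapG k A n m = fold k A n m ∘ₗ chainLin ((chainOps k A).subdivide n m) := by
  have hn : 0 < n := Nat.pos_of_ne_zero (NeZero.ne n)
  rw [mapG, Finset.sum_filter, ← (Fin.consEquiv fun _ : Fin (m + 1) => Fin n).sum_comp,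
    Fintype.sum_prod_type, Finset.sum_eq_single 0, SimplicialOps.subdivide,
    sum_words_eq_sum_wordOf, chainLin_sum, comp_finsetSum]
  · refine Finset.sum_congr rfl fun c _ => ?_
    have h1 : (Fin.consEquiv fun _ : Fin (m + 1) => Fin n) (0, c) = Fin.cons 0 c := rfl
    rw [h1, if_pos (Fin.cons_zero _ _), insertRegrouping_chosen_map, chainLin_zsmul, chainLin_op,
      LinearMap.comp_smul, fold, cyclicOp_comp _ (isLift_fold n m), sign_rankPerm, wordOf_cons,
      Int.cast_smul_eq_zsmul]
    · simp [wordSign]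
    · rw [size_eq]
      simpa using (valid_wordVertex hn (wordOf_length c)).isLift
  · intro a _ ha
    exact Finset.sum_eq_zero fun c _ => if_neg ha
  · simp

/-! ### Shuffles as words in two letters. -/

section shuffles

variable {l r : ℕ} (σ : Equiv.Perm (Fin (l + r)))

/-- The letter `0` in the places of the first `l` elements and `1` in the places of the others. -/
def shuffleWord (i : Fin (l + r)) : Fin 2 := if ((σ⁻¹ i : Fin (l + r)) : ℕ) < l then 0 else 1

theorem shuffleWord_apply (a : Fin (l + r)) : shuffleWord σ (σ a) = if (a : ℕ) < l then 0 else 1 := by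
  simp [shuffleWord]

theorem isShuffle_lt {σ : Equiv.Perm (Fin (l + r))} (h : IsShuffle σ) {a b : Fin (l + r)}
    (hab : a < b) (hc : (b : ℕ) < l ∨ l ≤ (a : ℕ)) : σ a < σ b := by
  rcases hc with hc | hc
  · exact h.1 ⟨a, (Fin.lt_def.1 hab).trans hc⟩ ⟨b, hc⟩ hab
  · have hv := Fin.lt_def.1 hab
    have := h.2 ⟨a - l, by omega⟩ ⟨b - l, by omega⟩ (Fin.mk_lt_mk.2 (by omega))
    convert! this using 2 <;> (apply Fin.ext; simp; omega)

theorem strictMono_perm {r : ℕ} {σ : Equiv.Perm (Fin r)} (h : StrictMono σ) : σ = 1 := by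
  have h1 : (h.orderIsoOfSurjective σ σ.surjective) = OrderIso.refl _ := Subsingleton.elim _ _
  ext i
  have := congrArg (fun e : Fin r ≃o Fin r => ((e i : Fin r) : ℕ)) h1
  simpa using this

/-- Stable sorting puts the places of the first `l` elements in front, in order, and the other
places behind them, so it undoes the shuffle. Formally the composite is a strictly monotone
permutation, hence the identity. -/
theorem rankPerm_shuffleWord {σ : Equiv.Perm (Fin (l + r))} (h : IsShuffle σ) :
    rankPerm (shuffleWord σ) = σ⁻¹ := by
  rw [eq_inv_iff_mul_eq_one]
  refine strictMono_perm fun a b hab => rank_lt_rank _ ?_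
  rw [shuffleWord_apply, shuffleWord_apply]
  have hv : (a : ℕ) < b := hab
  by_cases hb : (b : ℕ) < l
  · rw [if_pos hb, if_pos (hv.trans hb)]
    exact Or.inr ⟨rfl, isShuffle_lt h hab (Or.inl hb)⟩
  · rw [if_neg hb]
    split_ifs with ha
    · exact Or.inl Fin.zero_lt_one
    · exact Or.inr ⟨rfl, isShuffle_lt h hab (Or.inr (not_lt.1 ha))⟩

theorem card_shuffleWord :
    (Finset.univ.filter fun i => shuffleWord σ i = 0).card = l := by
  have h1 : (Finset.univ.filter fun i => shuffleWord σ i = 0).card =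
      (Finset.univ.filter fun a : Fin (l + r) => (a : ℕ) < l).card := by
    refine (Finset.card_equiv σ fun a => ?_).symm
    simp [shuffleWord_apply]
  rw [h1, Fin.card_filter_val_lt]
  omega

variable {c : Fin (l + r) → Fin 2}

theorem rankPerm_lt (hc : (Finset.univ.filter fun i => c i = 0).card = l) (i : Fin (l + r)) : (rankPerm c i : ℕ) < l ↔ c i = 0 := by
  have h1 : (rankPerm c i : ℕ) = rank c i := rfl
  rw [h1, rank]
  constructor
  · intro h
    by_contra h0
    refine absurd (hc.ge.trans (Finset.card_le_card ?_)) (not_le.2 h)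
    intro j
    simp only [Finset.mem_filter, Finset.mem_univ, true_and]
    intro hj
    exact Or.inl (by rw [hj]; exact Fin.pos_iff_ne_zero.2 h0)
  · intro h0
    conv_rhs => rw [← hc]
    refine Finset.card_lt_card ?_
    rw [Finset.ssubset_iff_of_subset]
    · exact ⟨i, by simpa using h0, by simp⟩
    · intro j
      simp only [Finset.mem_filter, Finset.mem_univ, true_and, h0]
      rintro (hj | hj)
      · exact absurd hj (Fin.not_lt_zero _)
      · exact hj.1

theorem shuffleWord_rankPerm (hc : (Finset.univ.filter fun i => c i = 0).card = l) :
    shuffleWord (rankPerm c)⁻¹ = c := by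
  funext i
  rw [shuffleWord, inv_inv, if_congr (rankPerm_lt hc i) rfl rfl]
  split_ifs with h
  · exact h.symm
  · rcases Fin.eq_zero_or_eq_succ (c i) with h1 | ⟨j, h1⟩
    · exact absurd h1 h
    · rw [h1]; fin_cases j; rfl

theorem isShuffle_rankPerm (hc : (Finset.univ.filter fun i => c i = 0).card = l) :
    IsShuffle (rankPerm c)⁻¹ := by
  have key : ∀ a b : Fin (l + r), a < b → ((a : ℕ) < l ↔ (b : ℕ) < l) →
      (rankPerm c)⁻¹ a < (rankPerm c)⁻¹ b := by
    intro a b hab h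
    have h1 : c ((rankPerm c)⁻¹ a) = c ((rankPerm c)⁻¹ b) := by
      have := shuffleWord_apply (rankPerm c)⁻¹ a
      have := shuffleWord_apply (rankPerm c)⁻¹ b
      rw [shuffleWord_rankPerm hc] at *
      simp_all
    by_contra h2
    rcases (not_lt.1 h2).lt_or_eq with h2 | h2
    · have h3 : rankPerm c ((rankPerm c)⁻¹ b) < rankPerm c ((rankPerm c)⁻¹ a) :=
        rank_lt_rank c (Or.inr ⟨h1.symm, h2⟩)
      rw [← Equiv.Perm.mul_apply, ← Equiv.Perm.mul_apply, mul_inv_cancel] at h3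
      exact absurd hab h3.not_gt
    · exact hab.ne' ((rankPerm c)⁻¹.injective h2)
  refine ⟨fun i j hij => key _ _ hij ?_, fun i j hij => key _ _ ?_ ?_⟩
  · simp
  · exact Nat.add_lt_add_left hij l
  · simp

-- Shuffles correspond to the words with `l` letters `0`. The inverse bijection sends a word to the
-- inverse of its sorting permutation, which has the same sign.
open Classical in
theorem sum_isShuffle {M : Type*} [AddCommGroup M] [Module k M] (F : (Fin (l + r) → Fin 2) → M) :
    (∑ σ : Equiv.Perm (Fin (l + r)) with IsShuffle σ,
      ((Equiv.Perm.sign σ : ℤ) : k) • F (shuffleWord σ)) =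
    ∑ c : Fin (l + r) → Fin 2, wordSign (wordOf c) • if (wordOf c).count 0 = l then F c else 0 := by
  have h1 : ∀ c : Fin (l + r) → Fin 2, (wordOf c).count 0 = l ↔
      (Finset.univ.filter fun i => c i = 0).card = l := fun c => by
    rw [count_wordOf]
    simp only [Fin.ext_iff, Fin.val_zero]
  simp only [smul_ite, smul_zero, h1]
  rw [← Finset.sum_filter]
  refine Finset.sum_bij' (fun σ _ => shuffleWord σ) (fun c _ => (rankPerm c)⁻¹) (fun σ hσ => ?_)
    (fun c hc => ?_) (fun σ hσ => ?_) (fun c hc => ?_) (fun σ hσ => ?_)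
  all_goals simp only [Finset.mem_filter, Finset.mem_univ, true_and] at *
  · exact card_shuffleWord σ
  · exact isShuffle_rankPerm hc
  · rw [rankPerm_shuffleWord hσ, inv_inv]
  · exact shuffleWord_rankPerm hc
  · rw [← sign_rankPerm, rankPerm_shuffleWord hσ, Equiv.Perm.sign_inv, Int.cast_smul_eq_zsmul]

theorem insertRegrouping_shuffle_map (σ : Equiv.Perm (Fin (l + r))) :
    (insertRegrouping l 1 (l + r) (shufflePositions σ) (card_shufflePositions σ)).map
      (k := k) (A := A) = cyclicOp k A 1 l 1 (l + r) (periodic (l + 1) (l + r + 1)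
        fun y => ((wordOf (shuffleWord σ)).take y).count 0) := by
  set w := wordOf (shuffleWord σ) with hw
  have hlen : w.length = l + r := wordOf_length _
  have hcount : w.count 0 = l := by
    rw [hw, count_wordOf]
    refine Eq.trans ?_ (card_shuffleWord σ)
    simp only [Fin.ext_iff, Fin.val_zero]
  have hmem : ∀ i : Fin (l + r), ((i.succ, 0) : Idx (l + r) 1) ∈ shufflePositions σ ↔
      shuffleWord σ i = 0 := by
    intro i
    rw [shufflePositions, Finset.mem_insert, Finset.mem_image]
    constructor
    · rintro (h | ⟨a, -, h⟩)
      · exact absurd (congrArg Prod.fst h) (Fin.succ_ne_zero i)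
      · have : σ (Fin.castAdd r a) = i := Fin.succ_injective _ (congrArg Prod.fst h)
        rw [← this, shuffleWord_apply, if_pos (by simp)]
    · intro h
      right
      have h1 : ((σ⁻¹ i : Fin (l + r)) : ℕ) < l := by
        by_contra h2
        rw [shuffleWord, if_neg h2] at h
        exact one_ne_zero h
      exact ⟨⟨_, h1⟩, Finset.mem_univ _, by
        rw [show Fin.castAdd r ⟨_, h1⟩ = σ⁻¹ i from rfl, ← Equiv.Perm.mul_apply, mul_inv_cancel]
        rfl⟩
  have hv : Valid (l + 1) (l + r + 1) fun y => (w.take y).count 0 :=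
    ⟨Nat.succ_pos _, fun i _ => Nat.lt_succ_of_le (hcount ▸ (List.take_sublist i w).count_le 0),
      fun i j hij _ => (List.take_sublist_take_left hij).count_le 0⟩
  have := insertRegrouping_map (k := k) (A := A) (n' := 1) (card_shufflePositions σ)
    (θ := fun y => (w.take y).count 0) (by rwa [one_mul])
    (by simp [shufflePositions]) (by simp) ?_ ?_
  · rwa [one_mul] at this
  · rw [one_mul, Nat.add_sub_cancel, ← hlen, List.take_length, hcount]
  · rintro ⟨i, j⟩ hy
    obtain rfl : j = 0 := Subsingleton.elim _ _
    rcases Fin.eq_zero_or_eq_succ i with rfl | ⟨i, rfl⟩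
    · exact absurd rfl hy
    · rw [if_congr (hmem i) rfl rfl]
      simp only [Fin.val_zero, mul_zero, add_zero, Fin.val_succ, Nat.add_sub_cancel]
      rw [List.take_succ_eq_append_getElem (by rw [hlen]; exact i.isLt), List.count_append,
        List.count_singleton]
      have h3 : w[(i : ℕ)]'(by rw [hlen]; exact i.isLt) = shuffleWord σ i := by simp [hw, wordOf]
      rw [h3]
      simp only [beq_iff_eq, Fin.ext_iff, Fin.val_zero]

open Classical in
theorem shuffleOnes_eq (l r : ℕ) :
    shuffleOnes k A l r = chainLin ((chainOps k A).shuffle (l + 1) (l + r) l id) := by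
  have h1 : shuffleOnes k A l r = ∑ σ : Equiv.Perm (Fin (l + r)) with IsShuffle σ,
      ((Equiv.Perm.sign σ : ℤ) : k) • cyclicOp k A 1 l 1 (l + r) (periodic (l + 1) (l + r + 1)
        fun y => ((wordOf (shuffleWord σ)).take y).count 0) := by
    refine Finset.sum_congr rfl fun σ _ => ?_
    rw [insertRegrouping_shuffle_map]
  rw [h1, sum_isShuffle fun c => cyclicOp k A 1 l 1 (l + r) (periodic (l + 1) (l + r + 1)
    fun y => ((wordOf c).take y).count 0), SimplicialOps.shuffle, sum_words_eq_sum_wordOf,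
    chainLin_sum]
  refine Finset.sum_congr rfl fun c _ => ?_
  rw [chainLin_zsmul]
  split_ifs <;> rfl

end shuffles

end insert

/-- It joins the two stages of `totalPsi`: the wrapping restricts to a path, and the shuffle with
identities is then taken along that path. -/
theorem SimplicialOps.op_shuffle {C : Type u} [Category.{v} C] [Preadditive C] (X : SimplicialOps C)
    {N N' M l : ℕ} {θ : ℕ → ℕ} (h : Valid N N' θ) (hl : l < N') :
    X.op N N' θ ≫ X.shuffle N' M l id = X.shuffle N M l θ := by
  rw [shuffle, Preadditive.comp_sum, shuffle]
  refine Finset.sum_congr rfl fun κ _ => ?_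
  rw [Preadditive.comp_zsmul]
  congr 1
  split_ifs with hκ
  · have hle : ∀ y, (κ.take y).count 0 ≤ l := fun y => hκ ▸ (List.take_sublist y κ).count_le 0
    exact X.op_comp h ⟨Nat.succ_pos M, fun i _ => (hle i).trans_lt hl,
      fun i j hij _ => (List.take_sublist_take_left hij).count_le 0⟩
  · exact Limits.comp_zero

theorem toModule_comp_lof {k : Type w} [Field k] {A : Type u} [Category.{v} A]
    [Preadditive A] [Linear k A] {n : ℕ} [NeZero n] {N : Type*} [AddCommGroup N] [Module k N]
    (φ : ∀ m, Chain k A n m →ₗ[k] N) (m : ℕ) :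
    DirectSum.toModule k ℕ N φ ∘ₗ DirectSum.lof k ℕ (fun m => Chain k A n m) m = φ m :=
  LinearMap.ext fun x => by
    rw [LinearMap.comp_apply, DirectSum.toModule_lof]

/-! ### The components of the homotopy and of the two maps. -/

section components

variable {k : Type w} [Field k] {A : Type u} [Category.{v} A] [Preadditive A] [Linear k A]
  [DGCategory k A]

/-- In `totalPsi` the number of rows has the form `M + 1 - (p + q) + (p + q)`, which is `M + 1` only
by a computation; inside the total space it can be replaced. -/
theorem lof_shuffle {N R R' l : ℕ} (θ : ℕ → ℕ) (h : R = R') :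
    DirectSum.lof k ℕ (fun m => Chain k A 1 m) R ∘ₗ chainLin ((chainOps k A).shuffle N R l θ) =
      DirectSum.lof k ℕ (fun m => Chain k A 1 m) R' ∘ₗ
        chainLin ((chainOps k A).shuffle N R' l θ) := by
  subst h; rfl

theorem lof_shuffleOnes_wrap {M p q : ℕ} (hp : 1 ≤ p + 1) (hpq : p + 1 + q ≤ M + 1) :
    DirectSum.lof k ℕ (fun m => Chain k A 1 m) (M + 1 - (p + 1 + q) + (p + 1 + q)) ∘ₗ
        shuffleOnes k A (M + 1 - (p + 1 + q)) (p + 1 + q) ∘ₗ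
        (wrapRegrouping M (p + 1) q hp hpq).map =
      DirectSum.lof k ℕ (fun m => Chain k A 1 m) (M + 1) ∘ₗ
        chainLin ((chainOps k A).shuffle (M + 1) (M + 1) (M - p - q) (p + ·)) := by
  have h1 : M + 1 - (p + 1 + q) = M - p - q := by omega
  rw [← lof_shuffle _ (Nat.sub_add_cancel hpq), wrapRegrouping_map, shuffleOnes_eq, ← h1,
    ← (chainOps k A).op_shuffle (SimplicialOps.valid_add (by omega)) (Nat.lt_succ_self _)]
  rfl

theorem totalPsi_lof {n : ℕ} (M : ℕ) :
    totalPsi k A n ∘ₗ DirectSum.lof k ℕ (fun m => Chain k A 1 m) M =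
      DirectSum.lof k ℕ (fun m => Chain k A 1 m) (M + 1) ∘ₗ
        ((n : k)⁻¹ • chainLin ((chainOps k A).psi n (M + 1))) := by
  have h0 : totalPsi k A n ∘ₗ DirectSum.lof k ℕ (fun m => Chain k A 1 m) M =
    ((-1) ^ (M + 1) : k) • ∑ p ∈ Finset.range (M + 2), ∑ q ∈ Finset.range (M + 2),
      if h : 1 ≤ p ∧ p + q ≤ M + 1 ∧ Even (p + q) then
        coeffT k p q (M + 1) n •
          (DirectSum.lof k ℕ (fun m => Chain k A 1 m) (M + 1 - (p + q) + (p + q)) ∘ₗ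
            shuffleOnes k A (M + 1 - (p + q)) (p + q) ∘ₗ
            (wrapRegrouping M p q h.1 h.2.1).map)
      else 0 := toModule_comp_lof _ M
  rw [h0, SimplicialOps.psi, chainLin_zsmul, chainLin_sum, ← Int.cast_smul_eq_zsmul k,
    LinearMap.comp_smul, LinearMap.comp_smul, smul_comm, comp_finsetSum]
  push_cast
  congr 1
  -- The term `p = 0` is absent. Shifting `p` by one turns the condition that the sum of the indices
  -- is even into oddness.
  rw [Finset.sum_range_succ', Finset.sum_eq_zero (s := Finset.range (M + 2)) (f := fun q => _)
    (fun q _ => dif_neg (by omega)), add_zero, Finset.smul_sum]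
  refine Finset.sum_congr rfl fun p _ => ?_
  rw [Finset.sum_range_succ, dif_neg (by omega), add_zero, chainLin_sum, comp_finsetSum,
    Finset.smul_sum]
  refine Finset.sum_congr rfl fun q _ => ?_
  by_cases h : p + q < M + 1 ∧ Odd (p + q)
  · have h' : 1 ≤ p + 1 ∧ p + 1 + q ≤ M + 1 ∧ Even (p + 1 + q) := by
      refine ⟨by omega, by omega, ?_⟩
      rw [Nat.add_right_comm]; exact h.2.add_one
    rw [dif_pos h', if_pos h, coeffT_eq, lof_shuffleOnes_wrap, chainLin_zsmul, mul_smul,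
      ← Int.cast_smul_eq_zsmul k, LinearMap.comp_smul]
  · have h' : ¬ (1 ≤ p + 1 ∧ p + 1 + q ≤ M + 1 ∧ Even (p + 1 + q)) := by
      rintro ⟨-, h1, h2⟩
      refine h ⟨by omega, ?_⟩
      rw [Nat.add_right_comm] at h2
      exact Nat.not_even_iff_odd.1 fun h3 => Nat.not_even_iff_odd.2 h3.add_one h2
    rw [dif_neg h', if_neg h]
    have h3 : chainLin (0 : (chainOps k A).V (M + 1) ⟶ (chainOps k A).V (M + 1 + 1)) = 0 := rfl
    rw [h3, LinearMap.comp_zero, smul_zero]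

/-! ### The identities in each degree -/

variable {n : ℕ} [NeZero n] (m : ℕ)

theorem hochschildDiff_internalDiff : hochschildDiff k A n m ∘ₗ internalDiff k n (m + 1) =
    internalDiff k n m ∘ₗ hochschildDiff k A n m := by
  rw [← conjugate_blockBoundary, conjugate_internalDiff]

/-- The boundary of the subdivision is the ordinary boundary of another simplicial object. -/
theorem hochschildDiff_hochschildDiff :
    hochschildDiff k A n m ∘ₗ hochschildDiff k A n (m + 1) = 0 := by
  have hn : 0 < n := Nat.pos_of_ne_zero (NeZero.ne n)
  have h := ((chainOps k A).subdivision n hn).boundary_boundary (Nat.succ_pos m)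
  have h' : (chainOps k A).blockBoundary n (m + 1 + 1) ≫ (chainOps k A).blockBoundary n (m + 1) = 0 := h
  rw [← conjugate_blockBoundary, ← conjugate_blockBoundary, ← conjugate_comp, h']
  exact map_zero (AddMonoidHom.mk' (conjugate k A n (m := m + 1 + 1) (m' := m)) (conjugate_add k A n))

theorem hochschildDiff_degree (e : ℤ) :
    (Chain.degree k A n (m + 1) e).map (hochschildDiff k A n m) ≤ Chain.degree k A n m e := by
  rw [← conjugate_blockBoundary]
  exact conjugate_degree k A n _ e

theorem mapF_eq : mapF k A n m = (n : k)⁻¹ • ∑ s ∈ Finset.range n,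
    chainLin ((chainOps k A).column n (m + 1) s) ∘ₗ unfold k A n m := by
  rw [mapF, Finset.sum_range]
  congr 1
  exact Finset.sum_congr rfl fun s _ => (chainLin_column k A n m s).symm

theorem mapF_hochschildDiff :
    mapF k A n m ∘ₗ hochschildDiff k A n m = hochschildDiff k A 1 m ∘ₗ mapF k A n (m + 1) := by
  rw [mapF_eq, mapF_eq, LinearMap.smul_comp, LinearMap.comp_smul, finsetSum_comp, comp_finsetSum]
  congr 1
  refine Finset.sum_congr rfl fun s hs => ?_
  have h := congrArg chainLin ((chainOps k A).blockBoundary_column (Nat.succ_pos m)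
    (Finset.mem_range.1 hs))
  rw [chainLin_comp, chainLin_comp, chainLin_boundary] at h
  rw [← conjugate_blockBoundary, conjugate]
  -- Unrolling after folding is the identity, so the two conjugations between the column and the
  -- boundary cancel.
  calc _ = chainLin ((chainOps k A).column n (m + 1) s) ∘ₗ (unfold k A n m ∘ₗ fold k A n m) ∘ₗ
        chainLin ((chainOps k A).blockBoundary n (m + 1)) ∘ₗ unfold k A n (m + 1) := rfl
    _ = (chainLin ((chainOps k A).column n (m + 1) s) ∘ₗ
        chainLin ((chainOps k A).blockBoundary n (m + 1))) ∘ₗ unfold k A n (m + 1) := by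
          rw [unfold_fold]; rfl
    _ = _ := by rw [h]; rfl

theorem mapG_hochschildDiff :
    mapG k A n m ∘ₗ hochschildDiff k A 1 m = hochschildDiff k A n m ∘ₗ mapG k A n (m + 1) := by
  have hn : 0 < n := Nat.pos_of_ne_zero (NeZero.ne n)
  have h := congrArg chainLin ((chainOps k A).subdivide_boundary n m hn)
  rw [chainLin_comp, chainLin_comp, chainLin_boundary] at h
  rw [mapG_eq, mapG_eq, ← conjugate_blockBoundary k A n m, conjugate, LinearMap.comp_assoc]
  calc _ = fold k A n m ∘ₗ (chainLin ((chainOps k A).blockBoundary n (m + 1)) ∘ₗ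
        chainLin ((chainOps k A).subdivide n (m + 1))) := by rw [h]
    _ = fold k A n m ∘ₗ chainLin ((chainOps k A).blockBoundary n (m + 1)) ∘ₗ LinearMap.id ∘ₗ
        chainLin ((chainOps k A).subdivide n (m + 1)) := rfl
    _ = _ := by rw [← unfold_fold]; rfl

theorem mapF_internalDiff :
    mapF k A n m ∘ₗ internalDiff k n m = internalDiff k 1 m ∘ₗ mapF k A n m := by
  rw [mapF, LinearMap.smul_comp, LinearMap.comp_smul, finsetSum_comp, comp_finsetSum]
  congr 1
  exact Finset.sum_congr rfl fun s _ => Regrouping.map_internalDiff _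

theorem mapG_internalDiff :
    mapG k A n m ∘ₗ internalDiff k 1 m = internalDiff k n m ∘ₗ mapG k A n m := by
  rw [mapG, finsetSum_comp, comp_finsetSum]
  refine Finset.sum_congr rfl fun s _ => ?_
  rw [LinearMap.smul_comp, LinearMap.comp_smul, Regrouping.map_internalDiff]

theorem mapF_degree (e : ℤ) :
    (Chain.degree k A n m e).map (mapF k A n m) ≤ Chain.degree k A 1 m e := by
  rintro _ ⟨x, hx, rfl⟩
  rw [mapF, LinearMap.smul_apply, LinearMap.sum_apply]
  exact Submodule.smul_mem _ _ (Submodule.sum_mem _ fun s _ =>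
    Regrouping.map_degree _ e ⟨x, hx, rfl⟩)

theorem mapG_degree (e : ℤ) :
    (Chain.degree k A 1 m e).map (mapG k A n m) ≤ Chain.degree k A n m e := by
  rintro _ ⟨x, hx, rfl⟩
  rw [mapG, LinearMap.sum_apply]
  exact Submodule.sum_mem _ fun s _ => Submodule.smul_mem _ _
    (Regrouping.map_degree _ e ⟨x, hx, rfl⟩)

theorem chainLin_column_comp (s : ℕ) : (chainLin ((chainOps k A).column n (m + 1) s) ∘ₗ
    unfold k A n m) ∘ₗ mapG k A n m = chainLin ((chainOps k A).subdivide n m ≫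
      (chainOps k A).column n (m + 1) s) := by
  rw [mapG_eq, chainLin_comp]
  calc _ = chainLin ((chainOps k A).column n (m + 1) s) ∘ₗ (unfold k A n m ∘ₗ fold k A n m) ∘ₗ
        chainLin ((chainOps k A).subdivide n m) := rfl
    _ = _ := by rw [unfold_fold]; rfl

theorem mapF_mapG (hn : (n : k) ≠ 0) : mapF k A n m ∘ₗ mapG k A n m - LinearMap.id =
    (n : k)⁻¹ • chainLin (∑ s ∈ Finset.range n, (chainOps k A).subdivide n m ≫
      (chainOps k A).column n (m + 1) s - (n : ℤ) • 𝟙 ((chainOps k A).V (m + 1))) := by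
  rw [mapF_eq, LinearMap.smul_comp, finsetSum_comp, chainLin_sub, chainLin_sum, smul_sub,
    chainLin_zsmul, chainLin_id, ← Int.cast_smul_eq_zsmul k, Int.cast_natCast, smul_smul,
    inv_mul_cancel₀ hn, one_smul]
  congr 2
  exact Finset.sum_congr rfl fun s _ => chainLin_column_comp m s

theorem mapG_mapF (hn : (n : k) ≠ 0) : mapG k A n m ∘ₗ mapF k A n m - LinearMap.id =
    (n : k)⁻¹ • conjugate k A n (∑ s ∈ Finset.range n, (chainOps k A).column n (m + 1) s ≫
      (chainOps k A).subdivide n m - (n : ℤ) • 𝟙 ((chainOps k A).V (n * (m + 1)))) := by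
  rw [mapF_eq, LinearMap.comp_smul, comp_finsetSum, sub_eq_add_neg _ ((n : ℤ) • _), ← neg_smul,
    conjugate_add, conjugate_sum, smul_add,
    conjugate_zsmul, conjugate_id, ← Int.cast_smul_eq_zsmul k, Int.cast_neg, Int.cast_natCast,
    smul_smul, mul_neg, inv_mul_cancel₀ hn, neg_one_smul, sub_eq_add_neg]
  congr 2
  refine Finset.sum_congr rfl fun s _ => ?_
  rw [mapG_eq, conjugate, chainLin_comp]; rfl

end components

/-! ### Maps of the total spaces -/

section

variable {k : Type w} [Field k] {A : Type u} [Category.{v} A] [Preadditive A] [Linear k A]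
  {n n' n'' : ℕ} [NeZero n] [NeZero n'] [NeZero n'']

theorem Tot.hom_ext {N : Type*} [AddCommGroup N] [Module k N] {f g : Tot k A n →ₗ[k] N}
    (h : ∀ m, f ∘ₗ DirectSum.lof k ℕ (fun m => Chain k A n m) m =
      g ∘ₗ DirectSum.lof k ℕ (fun m => Chain k A n m) m) : f = g :=
  DirectSum.linearMap_ext k h

variable (k A n) in
/-- The inclusion of the chains with `m + 1` rows. -/
noncomputable abbrev lofTot (m : ℕ) : Chain k A n m →ₗ[k] Tot k A n :=
  DirectSum.lof k ℕ (fun m => Chain k A n m) m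

/-- The map of total spaces with the components `f m`. -/
noncomputable def totMap (f : ∀ m, Chain k A n m →ₗ[k] Chain k A n' m) :
    Tot k A n →ₗ[k] Tot k A n' :=
  DirectSum.toModule k ℕ _ fun m => lofTot k A n' m ∘ₗ f m

/-- The map of total spaces with the components `f m`, which raise the number of rows by one. -/
noncomputable def totRaise (f : ∀ m, Chain k A n m →ₗ[k] Chain k A n' (m + 1)) :
    Tot k A n →ₗ[k] Tot k A n' :=
  DirectSum.toModule k ℕ _ fun m => lofTot k A n' (m + 1) ∘ₗ f m

theorem totMap_lof (f : ∀ m, Chain k A n m →ₗ[k] Chain k A n' m) (m : ℕ) :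
    totMap f ∘ₗ lofTot k A n m = lofTot k A n' m ∘ₗ f m := toModule_comp_lof _ m

theorem totRaise_lof (f : ∀ m, Chain k A n m →ₗ[k] Chain k A n' (m + 1)) (m : ℕ) :
    totRaise f ∘ₗ lofTot k A n m = lofTot k A n' (m + 1) ∘ₗ f m := toModule_comp_lof _ m

theorem totMap_comp (g : ∀ m, Chain k A n' m →ₗ[k] Chain k A n'' m)
    (f : ∀ m, Chain k A n m →ₗ[k] Chain k A n' m) :
    totMap g ∘ₗ totMap f = totMap fun m => g m ∘ₗ f m := by
  refine Tot.hom_ext fun m => ?_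
  rw [LinearMap.comp_assoc, totMap_lof, ← LinearMap.comp_assoc, totMap_lof, totMap_lof,
    LinearMap.comp_assoc]

theorem totMap_id : totMap (fun m => (LinearMap.id : Chain k A n m →ₗ[k] Chain k A n m)) =
    LinearMap.id :=
  Tot.hom_ext fun m => by rw [totMap_lof]; rfl

theorem totMap_sub (f g : ∀ m, Chain k A n m →ₗ[k] Chain k A n' m) :
    (totMap fun m => f m - g m) = totMap f - totMap g :=
  Tot.hom_ext fun m => by
    rw [totMap_lof, LinearMap.comp_sub, LinearMap.sub_comp, totMap_lof, totMap_lof]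

end

section totals

variable {k : Type w} [Field k] {A : Type u} [Category.{v} A] [Preadditive A] [Linear k A]
  [DGCategory k A] {n n' : ℕ} [NeZero n] [NeZero n']

theorem totalDiff_lof_zero : totalDiff k A n ∘ₗ lofTot k A n 0 =
    lofTot k A n 0 ∘ₗ internalDiff k n 0 := by
  rw [totalDiff, LinearMap.add_comp, toModule_comp_lof, toModule_comp_lof]
  simp

theorem totalDiff_lof_succ (m : ℕ) : totalDiff k A n ∘ₗ lofTot k A n (m + 1) =
    lofTot k A n m ∘ₗ hochschildDiff k A n m +
      (-1 : k) ^ (m + 1) • lofTot k A n (m + 1) ∘ₗ internalDiff k n (m + 1) := by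
  rw [totalDiff, LinearMap.add_comp, toModule_comp_lof, toModule_comp_lof, LinearMap.comp_smul]

theorem totMap_totalDiff {f : ∀ m, Chain k A n m →ₗ[k] Chain k A n' m}
    (hb : ∀ m, f m ∘ₗ hochschildDiff k A n m = hochschildDiff k A n' m ∘ₗ f (m + 1))
    (hd : ∀ m, f m ∘ₗ internalDiff k n m = internalDiff k n' m ∘ₗ f m) :
    totMap f ∘ₗ totalDiff k A n = totalDiff k A n' ∘ₗ totMap f := by
  refine Tot.hom_ext fun m => ?_
  rw [LinearMap.comp_assoc, LinearMap.comp_assoc, totMap_lof]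
  rcases m with _ | m
  · rw [totalDiff_lof_zero, ← LinearMap.comp_assoc, totMap_lof, ← LinearMap.comp_assoc,
      totalDiff_lof_zero, LinearMap.comp_assoc, LinearMap.comp_assoc, hd]
  · rw [totalDiff_lof_succ, LinearMap.comp_add, LinearMap.comp_smul, ← LinearMap.comp_assoc,
      ← LinearMap.comp_assoc, totMap_lof, totMap_lof, ← LinearMap.comp_assoc, totalDiff_lof_succ,
      LinearMap.add_comp, LinearMap.smul_comp, LinearMap.comp_assoc, LinearMap.comp_assoc,
      LinearMap.comp_assoc, LinearMap.comp_assoc, hd, hb]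

theorem neg_one_pow_smul_add {M N : Type*} [AddCommGroup M] [Module k M] [AddCommGroup N]
    [Module k N] (X : M →ₗ[k] N) (j : ℕ) : (-1 : k) ^ (j + 1) • X + (-1 : k) ^ j • X = 0 := by
  rw [← add_smul, pow_succ]; simp

/-- A map that adds a row and commutes with the internal differential anticommutes with its signed
version, because the sign `(-1)^m` changes with the row number. So a homotopy for the Hochschild
differentials is one for the total differentials. Chains with one row are separate, since the
Hochschild differential vanishes on them. -/
theorem totRaise_totalDiff {f : ∀ m, Chain k A n m →ₗ[k] Chain k A n (m + 1)}
    {E : ∀ m, Chain k A n m →ₗ[k] Chain k A n m}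
    (hd : ∀ m, f m ∘ₗ internalDiff k n m = internalDiff k n (m + 1) ∘ₗ f m)
    (h0 : hochschildDiff k A n 0 ∘ₗ f 0 = E 0)
    (hb : ∀ m, hochschildDiff k A n (m + 1) ∘ₗ f (m + 1) + f m ∘ₗ hochschildDiff k A n m =
      E (m + 1)) :
    totalDiff k A n ∘ₗ totRaise f + totRaise f ∘ₗ totalDiff k A n = totMap E := by
  refine Tot.hom_ext fun m => ?_
  rw [LinearMap.add_comp, LinearMap.comp_assoc, LinearMap.comp_assoc, totRaise_lof, totMap_lof,
    ← LinearMap.comp_assoc, totalDiff_lof_succ, LinearMap.add_comp, LinearMap.smul_comp,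
    LinearMap.comp_assoc, LinearMap.comp_assoc]
  rcases m with _ | m
  · rw [totalDiff_lof_zero, ← LinearMap.comp_assoc (internalDiff k n 0), totRaise_lof, LinearMap.comp_assoc, h0, hd]
    have hs := neg_one_pow_smul_add (lofTot k A n 1 ∘ₗ internalDiff k n 1 ∘ₗ f 0) 0
    rw [pow_zero, one_smul] at hs
    rw [add_assoc, hs, add_zero]
  · rw [totalDiff_lof_succ, LinearMap.comp_add, LinearMap.comp_smul,
      ← LinearMap.comp_assoc (hochschildDiff k A n m),
      ← LinearMap.comp_assoc (internalDiff k n (m + 1)) _ (totRaise f), totRaise_lof, totRaise_lof,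
      LinearMap.comp_assoc, LinearMap.comp_assoc, hd, ← hb, LinearMap.comp_add,
      add_add_add_comm, neg_one_pow_smul_add, add_zero]

/-- Each of the two differentials squares to zero, and they commute; the sign `(-1)^m` makes the
mixed terms cancel. -/
theorem totalDiff_totalDiff : totalDiff k A n ∘ₗ totalDiff k A n = 0 := by
  refine Tot.hom_ext fun m => ?_
  rw [LinearMap.comp_assoc, LinearMap.zero_comp]
  rcases m with _ | m
  · rw [totalDiff_lof_zero, ← LinearMap.comp_assoc, totalDiff_lof_zero, LinearMap.comp_assoc,
      internalDiff_internalDiff, LinearMap.comp_zero]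
  · rw [totalDiff_lof_succ, LinearMap.comp_add, LinearMap.comp_smul,
      ← LinearMap.comp_assoc (internalDiff k n (m + 1)), totalDiff_lof_succ, LinearMap.add_comp,
      LinearMap.smul_comp, LinearMap.comp_assoc, LinearMap.comp_assoc, internalDiff_internalDiff,
      LinearMap.comp_zero, smul_zero, add_zero, hochschildDiff_internalDiff,
      ← LinearMap.comp_assoc (hochschildDiff k A n m)]
    rcases m with _ | m
    · have hs := neg_one_pow_smul_add
        (lofTot k A n 0 ∘ₗ internalDiff k n 0 ∘ₗ hochschildDiff k A n 0) 0
      rw [pow_zero, one_smul] at hs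
      rw [totalDiff_lof_zero, LinearMap.comp_assoc]
      exact (add_comm _ _).trans hs
    · rw [totalDiff_lof_succ, LinearMap.add_comp, LinearMap.smul_comp, LinearMap.comp_assoc,
        LinearMap.comp_assoc, hochschildDiff_hochschildDiff, LinearMap.comp_zero, zero_add,
        ← add_smul, pow_succ (-1 : k) (m + 1)]
      simp

/-! ### Degrees -/

theorem lof_mem_degreePart {m : ℕ} {e : ℤ} {x : Chain k A n m}
    (hx : x ∈ Chain.degree k A n m (e + m)) : lofTot k A n m x ∈ degreePart k A n e := by
  have h : (Chain.degree k A n m (e + m)).map (lofTot k A n m) ≤ degreePart k A n e :=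
    Chain.map_degree_le fun a α δ hδ he =>
      Submodule.subset_span ⟨m, a, α, δ, hδ, by rw [he]; ring, rfl⟩
  exact h ⟨x, hx, rfl⟩

theorem degreePart_map_le {M : Type*} [AddCommGroup M] [Module k M] {f : Tot k A n →ₗ[k] M}
    {S : Submodule k M} {e : ℤ}
    (h : ∀ m, ∀ x ∈ Chain.degree k A n m (e + m), f (lofTot k A n m x) ∈ S) :
    (degreePart k A n e).map f ≤ S := by
  rw [Submodule.map_le_iff_le_comap, degreePart, Submodule.span_le]
  rintro _ ⟨m, a, α, δ, hδ, he, rfl⟩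
  exact h m _ (Submodule.subset_span ⟨a, α, δ, hδ, by omega, rfl⟩)

theorem totMap_degree {f : ∀ m, Chain k A n m →ₗ[k] Chain k A n' m}
    (h : ∀ m e, (Chain.degree k A n m e).map (f m) ≤ Chain.degree k A n' m e) (e : ℤ) :
    (degreePart k A n e).map (totMap f) ≤ degreePart k A n' e :=
  degreePart_map_le fun m x hx => by
    rw [← LinearMap.comp_apply, totMap_lof]
    exact lof_mem_degreePart (h m _ ⟨x, hx, rfl⟩)

/-- An additional row lowers the total degree by one, while the degrees of the morphisms are kept.
-/
theorem totRaise_degree {f : ∀ m, Chain k A n m →ₗ[k] Chain k A n' (m + 1)}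
    (h : ∀ m e, (Chain.degree k A n m e).map (f m) ≤ Chain.degree k A n' (m + 1) e) (e : ℤ) :
    (degreePart k A n e).map (totRaise f) ≤ degreePart k A n' (e - 1) :=
  degreePart_map_le fun m x hx => by
    rw [← LinearMap.comp_apply, totRaise_lof]
    refine lof_mem_degreePart (h m _ ⟨x, ?_, rfl⟩)
    rwa [show e - 1 + ((m + 1 : ℕ) : ℤ) = e + m by push_cast; ring]

theorem totalDiff_degree (e : ℤ) :
    (degreePart k A n e).map (totalDiff k A n) ≤ degreePart k A n (e + 1) :=
  degreePart_map_le fun m x hx => by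
    have hd := internalDiff_degree (k := k) (A := A) (n := n) (m := m) (e + m) ⟨x, hx, rfl⟩
    rw [add_right_comm] at hd
    rw [← LinearMap.comp_apply]
    rcases m with _ | m
    · rw [totalDiff_lof_zero]
      exact lof_mem_degreePart hd
    · rw [totalDiff_lof_succ]
      refine Submodule.add_mem _ (lof_mem_degreePart (hochschildDiff_degree m _ ⟨x, ?_, rfl⟩))
        (Submodule.smul_mem _ _ (lof_mem_degreePart hd))
      rwa [show e + 1 + (m : ℤ) = e + ((m + 1 : ℕ) : ℤ) by push_cast; ring]

end totals

theorem isLift_rotate_mul (n i m : ℕ) :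
    IsLift (n * (m + 1)) (n * (m + 1)) (fun y => y - ((m : ℤ) + 1) * i) :=
  ⟨fun _ _ h => by simpa using h, fun y => by ring⟩

theorem totalPsi_eq {k : Type w} [Field k] {A : Type u} [Category.{v} A] [Preadditive A]
    [Linear k A] [DGCategory k A] (n : ℕ) : totalPsi k A n =
    totRaise fun m => (n : k)⁻¹ • chainLin ((chainOps k A).psi n (m + 1)) :=
  Tot.hom_ext fun m => by rw [totalPsi_lof, totRaise_lof]

theorem smul_degree {k : Type w} [Field k] {A : Type u} [Category.{v} A] [Preadditive A]
    [Linear k A] [DGCategory k A] {n n' m m' : ℕ} [NeZero n] [NeZero n'] {f : Chain k A n m →ₗ[k] Chain k A n' m'} (c : k)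
    {e : ℤ} (h : (Chain.degree k A n m e).map f ≤ Chain.degree k A n' m' e) :
    (Chain.degree k A n m e).map (c • f) ≤ Chain.degree k A n' m' e := by
  rintro _ ⟨x, hx, rfl⟩
  exact Submodule.smul_mem _ c (h ⟨x, hx, rfl⟩)

theorem totalPsi_degree {k : Type w} [Field k] {A : Type u} [Category.{v} A] [Preadditive A]
    [Linear k A] [DGCategory k A] (n : ℕ) (e : ℤ) :
    (degreePart k A 1 e).map (totalPsi k A n) ≤ degreePart k A 1 (e - 1) := by
  rw [totalPsi_eq]
  exact totRaise_degree (fun _ _ => smul_degree _ (chainLin_degree _ _)) e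

section rotations

variable {k : Type w} [Field k] {A : Type u} [Category.{v} A] [Preadditive A] [Linear k A]
  [DGCategory k A] {n : ℕ} [NeZero n]

/-! ### The cyclic action -/

variable (k A n) in
/-- The cyclic permutation of the columns by `i` places. -/
noncomputable def rotate (i m : ℕ) : Chain k A n m →ₗ[k] Chain k A n m :=
  cyclicOp k A n m n m fun y => y - ((m : ℤ) + 1) * i

theorem rotation_eq : rotation k A n = totMap (rotate k A n 1) := by
  refine Tot.hom_ext fun m => ?_
  rw [totMap_lof, rotation, toModule_comp_lof, rotateRegrouping_map, rotate]
  simp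

theorem rotate_zero : totMap (rotate k A n 0) = LinearMap.id := by
  rw [← totMap_id]
  congr 1
  funext m
  rw [rotate, ← cyclicOp_id]
  congr 1
  funext y; simp

theorem rotate_comp (i j m : ℕ) : rotate k A n j m ∘ₗ rotate k A n i m = rotate k A n (i + j) m := by
  rw [rotate, rotate, rotate, cyclicOp_comp (isLift_rotate_mul n i m) (isLift_rotate_mul n j m)]
  congr 1
  funext y; simp only [Function.comp]; push_cast; ring

theorem rotate_all (m : ℕ) : rotate k A n n m = LinearMap.id := by
  rw [rotate, ← cyclicOp_id, ← cyclicOp_add (isLift_id _) (-1)]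
  congr 1
  funext y; simp only [id]; push_cast; ring

theorem rotation_iterate (i : ℕ) :
    (rotation k A n : Module.End k (Tot k A n)) ^ i = totMap (rotate k A n i) := by
  induction i with
  | zero => rw [pow_zero, rotate_zero]; rfl
  | succ i ih =>
    rw [pow_succ, ih, rotation_eq]
    refine (totMap_comp _ _).trans ?_
    congr 1
    funext m
    rw [rotate_comp, Nat.add_comm]

theorem rotation_pow : (rotation k A n : Module.End k (Tot k A n)) ^ n = 1 := by
  rw [rotation_iterate]
  refine Eq.trans ?_ totMap_id
  congr 1
  funext m; exact rotate_all m

/-- A rotation is a translation by whole columns, and the lift of a face carries such translations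
to translations by as many columns of the other length. -/
theorem rotate_hochschildDiff (i m : ℕ) : rotate k A n i m ∘ₗ hochschildDiff k A n m =
    hochschildDiff k A n m ∘ₗ rotate k A n i (m + 1) := by
  rw [hochschildDiff_eq, comp_finsetSum, finsetSum_comp]
  refine Finset.sum_congr rfl fun j _ => ?_
  have hl := (valid_coface (Nat.succ_pos m) j).isLift
  rw [LinearMap.comp_smul, LinearMap.smul_comp, blockOp, rotate, rotate,
    cyclicOp_comp (hl.mul n) (isLift_rotate_mul n i m),
    cyclicOp_comp (isLift_rotate_mul n i (m + 1)) (hl.mul n)]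
  congr 2
  funext y
  have := hl.add_mul y (-i)
  simp only [Function.comp]
  push_cast at this ⊢
  rw [show y - ((m : ℤ) + 1) * i = y + (m + 1) * -i by ring, this]
  ring

theorem rotate_internalDiff (i m : ℕ) : rotate k A n i m ∘ₗ internalDiff k n m =
    internalDiff k n m ∘ₗ rotate k A n i m := cyclicOp_internalDiff _

/-- After a rotation the projection to the column `s + 1` becomes the one to the column `s`, so the
sum over all columns is unchanged. -/
theorem mapF_rotate (m : ℕ) : mapF k A n m ∘ₗ rotate k A n 1 m = mapF k A n m := by
  have hn : 0 < n := Nat.pos_of_ne_zero (NeZero.ne n)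
  have hl := fun s : Fin n => (valid_inBlock (Nat.succ_pos m) s.isLt).isLift
  have h1 : ∀ s : Fin n, (columnRegrouping n m (s + 1)).map (k := k) (A := A) ∘ₗ rotate k A n 1 m =
      (columnRegrouping n m s).map := by
    intro s
    rw [columnRegrouping_map, columnRegrouping_map, rotate,
      cyclicOp_comp (isLift_rotate_mul n 1 m) (by rw [one_mul]; exact hl (s + 1))]
    -- For the last `s` the index `s + 1` wraps around to `0`, and the two lifts then differ by one
    -- full turn.
    refine Eq.trans ?_ (cyclicOp_add (by rw [one_mul]; exact hl s) (-(((s : ℕ) + 1) / n : ℕ)))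
    congr 1
    funext y
    obtain ⟨r, q, hr, rfl⟩ := exists_eq_add_mul (m + 1) (Nat.succ_pos m) y
    rw [Function.comp, periodic_apply _ _ hr, periodic_apply _ _ hr]
    have h2 : ((s + 1 : Fin n) : ℕ) = ((s : ℕ) + 1) % n := by
      rw [Fin.val_add, Fin.val_one', Nat.add_mod_mod]
    have h3 := Nat.mod_add_div ((s : ℕ) + 1) n
    rw [← h2] at h3
    zify at h3
    simp only [inBlock]
    push_cast
    linear_combination ((m : ℤ) + 1) * h3
  rw [mapF, LinearMap.smul_comp, finsetSum_comp, ← Equiv.sum_comp (Equiv.addRight (1 : Fin n))]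
  congr 1
  exact Finset.sum_congr rfl fun s _ => h1 s

/-! ### The averaging operator and the homotopies -/

variable (k A n) in
/-- The average over the cyclic group. -/
noncomputable def average : Tot k A n →ₗ[k] Tot k A n :=
  (n : k)⁻¹ • ∑ i ∈ Finset.range n, totMap (rotate k A n i)

/-- The product `(1 + t + ⋯ + t^{n-1})(t - 1) = t^n - 1` vanishes. -/
theorem average_rotation_sub : average k A n ∘ₗ (rotation k A n - LinearMap.id) = 0 := by
  have h := geom_sum_mul (rotation k A n : Module.End k (Tot k A n)) n
  rw [rotation_pow, sub_self, Finset.sum_congr rfl fun i _ => rotation_iterate i] at h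
  rw [average, LinearMap.smul_comp]
  exact (congrArg _ h).trans (smul_zero _)

/-- All `n` rotated copies of the argument have the same image, and division by `n` restores it.
Here the invertibility of `n` is needed. -/
theorem comp_average (hn : (n : k) ≠ 0) {N : Type*} [AddCommGroup N] [Module k N]
    {f : Tot k A n →ₗ[k] N} (h : f ∘ₗ rotation k A n = f) : f ∘ₗ average k A n = f := by
  have h1 : ∀ i, f ∘ₗ totMap (rotate k A n i) = f := by
    intro i
    induction i with
    | zero => rw [rotate_zero]; rfl
    | succ i ih =>
      conv_rhs => rw [← h, ← ih, rotation_eq, LinearMap.comp_assoc, totMap_comp]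
      congr 2
      funext m
      rw [rotate_comp, Nat.add_comm]
  rw [average, LinearMap.comp_smul, comp_finsetSum, Finset.sum_congr rfl fun i _ => h1 i,
    Finset.sum_const, Finset.card_range, ← Nat.cast_smul_eq_nsmul k, smul_smul, inv_mul_cancel₀ hn,
    one_smul]

theorem average_totalDiff :
    average k A n ∘ₗ totalDiff k A n = totalDiff k A n ∘ₗ average k A n := by
  rw [average, LinearMap.smul_comp, LinearMap.comp_smul, finsetSum_comp, comp_finsetSum]
  congr 1
  exact Finset.sum_congr rfl fun i _ =>
    totMap_totalDiff (rotate_hochschildDiff i) (rotate_internalDiff i)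

theorem average_degree (e : ℤ) :
    (degreePart k A n e).map (average k A n) ≤ degreePart k A n e := by
  rintro _ ⟨x, hx, rfl⟩
  rw [average, LinearMap.smul_apply, LinearMap.sum_apply]
  exact Submodule.smul_mem _ _ (Submodule.sum_mem _ fun i _ =>
    totMap_degree (fun m e => cyclicOp_degree _ e) e ⟨x, hx, rfl⟩)

theorem rotation_totalDiff :
    rotation k A n ∘ₗ totalDiff k A n = totalDiff k A n ∘ₗ rotation k A n := by
  rw [rotation_eq]
  exact totMap_totalDiff (rotate_hochschildDiff 1) (rotate_internalDiff 1)

theorem totalF_rotation : totalF k A n ∘ₗ rotation k A n = totalF k A n := by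
  rw [rotation_eq]
  refine (totMap_comp (mapF k A n) _).trans ?_
  exact congrArg totMap (funext mapF_rotate)

theorem coinvProj_rotation : coinvProj k A n ∘ₗ rotation k A n = coinvProj k A n := by
  rw [← sub_eq_zero, ← LinearMap.comp_id (coinvProj k A n), LinearMap.comp_assoc,
    ← LinearMap.comp_sub, LinearMap.id_comp]
  exact LinearMap.range_mkQ_comp _

theorem totalPsi_totalDiff (hn : (n : k) ≠ 0) :
    totalDiff k A 1 ∘ₗ totalPsi k A n + totalPsi k A n ∘ₗ totalDiff k A 1 =
      totMap (mapF k A n) ∘ₗ totMap (mapG k A n) - LinearMap.id := by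
  have h0 : 0 < n := Nat.pos_of_ne_zero (NeZero.ne n)
  rw [totMap_comp, ← totMap_id, ← totMap_sub, totalPsi_eq]
  refine totRaise_totalDiff (fun m => ?_) ?_ (fun m => ?_)
  · rw [LinearMap.smul_comp, LinearMap.comp_smul]
    exact congrArg _ (chainLin_internalDiff _)
  · have h := congrArg chainLin ((chainOps k A).psi_boundary h0 0)
    -- In the lowest degree the second term of the homotopy relation is absent, its sum being empty.
    have h1 : (chainOps k A).psi n 0 = 0 := by simp [SimplicialOps.psi]
    rw [h1, Limits.comp_zero, add_zero, chainLin_comp, chainLin_boundary] at h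
    rw [mapF_mapG 0 hn, LinearMap.comp_smul]
    exact congrArg _ h
  · have h := congrArg chainLin ((chainOps k A).psi_boundary h0 (m + 1))
    rw [chainLin_add, chainLin_comp, chainLin_comp, chainLin_boundary, chainLin_boundary] at h
    rw [mapF_mapG (m + 1) hn, LinearMap.comp_smul, LinearMap.smul_comp, ← smul_add]
    exact congrArg _ h

variable (k A n) in
/-- The homotopy between the composite of `f` and `g` and the identity, on all matrices. -/
noncomputable def totalHomotopy : Tot k A n →ₗ[k] Tot k A n :=
  totRaise fun m => (n : k)⁻¹ • conjugate k A n
    ((chainOps k A).subdivisionHomotopy n (Nat.pos_of_ne_zero (NeZero.ne n)) (m + 1))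

theorem totalHomotopy_totalDiff (hn : (n : k) ≠ 0) :
    totalDiff k A n ∘ₗ totalHomotopy k A n + totalHomotopy k A n ∘ₗ totalDiff k A n =
      totMap (mapG k A n) ∘ₗ totMap (mapF k A n) - LinearMap.id := by
  have h0 : 0 < n := Nat.pos_of_ne_zero (NeZero.ne n)
  rw [totMap_comp, ← totMap_id, ← totMap_sub, totalHomotopy]
  refine totRaise_totalDiff (fun m => ?_) ?_ (fun m => ?_)
  · rw [LinearMap.smul_comp, LinearMap.comp_smul]
    exact congrArg _ (conjugate_internalDiff k A n _)
  · have h := (chainOps k A).subdivisionHomotopy_boundary h0 0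
    have h1 : (chainOps k A).subdivisionHomotopy n h0 0 = 0 := rfl
    rw [h1, Limits.comp_zero, add_zero] at h
    rw [mapG_mapF 0 hn, LinearMap.comp_smul, ← h, conjugate_comp, conjugate_blockBoundary]
  · have h := (chainOps k A).subdivisionHomotopy_boundary h0 (m + 1)
    rw [mapG_mapF (m + 1) hn, LinearMap.comp_smul, LinearMap.smul_comp, ← smul_add, ← h,
      conjugate_add, conjugate_comp, conjugate_comp, conjugate_blockBoundary,
      conjugate_blockBoundary]

theorem totalHomotopy_degree (e : ℤ) :
    (degreePart k A n e).map (totalHomotopy k A n) ≤ degreePart k A n (e - 1) :=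
  totRaise_degree (fun _ _ => smul_degree _ (conjugate_degree k A n _ _)) e

end rotations

end DGHochschild

/-! ### Descent to the coinvariants. -/

open DGHochschild in
theorem theorem3p2 (k : Type w) [Field k] (A : Type u) [Category.{v} A] [Preadditive A]
    [Linear k A] [DGCategory k A] (n : ℕ) [NeZero n] (hn : (n : k) ≠ 0) :
    -- the Hochschild complex of `A`, with `Ψ_n` of degree `-1`
    totalDiff k A 1 ∘ₗ totalDiff k A 1 = 0 ∧
    (∀ e, (degreePart k A 1 e).map (totalDiff k A 1) ≤ degreePart k A 1 (e + 1)) ∧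
    (∀ e, (degreePart k A 1 e).map (totalPsi k A n) ≤ degreePart k A 1 (e - 1)) ∧
    -- the differential and `f_n` descend to the coinvariants
    ∃ (D : Coinv k A n →ₗ[k] Coinv k A n) (f : Coinv k A n →ₗ[k] Tot k A 1),
      D ∘ₗ coinvProj k A n = coinvProj k A n ∘ₗ totalDiff k A n ∧
      f ∘ₗ coinvProj k A n = totalF k A n ∧
      D ∘ₗ D = 0 ∧
      (∀ e, ((degreePart k A n e).map (coinvProj k A n)).map D ≤
        (degreePart k A n (e + 1)).map (coinvProj k A n)) ∧
      -- `f_n` and `g_n` are morphisms of complexes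
      totalDiff k A 1 ∘ₗ f = f ∘ₗ D ∧
      D ∘ₗ totalG k A n = totalG k A n ∘ₗ totalDiff k A 1 ∧
      (∀ e, ((degreePart k A n e).map (coinvProj k A n)).map f ≤ degreePart k A 1 e) ∧
      (∀ e, (degreePart k A 1 e).map (totalG k A n) ≤
        (degreePart k A n e).map (coinvProj k A n)) ∧
      -- `d Ψ_n = f_n g_n - id`
      totalDiff k A 1 ∘ₗ totalPsi k A n + totalPsi k A n ∘ₗ totalDiff k A 1 =
        f ∘ₗ totalG k A n - LinearMap.id ∧
      -- `g_n f_n` is homotopic to the identity as well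
      ∃ Φ : Coinv k A n →ₗ[k] Coinv k A n,
        (∀ e, ((degreePart k A n e).map (coinvProj k A n)).map Φ ≤
          (degreePart k A n (e - 1)).map (coinvProj k A n)) ∧
        D ∘ₗ Φ + Φ ∘ₗ D = totalG k A n ∘ₗ f - LinearMap.id := by
  have hF : totMap (mapF k A n) ∘ₗ totalDiff k A n = totalDiff k A 1 ∘ₗ totMap (mapF k A n) :=
    totMap_totalDiff mapF_hochschildDiff mapF_internalDiff
  have hG : totMap (mapG k A n) ∘ₗ totalDiff k A 1 = totalDiff k A n ∘ₗ totMap (mapG k A n) :=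
    totMap_totalDiff mapG_hochschildDiff mapG_internalDiff
  have hH := totalHomotopy_totalDiff (A := A) hn
  have hFr := totalF_rotation (k := k) (A := A) (n := n)
  have hpr := coinvProj_rotation (k := k) (A := A) (n := n)
  have hFe : totalF k A n ∘ₗ average k A n = totalF k A n := comp_average hn hFr
  have hpe : coinvProj k A n ∘ₗ average k A n = coinvProj k A n := comp_average hn hpr
  have hker : ∀ {N : Type (max u v w)} [AddCommGroup N] [Module k N] {φ : Tot k A n →ₗ[k] N},
      φ ∘ₗ (rotation k A n - LinearMap.id) = 0 →
        LinearMap.range (rotation k A n - LinearMap.id) ≤ LinearMap.ker φ := fun h =>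
    LinearMap.range_le_ker_iff.2 h
  have hsurj : Function.Surjective (coinvProj k A n) := Submodule.mkQ_surjective _
  have hcancel : ∀ {N : Type (max u v w)} [AddCommGroup N] [Module k N]
      {φ ψ : Coinv k A n →ₗ[k] N}, φ ∘ₗ coinvProj k A n = ψ ∘ₗ coinvProj k A n → φ = ψ := fun h =>
    (LinearMap.cancel_right hsurj).1 h
  have hD0 : (coinvProj k A n ∘ₗ totalDiff k A n) ∘ₗ (rotation k A n - LinearMap.id) = 0 := by
    rw [LinearMap.comp_sub, LinearMap.comp_assoc, ← rotation_totalDiff, ← LinearMap.comp_assoc, hpr,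
      LinearMap.comp_id, sub_self]
  have hf0 : totalF k A n ∘ₗ (rotation k A n - LinearMap.id) = 0 := by
    rw [LinearMap.comp_sub, hFr, LinearMap.comp_id, sub_self]
  -- `totalHomotopy` is not known to commute with the rotation. Precomposed with the average it
  -- kills all `t ξ - ξ`, so it factors through the coinvariants.
  have hP0 : (coinvProj k A n ∘ₗ totalHomotopy k A n ∘ₗ average k A n) ∘ₗ
      (rotation k A n - LinearMap.id) = 0 := by
    rw [LinearMap.comp_assoc, LinearMap.comp_assoc, average_rotation_sub, LinearMap.comp_zero,
      LinearMap.comp_zero]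
  obtain ⟨D, hD⟩ : ∃ D : Coinv k A n →ₗ[k] Coinv k A n,
      D ∘ₗ coinvProj k A n = coinvProj k A n ∘ₗ totalDiff k A n :=
    ⟨Submodule.liftQ _ _ (hker hD0), Submodule.liftQ_mkQ _ _ _⟩
  obtain ⟨f, hf⟩ : ∃ f : Coinv k A n →ₗ[k] Tot k A 1, f ∘ₗ coinvProj k A n = totalF k A n :=
    ⟨Submodule.liftQ _ _ (hker hf0), Submodule.liftQ_mkQ _ _ _⟩
  obtain ⟨Φ, hΦ⟩ : ∃ Φ : Coinv k A n →ₗ[k] Coinv k A n, Φ ∘ₗ coinvProj k A n =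
      coinvProj k A n ∘ₗ totalHomotopy k A n ∘ₗ average k A n :=
    ⟨Submodule.liftQ _ _ (hker hP0), Submodule.liftQ_mkQ _ _ _⟩
  have hfG : f ∘ₗ totalG k A n = totMap (mapF k A n) ∘ₗ totMap (mapG k A n) := by
    calc f ∘ₗ totalG k A n = (f ∘ₗ coinvProj k A n) ∘ₗ totMap (mapG k A n) := rfl
      _ = _ := by rw [hf]; rfl
  refine ⟨totalDiff_totalDiff, totalDiff_degree, totalPsi_degree n, D, f, hD, hf, ?_, fun e => ?_, ?_,
    ?_, fun e => ?_, fun e => ?_, ?_, Φ, fun e => ?_, ?_⟩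
  · refine hcancel ?_
    rw [LinearMap.comp_assoc, hD, ← LinearMap.comp_assoc, hD, LinearMap.comp_assoc,
      totalDiff_totalDiff, LinearMap.comp_zero, LinearMap.zero_comp]
  · rw [← Submodule.map_comp, hD, Submodule.map_comp]
    exact Submodule.map_mono (totalDiff_degree e)
  · refine hcancel ?_
    rw [LinearMap.comp_assoc, hf, LinearMap.comp_assoc, hD, ← LinearMap.comp_assoc, hf]
    exact hF.symm
  · calc D ∘ₗ totalG k A n = (D ∘ₗ coinvProj k A n) ∘ₗ totMap (mapG k A n) := rfl
      _ = coinvProj k A n ∘ₗ (totalDiff k A n ∘ₗ totMap (mapG k A n)) := by rw [hD]; rfl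
      _ = _ := by rw [← hG]; rfl
  · rw [← Submodule.map_comp, hf]
    exact totMap_degree mapF_degree e
  · exact (Submodule.map_comp (totMap (mapG k A n)) (coinvProj k A n) _).trans_le
      (Submodule.map_mono (totMap_degree mapG_degree e))
  · rw [hfG]
    exact totalPsi_totalDiff hn
  · rw [← Submodule.map_comp, hΦ, Submodule.map_comp, Submodule.map_comp]
    exact Submodule.map_mono
      ((Submodule.map_mono (average_degree e)).trans (totalHomotopy_degree e))
  · refine hcancel ?_
    -- The average moves past the differential, so the relation `hH` on all matrices applies;
    -- afterwards `totalF` and the projection absorb the average.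
    calc (D ∘ₗ Φ + Φ ∘ₗ D) ∘ₗ coinvProj k A n
        = D ∘ₗ (Φ ∘ₗ coinvProj k A n) + Φ ∘ₗ (D ∘ₗ coinvProj k A n) := rfl
      _ = (D ∘ₗ coinvProj k A n) ∘ₗ totalHomotopy k A n ∘ₗ average k A n +
          (Φ ∘ₗ coinvProj k A n) ∘ₗ totalDiff k A n := by
            conv_lhs => rw [hΦ, hD]
            rfl
      _ = coinvProj k A n ∘ₗ totalDiff k A n ∘ₗ totalHomotopy k A n ∘ₗ average k A n +
          coinvProj k A n ∘ₗ totalHomotopy k A n ∘ₗ (average k A n ∘ₗ totalDiff k A n) := by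
            rw [hΦ, hD]; rfl
      _ = coinvProj k A n ∘ₗ (totalDiff k A n ∘ₗ totalHomotopy k A n +
          totalHomotopy k A n ∘ₗ totalDiff k A n) ∘ₗ average k A n := by
            rw [average_totalDiff, LinearMap.add_comp, LinearMap.comp_add]; rfl
      _ = coinvProj k A n ∘ₗ totMap (mapG k A n) ∘ₗ (totalF k A n ∘ₗ average k A n) -
          coinvProj k A n ∘ₗ average k A n := by
            rw [hH, LinearMap.sub_comp, LinearMap.comp_sub]; rfl
      _ = totalG k A n ∘ₗ (f ∘ₗ coinvProj k A n) - coinvProj k A n := by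
            rw [hFe, hpe, hf]; rfl
      _ = _ := by rw [LinearMap.sub_comp]; rfl
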